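/- **Setting.** Let $M=\mathbb R^4$ be Minkowski space with coordinates $x=(x^0,\mathbf x)$, metric of signature $(+,-,-,-)$, product $x\cdot y$ and flat derivative $\nabla$; $|x|=(|x^0|^2+|\mathbf x|^2)^{1/2}$ is the Euclidean norm, norms of tensors are Euclidean norms of their components, $|\nabla^\alpha f|$ with $|\alpha|=k$ refers to the derivatives of order $k$, and $\theta$ is the Heaviside function. For $\tau\in\mathbb R$, $\mathbf z\in\mathbb R^3$ put $\langle\tau\rangle=(\tau^2+1)^{1/2}$, $\langle z\rangle=(|\mathbf z|^2+1)^{1/2}$; the coordinates $(\tau,\mathbf z)$ of $x$ are defined by $x^0=\tau\langle z\rangle$, $\mathbf x=\langle\tau\rangle\mathbf z$. Let $0<\varepsilon<\frac12$. Call a current $J:M\to M$ *admissible* if it is of class $C^3$, conserved ($\nabla_aJ^a=0$), and $$|\nabla^\alpha J(x)|\le\frac{\mathrm{const}}{(|x|+1)^{3+|\alpha|}}\Big[\theta(x^2)+\frac1{(|x|+1)^{\varepsilon}}\Big]\ (|\alpha|\le3),\qquad |\nabla^\alpha(x\cdot\nabla+3)J(x)|\le\frac{\mathrm{const}}{(|x|+1)^{3+|\alpha|+\varepsilon}}\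 (|\alpha|\le2).$$ Its retarded and advanced potentials are $$A_{\mathrm{ret}/\mathrm{adv}}[J](x)=\int_{\mathbb R^3}\frac{J(x^0\mp|\mathbf u|,\mathbf x+\mathbf u)}{|\mathbf u|}\,d^3u,$$ and its radiated potential is $A_{\mathrm{rad}}[J]=A_{\mathrm{ret}}[J]-A_{\mathrm{adv}}[J]$. **Theorem.** Let $A=A_{\mathrm{ret}}[J]+A_{\mathrm{rad}}[J_{\mathrm{in}}]$ with admissible currents $J$, $J_{\mathrm{in}}$ (equivalently, $A=A_{\mathrm{adv}}[J]+A_{\mathrm{rad}}[J+J_{\mathrm{in}}]$), and let $C(x)=x\cdot A(x)$, $F_{ab}=\nabla_aA_b-\nabla_bA_a$. Then $A$ is of class $C^3$, and the following estimates hold for all $x\in M$, the last member of each chain being expressed in the coordinates $(\tau,\mathbf z)$ of $x$, with constants independent of $x$: $$|A(x)|,\ |\nabla\nabla A(x)|,\ |\nabla C(x)|\ \le\ \frac{\mathrm{const}}{|x|+1}\ \le\ \frac{\mathrm{const}}{\langle\tau\rangle\langle z\rangle},$$ $$|\nabla A(x)|\le\frac{\mathrm{const}}{|x|+1}\Big[\frac1{(||x^0|-|\mathbf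 x||+1)^{1+\varepsilon}}+\frac1{|x|+1}\Big]\le\frac{\mathrm{const}}{\langle\tau\rangle\langle z\rangle}\Big[\frac1{\langle\tau\rangle\langle z\rangle}+\Big(\frac{\langle\tau\rangle\langle z\rangle}{\langle\tau\rangle^2+\langle z\rangle^2}\Big)^{1+\varepsilon}\Big],$$ $$|\nabla\nabla C(x)|\le\frac{\mathrm{const}}{|x|+1}\Big[\frac1{(||x^0|-|\mathbf x||+1)^{1+\varepsilon}}+\frac1{(|x|+1)^{1/2}(||x^0|-|\mathbf x||+1)^{1/2}}\Big]$$ $$\le\frac{\mathrm{const}}{\langle\tau\rangle\langle z\rangle}\Big[\frac1{\langle\tau\rangle^{1/2}\langle z\rangle^{1/2}}\Big(\frac{\langle\tau\rangle\langle z\rangle}{\langle\tau\rangle^2+\langle z\rangle^2}\Big)^{1/2}+\Big(\frac{\langle\tau\rangle\langle z\rangle}{\langle\tau\rangle^2+\langle z\rangle^2}\Big)^{1+\varepsilon}\Big],$$ $$|(x\cdot\nabla+1)A(x)|,\ |\nabla(x\cdot\nabla C)(x)|\ \le\ \frac{\mathrm{const}}{(|x|+1)(||x^0|-|\mathbf x||+1)^{\varepsilon}}\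 \le\ \frac{\mathrm{const}}{\langle\tau\rangle\langle z\rangle}\Big(\frac{\langle\tau\rangle\langle z\rangle}{\langle\tau\rangle^2+\langle z\rangle^2}\Big)^{\varepsilon},$$ $$|(x\cdot\nabla)^kC(x)|\le\frac{\mathrm{const}}{(|x|+1)^{\varepsilon}}\le\frac{\mathrm{const}}{\langle\tau\rangle^{\varepsilon}\langle z\rangle^{\varepsilon}}\quad(k=1,2),\qquad |x^aF_{ab}(x)|\le\frac{\mathrm{const}}{|x|+1}\le\frac{\mathrm{const}}{\langle\tau\rangle\langle z\rangle}.$$ -/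

import Mathlib

noncomputable section

namespace ElectroDecay

/-- Three-dimensional Euclidean space, with its Euclidean norm. -/
abbrev Space : Type := EuclideanSpace ℝ (Fin 3)

/-- Minkowski space in a fixed Minkowski reference system, `x = (x⁰, x¹, x², x³)`.
The norm `‖x‖` is the Euclidean norm `|x| = (|x⁰|² + |𝐱|²)^{1/2}` of the coordinates. -/
abbrev Spacetime : Type := EuclideanSpace ℝ (Fin 4)

/-- The space part `𝐱` of `x`. -/
def spacePart (x : Spacetime) : Space := !₂[x 1, x 2, x 3]

/-- The spacetime point `(t, 𝐲)`. -/
def point (t : ℝ) (y : Space) : Spacetime := !₂[t, y 0, y 1, y 2]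

/-- The diagonal entries of the Minkowski metric, signature `(+,-,-,-)`. -/
def metric (a : Fin 4) : ℝ := if a = 0 then 1 else -1

/-- The Minkowski product `x · y`. -/
def minkowski (x y : Spacetime) : ℝ := ∑ a, metric a * x a * y a

/-- The factor `θ(x²)`, with `θ` the Heaviside function and `x² = x · x`. -/
def thetaSq (x : Spacetime) : ℝ := if 0 ≤ minkowski x x then 1 else 0

/-- The partial derivative `∇_a f`. -/
def partialD (a : Fin 4) (f : Spacetime → ℝ) (x : Spacetime) : ℝ :=
  fderiv ℝ f x (EuclideanSpace.single a 1)

/-- The operator `x · ∇ = x^a ∇_a` (differentiation in the direction of `x`). -/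
def xDeriv {E : Type*} [NormedAddCommGroup E] [NormedSpace ℝ E]
    (f : Spacetime → E) (x : Spacetime) : E :=
  fderiv ℝ f x x

/-- The divergence `∇_a J^a`. -/
def divergence (J : Spacetime → Spacetime) (x : Spacetime) : ℝ :=
  ∑ a, partialD a (fun y => J y a) x

/-- The retarded potential `4π ∫ D_ret(x - y) J(y) dy` with `D_ret(x) = (2π)⁻¹ θ(x⁰) δ(x²)`,
as an integral over the past light cone of `x`. -/
def retarded (J : Spacetime → Spacetime) (x : Spacetime) : Spacetime :=
  ∫ z : Space, ‖z‖⁻¹ • J (point (x 0 - ‖z‖) (spacePart x + z))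

/-- The advanced potential `4π ∫ D_adv(x - y) J(y) dy` with `D_adv(x) = (2π)⁻¹ θ(-x⁰) δ(x²)`,
as an integral over the future light cone of `x`. -/
def advanced (J : Spacetime → Spacetime) (x : Spacetime) : Spacetime :=
  ∫ z : Space, ‖z‖⁻¹ • J (point (x 0 + ‖z‖) (spacePart x + z))

/-- The radiated potential `A_rad = A_ret - A_adv` of the current `J`. -/
def radiated (J : Spacetime → Spacetime) (x : Spacetime) : Spacetime :=
  retarded J x - advanced J x

/-- The class of currents considered: conserved, of class `C³`, with the decay
`|∇^α J| ≤ const (|x|+1)^{-3-|α|} [θ(x²) + (|x|+1)^{-ε}]` for `|α| ≤ 3` and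
`|∇^α (x·∇+3) J| ≤ const (|x|+1)^{-3-|α|-ε}` for `|α| ≤ 2`. -/
structure AdmissibleCurrent (ε : ℝ) (J : Spacetime → Spacetime) : Prop where
  contDiff : ContDiff ℝ 3 J
  conserved : ∀ x, divergence J x = 0
  decay : ∀ k : ℕ, k ≤ 3 → ∃ c : ℝ, ∀ x,
    ‖iteratedFDeriv ℝ k J x‖ ≤
      c / (‖x‖ + 1) ^ (3 + k) * (thetaSq x + 1 / (‖x‖ + 1) ^ ε)
  homogeneous : ∀ k : ℕ, k ≤ 2 → ∃ c : ℝ, ∀ x,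
    ‖iteratedFDeriv ℝ k (fun y => xDeriv J y + (3 : ℝ) • J y) x‖ ≤
      c / (‖x‖ + 1) ^ (3 + (k : ℝ) + ε)

/-- `A` is the sum of the retarded potential of an admissible current and of the
radiated potential of another admissible current. -/
def ScatteringPotential (ε : ℝ) (A : Spacetime → Spacetime) : Prop :=
  ∃ J Jin : Spacetime → Spacetime, AdmissibleCurrent ε J ∧ AdmissibleCurrent ε Jin ∧
    ∀ x, A x = retarded J x + radiated Jin x

/-- The scalar field `C(x) = x · A(x)`. -/
def scalarC (A : Spacetime → Spacetime) (x : Spacetime) : ℝ := minkowski x (A x)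

/-- The field `F_{ab} = ∇_a A_b - ∇_b A_a`, with `A_b` the covariant components of `A`. -/
def fieldF (A : Spacetime → Spacetime) (a b : Fin 4) (x : Spacetime) : ℝ :=
  partialD a (fun y => metric b * A y b) x - partialD b (fun y => metric a * A y a) x

/-- The covector `x^a F_{ab}(x)`. -/
def xF (A : Spacetime → Spacetime) (x : Spacetime) : EuclideanSpace ℝ (Fin 4) :=
  WithLp.toLp 2 fun b => ∑ a, x a * fieldF A a b x

/-- `⟨τ⟩ = (τ² + 1)^{1/2}` and `⟨𝐳⟩ = (|𝐳|² + 1)^{1/2}`. -/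
def bracket {E : Type*} [NormedAddCommGroup E] (v : E) : ℝ := √(‖v‖ ^ 2 + 1)

/-- The point `x` with coordinates `(τ, 𝐳)`: `x⁰ = τ⟨𝐳⟩`, `𝐱 = ⟨τ⟩𝐳`. -/
def coord (τ : ℝ) (z : Space) : Spacetime := point (τ * bracket z) (bracket τ • z)

/-- `|x| + 1`. -/
def wPlus (x : Spacetime) : ℝ := ‖x‖ + 1

/-- `||x⁰| - |𝐱|| + 1`. -/
def wMinus (x : Spacetime) : ℝ := |(|x 0| - ‖spacePart x‖)| + 1

/-- `⟨τ⟩⟨𝐳⟩`. -/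
def prodB (τ : ℝ) (z : Space) : ℝ := bracket τ * bracket z

/-- `⟨τ⟩⟨𝐳⟩ / (⟨τ⟩² + ⟨𝐳⟩²)`. -/
def ratioB (τ : ℝ) (z : Space) : ℝ := prodB τ z / (bracket τ ^ 2 + bracket z ^ 2)

/-- The chain of estimates `f ≤ const · B ≤ const · b`: the first inequality at all points `x`,
the second one in the coordinates `(τ, 𝐳)` of `x`. -/
def ChainBound (f B : Spacetime → ℝ) (b : ℝ → Space → ℝ) : Prop :=
  ∃ K₁ K₂ : ℝ, (∀ x, f x ≤ K₁ * B x) ∧ ∀ τ z, K₁ * B (coord τ z) ≤ K₂ * b τ z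

end ElectroDecay

end

/-! Everything reduces to retarded integrals `ret f x = ∫ |u|⁻¹ f(x + nul u) du` over the past light
cone of `x`. Time reflection preserves admissibility and all the bounds, and it turns advanced
potentials into retarded ones. Hence `A` is a combination of two retarded potentials and one
reflected retarded potential (`potentialBounds_scattering`), and the core is `potentialBounds_ret`.
Write s = x⁰ - |𝐱| for the retarded time and y for a point of the past cone of `x`.

Size bounds. One always has |s| ≤ 2|y|. If |x| is controlled by |s|, power counting is enough.
Otherwise `x` is near the future light cone and only the shell |u| ~ |𝐱| is delicate. There a weight
of order three would cost a logarithm, but θ(y²) confines the integration to two paraboloids about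
the axis of 𝐱, of width b = 1 + |s|, over which (b + |𝐲|)⁻³ has an integral bounded independently of
b (`theta_paraboloid`, `domInt_parab`).

The scalar C. For conserved K the difference between x · ret K and ret (y · K) is the flux of K
through the past cone. The flux does not change under time translation, and for decay faster than
order three it tends to zero at late times, so it vanishes (`flux_eq_zero`, `minkowski_ret`). The
current J decays too slowly for this, but its derivatives and (x·∇+3)J are conserved and decay fast
enough. With the scaling identity (x·∇+1) ret f = ret ((x·∇+3) f) this gives ∇C = ret ∇(y·J) and
x·∇C = ret (y·(y·∇+3)J). All the estimates on derivatives of A and C except those of ∇A and ∇∇C then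
follow from size bounds.

The gradients. Both ∇A and ∇∇C are gradients of `ret f`, where f has order three, is smaller outside
the light cone, and is nearly homogeneous of degree -3. Scaling and integration by parts express s
∂₀ ret f through ret ((x·∇+3) f) and two cone integrals whose kernels vanish at 𝐱 + 𝐮 = 0
(`retTime_smul_fderiv`). Smallness outside the light cone bounds f inside by its distance to the
cone (`coneDecays_dist`), and timelike points of the past cone of `x` have distance at most |s|
(`timelike_dist_le`). This gains |s|/|x|, and division by s gives the estimate
(`norm_fderiv_ret_near`). -/

noncomputable section

open MeasureTheory Set Filter Topology

namespace ElectroDecay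

set_option linter.unusedSectionVars false

variable {E F : Type*} [NormedAddCommGroup E] [NormedSpace ℝ E] [NormedAddCommGroup F]
  [NormedSpace ℝ F]

/-! ### Geometry of the past light cone -/

/-- The point of the past light cone of the origin over `u`. -/
def nul (u : Space) : Spacetime := point (-‖u‖) u

@[simp] lemma point_zero (t : ℝ) (y : Space) : point t y 0 = t := rfl

@[simp] lemma spacePart_point (t : ℝ) (y : Space) : spacePart (point t y) = y := by
  ext i; fin_cases i <;> rfl

@[simp] lemma spacePart_add (x y : Spacetime) : spacePart (x + y) = spacePart x + spacePart y := by
  ext i; fin_cases i <;> simp [spacePart]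

lemma point_eta (x : Spacetime) : point (x 0) (spacePart x) = x := by
  ext i; fin_cases i <;> rfl

lemma point_add (s t : ℝ) (y z : Space) : point (s + t) (y + z) = point s y + point t z := by
  ext i; fin_cases i <;> simp [point]

lemma point_smul (c t : ℝ) (y : Space) : point (c * t) (c • y) = c • point t y := by
  ext i; fin_cases i <;> simp [point]

lemma spacetime_ext {x y : Spacetime} (h₀ : x 0 = y 0) (h₁ : spacePart x = spacePart y) : x = y := by
  rw [← point_eta x, ← point_eta y, h₀, h₁]

lemma norm_sq_split (x : Spacetime) : ‖x‖ ^ 2 = x 0 ^ 2 + ‖spacePart x‖ ^ 2 := by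
  simp [EuclideanSpace.norm_sq_eq, Fin.sum_univ_four, Fin.sum_univ_three, spacePart]
  ring

lemma minkowski_self (x : Spacetime) : minkowski x x = x 0 ^ 2 - ‖spacePart x‖ ^ 2 := by
  simp [minkowski, metric, EuclideanSpace.norm_sq_eq, Fin.sum_univ_four, Fin.sum_univ_three, spacePart]
  ring

lemma abs_time_le (x : Spacetime) : |x 0| ≤ ‖x‖ := by
  apply abs_le_of_sq_le_sq _ (norm_nonneg _)
  have := norm_sq_split x
  nlinarith [sq_nonneg ‖spacePart x‖]

lemma norm_spacePart_le (x : Spacetime) : ‖spacePart x‖ ≤ ‖x‖ := by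
  apply le_of_sq_le_sq _ (norm_nonneg _)
  have := norm_sq_split x
  nlinarith [sq_nonneg (x 0)]

lemma norm_le_add_split (x : Spacetime) : ‖x‖ ≤ |x 0| + ‖spacePart x‖ := by
  apply le_of_sq_le_sq _ (by positivity)
  have := norm_sq_split x
  have h := sq_abs (x 0)
  nlinarith [mul_nonneg (abs_nonneg (x 0)) (norm_nonneg (spacePart x))]

lemma thetaSq_nonneg (x : Spacetime) : 0 ≤ thetaSq x := by unfold thetaSq; split_ifs <;> norm_num

lemma thetaSq_le_one (x : Spacetime) : thetaSq x ≤ 1 := by unfold thetaSq; split_ifs <;> norm_num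

lemma thetaSq_eq_one {x : Spacetime} (h : ‖spacePart x‖ ≤ |x 0|) : thetaSq x = 1 := by
  have : 0 ≤ minkowski x x := by
    rw [minkowski_self, ← sq_abs (x 0)]
    nlinarith [norm_nonneg (spacePart x)]
  simp [thetaSq, this]

lemma thetaSq_eq_zero {x : Spacetime} (h : |x 0| < ‖spacePart x‖) : thetaSq x = 0 := by
  have : ¬ 0 ≤ minkowski x x := by
    rw [minkowski_self, ← sq_abs (x 0)]
    nlinarith [abs_nonneg (x 0)]
  simp [thetaSq, this]

@[simp] lemma nul_zero_apply (u : Space) : nul u 0 = -‖u‖ := rfl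

@[simp] lemma spacePart_nul (u : Space) : spacePart (nul u) = u := spacePart_point _ _

lemma nul_smul {c : ℝ} (hc : 0 ≤ c) (u : Space) : nul (c • u) = c • nul u := by
  rw [nul, nul, ← point_smul, norm_smul, Real.norm_of_nonneg hc, mul_neg]

lemma point_sub_norm (x : Spacetime) (u : Space) :
    point (x 0 - ‖u‖) (spacePart x + u) = x + nul u := by
  rw [sub_eq_add_neg, point_add, point_eta]; rfl

/-- Converts decay in spacetime into decay in `u`, locally uniformly in `x`. Only the space part of
`y` enters, so the same majorant serves the light cone and its regularisations. -/
lemma one_add_norm_le (x : Spacetime) (u : Space) {y : Spacetime} (hy : spacePart y = u) :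
    1 + ‖u‖ ≤ (1 + ‖x‖) * (1 + ‖x + y‖) := by
  have h1 : ‖u‖ ≤ ‖y‖ := hy ▸ norm_spacePart_le y
  have h2 : ‖y‖ ≤ ‖x + y‖ + ‖x‖ := by
    simpa using norm_sub_le (x + y) x
  nlinarith [norm_nonneg x, norm_nonneg (x + y)]

/-- The retarded time `x⁰ - |𝐱|`. -/
def retTime (x : Spacetime) : ℝ := x 0 - ‖spacePart x‖

lemma abs_norm_sub_le_cone (x : Spacetime) (u : Space) :
    |‖u‖ - ‖spacePart x‖| ≤ ‖spacePart (x + nul u)‖ := by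
  have := abs_norm_sub_norm_le u (-spacePart x)
  simpa [add_comm] using this

/-- The retarded time is the sum of the time of the cone point and of the defect |u| - |𝐱|, which
its space part dominates. Hence the past cone of `x` stays away from the origin by a multiple of the
retarded time. -/
lemma abs_retTime_le_cone (x : Spacetime) (u : Space) :
    |retTime x| ≤ |(x + nul u) 0| + ‖spacePart (x + nul u)‖ := by
  have h := abs_norm_sub_le_cone x u
  have e : retTime x = (x + nul u) 0 + (‖u‖ - ‖spacePart x‖) := by simp [retTime]; ring
  rw [e]
  exact (abs_add_le _ _).trans (by gcongr)

lemma abs_retTime_le (x : Spacetime) (u : Space) : |retTime x| ≤ 2 * ‖x + nul u‖ := by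
  have := abs_retTime_le_cone x u
  linarith [abs_time_le (x + nul u), norm_spacePart_le (x + nul u)]

/-- On the past light cone of `x`, timelike points lie close to the light cone of the origin. -/
lemma timelike_dist_le (x : Spacetime) (u : Space) :
    |(x + nul u) 0| - ‖spacePart (x + nul u)‖ ≤ |retTime x| := by
  have h1 : ‖spacePart x‖ ≤ ‖spacePart (x + nul u)‖ + ‖u‖ := by
    have := norm_sub_le (spacePart x + u) u
    simpa using this
  have h2 : ‖u‖ ≤ ‖spacePart (x + nul u)‖ + ‖spacePart x‖ := by
    have := norm_sub_le (spacePart x + u) (spacePart x)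
    simpa using this
  have e : (x + nul u) 0 = x 0 - ‖u‖ := by simp; ring
  rw [e] at *
  unfold retTime
  rcases abs_cases (x 0 - ‖u‖) with h3 | h3 <;> rcases abs_cases (x 0 - ‖spacePart x‖) with h4 | h4 <;>
    linarith

lemma wPlus_pos (x : Spacetime) : 0 < wPlus x := by unfold wPlus; positivity

lemma one_le_wMinus (x : Spacetime) : 1 ≤ wMinus x := by
  unfold wMinus; linarith [abs_nonneg (|x 0| - ‖spacePart x‖)]

lemma wMinus_le (x : Spacetime) : wMinus x ≤ 1 + |retTime x| := by
  have h := abs_abs_sub_abs_le (x 0) ‖spacePart x‖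
  rw [abs_of_nonneg (norm_nonneg (spacePart x))] at h
  unfold wMinus retTime; linarith

lemma wMinus_le_wPlus (x : Spacetime) : wMinus x ≤ wPlus x := by
  unfold wMinus wPlus
  have := abs_time_le x
  have := norm_spacePart_le x
  have : |(|x 0| - ‖spacePart x‖)| ≤ ‖x‖ := by
    rw [abs_le]; constructor <;> linarith [abs_nonneg (x 0), norm_nonneg (spacePart x)]
  linarith

/-- Away from the future light cone the retarded time controls `|x|`; near it, `|𝐱|` does. -/
lemma far_or_near (x : Spacetime) : wPlus x ≤ 6 * (1 + |retTime x|) ∨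
    (1 < ‖spacePart x‖ ∧ |retTime x| < ‖spacePart x‖ / 2 ∧ wPlus x ≤ 4 * ‖spacePart x‖) := by
  have h := norm_le_add_split x
  have h2 : |x 0| ≤ |retTime x| + ‖spacePart x‖ := by
    have := abs_add_le (retTime x) ‖spacePart x‖
    rw [abs_of_nonneg (norm_nonneg (spacePart x))] at this
    simpa [retTime] using this
  by_cases h3 : |retTime x| < ‖spacePart x‖ / 2
  · by_cases h4 : 1 < ‖spacePart x‖
    · right; refine ⟨h4, h3, ?_⟩; unfold wPlus; linarith
    · left; unfold wPlus; linarith [abs_nonneg (retTime x)]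
  · left; unfold wPlus; linarith [abs_nonneg (retTime x)]

/-! ### Dominated integrals over space -/

/-- The function `k` has an integrable majorant with integral at most `b`. -/
def DomInt (k : Space → ℝ) (b : ℝ) : Prop :=
  ∃ G : Space → ℝ, Integrable G ∧ (∀ u, k u ≤ G u) ∧ ∫ u, G u ≤ b

lemma DomInt.mono {k k' : Space → ℝ} {b b' : ℝ} (h : DomInt k b) (hk : ∀ u, k' u ≤ k u)
    (hb : b ≤ b') : DomInt k' b' := by
  obtain ⟨G, h1, h2, h3⟩ := h
  exact ⟨G, h1, fun u => (hk u).trans (h2 u), h3.trans hb⟩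

lemma DomInt.add {k k' : Space → ℝ} {b b' : ℝ} (h : DomInt k b) (h' : DomInt k' b') :
    DomInt (fun u => k u + k' u) (b + b') := by
  obtain ⟨G, h1, h2, h3⟩ := h
  obtain ⟨G', h1', h2', h3'⟩ := h'
  refine ⟨fun u => G u + G' u, h1.add h1', fun u => add_le_add (h2 u) (h2' u), ?_⟩
  rw [integral_add h1 h1']; exact add_le_add h3 h3'

lemma DomInt.const_mul {k : Space → ℝ} {b c : ℝ} (hc : 0 ≤ c) (h : DomInt k b) :
    DomInt (fun u => c * k u) (c * b) := by
  obtain ⟨G, h1, h2, h3⟩ := h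
  refine ⟨fun u => c * G u, h1.const_mul c, fun u => mul_le_mul_of_nonneg_left (h2 u) hc, ?_⟩
  rw [integral_const_mul]; exact mul_le_mul_of_nonneg_left h3 hc

/-- Neither `F` nor `k` has to be measurable. This is the benefit of carrying a majorant: weights
containing `thetaSq` never need a measurability proof. -/
lemma DomInt.norm_integral_le {E : Type*} [NormedAddCommGroup E] [NormedSpace ℝ E]
    {k : Space → ℝ} {b : ℝ} (h : DomInt k b) {F : Space → E} (hF : ∀ u, ‖F u‖ ≤ k u) :
    ‖∫ u, F u‖ ≤ b := by
  obtain ⟨G, h1, h2, h3⟩ := h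
  exact (norm_integral_le_of_norm_le h1 (Eventually.of_forall fun u => (hF u).trans (h2 u))).trans h3

lemma Integrable.domInt {G : Space → ℝ} (h : Integrable G) : DomInt G (∫ u, G u) :=
  ⟨G, h, fun _ => le_rfl, le_rfl⟩

/-- The model weight `|u|^{-k} (a + |u|)^{-p}`. -/
def radial (k p a : ℝ) (u : Space) : ℝ := ‖u‖ ^ (-k) * (a + ‖u‖) ^ (-p)

/-- The integral of the model weight at scale one. -/
def radialConst (k p : ℝ) : ℝ := ∫ u, radial k p 1 u

lemma radial_nonneg {k p a : ℝ} (ha : 0 ≤ a) (u : Space) : 0 ≤ radial k p a u := by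
  unfold radial; positivity

lemma radialConst_nonneg (k p : ℝ) : 0 ≤ radialConst k p :=
  integral_nonneg fun u => radial_nonneg zero_le_one u

lemma integrable_radial_one {k p : ℝ} (hk : k < 3) (hkp : 3 < k + p) :
    Integrable (radial k p 1) := by
  have key := integrable_fun_norm_addHaar (volume : Measure Space)
    (f := fun t : ℝ => t ^ (-k) * (1 + t) ^ (-p))
  refine key.mpr ?_
  simp only [finrank_euclideanSpace, Fintype.card_fin, smul_eq_mul]
  rw [← Ioc_union_Ioi_eq_Ioi (zero_le_one' ℝ)]
  have meas : Measurable fun t : ℝ => t ^ (3 - 1) * (t ^ (-k) * (1 + t) ^ (-p)) := by fun_prop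
  have e : ∀ t : ℝ, 0 < t → t ^ (3 - 1) * t ^ (-k) = t ^ (2 - k) := fun t ht => by
    rw [sub_eq_add_neg, Real.rpow_add ht]; norm_num
  refine IntegrableOn.union ?_ ?_
  · have h1 : IntegrableOn (fun t : ℝ => t ^ (2 - k)) (Ioc 0 1) := by
      have := intervalIntegral.intervalIntegrable_rpow' (a := 0) (b := 1) (r := 2 - k) (by linarith)
      rwa [intervalIntegrable_iff_integrableOn_Ioc_of_le zero_le_one] at this
    refine h1.mono' meas.aestronglyMeasurable ?_
    refine (ae_restrict_iff' measurableSet_Ioc).mpr (Eventually.of_forall fun t ht => ?_)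
    have ht0 : 0 < t := ht.1
    rw [Real.norm_of_nonneg (by positivity), ← mul_assoc, e t ht0]
    exact mul_le_of_le_one_right (by positivity)
      (Real.rpow_le_one_of_one_le_of_nonpos (by linarith) (by linarith))
  · have h1 : IntegrableOn (fun t : ℝ => t ^ (2 - k - p)) (Ioi 1) :=
      integrableOn_Ioi_rpow_of_lt (by linarith) zero_lt_one
    refine h1.mono' meas.aestronglyMeasurable ?_
    refine (ae_restrict_iff' measurableSet_Ioi).mpr (Eventually.of_forall fun t ht => ?_)
    have ht0 : 0 < t := zero_lt_one.trans ht
    rw [Real.norm_of_nonneg (by positivity), ← mul_assoc, e t ht0, sub_eq_add_neg (2 - k) p,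
      Real.rpow_add ht0]
    exact mul_le_mul_of_nonneg_left
      (Real.rpow_le_rpow_of_nonpos ht0 (by linarith) (by linarith)) (by positivity)

lemma radial_eq_scale {a : ℝ} (ha : 0 < a) (k p : ℝ) (u : Space) :
    radial k p a u = a ^ (-k - p) * radial k p 1 (a⁻¹ • u) := by
  have h1 : ‖u‖ = a * ‖a⁻¹ • u‖ := by
    rw [norm_smul, Real.norm_of_nonneg (by positivity)]; field_simp
  have h2 : a + ‖u‖ = a * (1 + ‖a⁻¹ • u‖) := by rw [h1]; ring
  unfold radial
  rw [h2, h1, Real.mul_rpow ha.le (norm_nonneg _), Real.mul_rpow ha.le (by positivity),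
    sub_eq_add_neg, Real.rpow_add ha]
  ring

lemma integrable_radial {k p a : ℝ} (ha : 0 < a) (hp : 0 ≤ p) (hk : k < 3) (hkp : 3 < k + p) :
    Integrable (radial k p a) := by
  have := ((integrable_radial_one hk hkp).comp_smul (R := a⁻¹) (by positivity)).const_mul
    (a ^ (-k - p))
  exact this.congr (Eventually.of_forall fun u => (radial_eq_scale ha k p u).symm)

lemma integral_radial {a : ℝ} (ha : 0 < a) (k p : ℝ) :
    ∫ u, radial k p a u = a ^ (3 - k - p) * radialConst k p := by
  simp_rw [radial_eq_scale ha k p]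
  rw [integral_const_mul, Measure.integral_comp_smul, ← radialConst, smul_eq_mul, ← mul_assoc]
  congr 1
  rw [finrank_euclideanSpace, Fintype.card_fin, abs_of_nonneg (by positivity), inv_pow, inv_inv,
    ← Real.rpow_natCast a 3, ← Real.rpow_add ha]
  congr 1; push_cast; ring

lemma domInt_radial {k p a : ℝ} (ha : 0 < a) (hp : 0 ≤ p) (hk : k < 3) (hkp : 3 < k + p) :
    DomInt (radial k p a) (a ^ (3 - k - p) * radialConst k p) :=
  ⟨_, integrable_radial ha hp hk hkp, fun _ => le_rfl, (integral_radial ha k p).le⟩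

/-- Translation of a majorant. -/
lemma DomInt.comp_add {k : Space → ℝ} {b : ℝ} (h : DomInt k b) (w : Space) :
    DomInt (fun u => k (w + u)) b := by
  obtain ⟨G, h1, h2, h3⟩ := h
  refine ⟨fun u => G (w + u), h1.comp_add_left w, fun u => h2 _, ?_⟩
  rwa [integral_add_left_eq_self]

lemma DomInt.comp_isometry {k : Space → ℝ} {b : ℝ} (h : DomInt k b) (e : Space ≃ₗᵢ[ℝ] Space) :
    DomInt (fun u => k (e u)) b := by
  obtain ⟨G, h1, h2, h3⟩ := h
  have mp := e.measurePreserving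
  refine ⟨fun u => G (e u), mp.integrable_comp_of_integrable h1, fun u => h2 _, ?_⟩
  rwa [mp.integral_comp e.toHomeomorph.measurableEmbedding]

lemma DomInt.comp_smul {k : Space → ℝ} {b : ℝ} (h : DomInt k b) {a : ℝ} (ha : 0 < a) :
    DomInt (fun u => k (a⁻¹ • u)) (a ^ 3 * b) := by
  obtain ⟨G, h1, h2, h3⟩ := h
  refine ⟨fun u => G (a⁻¹ • u), h1.comp_smul (by positivity), fun u => h2 _, ?_⟩
  rw [Measure.integral_comp_smul, finrank_euclideanSpace, Fintype.card_fin,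
    abs_of_nonneg (by positivity), inv_pow, inv_inv, smul_eq_mul]
  gcongr

/-! ### Integrals over paraboloids -/

/-- The weight `(b + |y|)^{-3}` on the paraboloid `|y| - ⟨y, ω⟩ ≤ 6 b`. -/
def parab (ω : Space) (b : ℝ) (y : Space) : ℝ :=
  if ‖y‖ - inner ℝ ω y ≤ 6 * b then (b + ‖y‖) ^ (-3 : ℝ) else 0

/-- Inside the paraboloid the two transverse coordinates are of order √ρ, ρ = |y|, so the product of
the three factors 1 + |yᵢ| is at most of order (1 + ρ)². Raising it to the power -3/2 dominates (1 +
ρ)⁻³ by a product of integrable functions of one variable. -/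
lemma parab_axis_le (y : Space) : parab (EuclideanSpace.single 0 1) 1 y ≤
    10000 * ((1 + ‖y 0‖) ^ (-(3 / 2) : ℝ) * (1 + ‖y 1‖) ^ (-(3 / 2) : ℝ) *
      (1 + ‖y 2‖) ^ (-(3 / 2) : ℝ)) := by
  unfold parab
  split_ifs with h
  · have hin : inner ℝ (EuclideanSpace.single 0 1) y = y 0 := by
      simp [EuclideanSpace.inner_single_left]
    rw [hin] at h
    set ρ := ‖y‖ with hρ
    have hρ0 : 0 ≤ ρ := norm_nonneg _
    have hsq : ρ ^ 2 = y 0 ^ 2 + y 1 ^ 2 + y 2 ^ 2 := by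
      rw [hρ, EuclideanSpace.norm_sq_eq]; simp [Fin.sum_univ_three]
    have h0 : |y 0| ≤ ρ := abs_le_of_sq_le_sq (by nlinarith) hρ0
    have key : ∀ t : ℝ, t ^ 2 ≤ ρ ^ 2 - y 0 ^ 2 → 1 + |t| ≤ 6 * (1 + ρ) ^ (1 / 2 : ℝ) := by
      intro t ht
      rw [← Real.sqrt_eq_rpow]
      have hs : √(1 + ρ) ^ 2 = 1 + ρ := Real.sq_sqrt (by positivity)
      have : 1 ≤ √(1 + ρ) := Real.one_le_sqrt.mpr (by linarith)
      -- Here ρ² - y₀² = (ρ - y₀)(ρ + y₀) ≤ 6 · 2ρ, below 25 (1 + ρ).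
      have h3 : |t| ≤ 5 * √(1 + ρ) := by
        apply le_of_sq_le_sq _ (by positivity)
        rw [sq_abs, mul_pow, hs]
        nlinarith [abs_le.mp h0, le_abs_self (y 0)]
      linarith
    have h1 := key (y 1) (by nlinarith)
    have h2 := key (y 2) (by nlinarith)
    have h0' : 1 + |y 0| ≤ 1 + ρ := by linarith
    have hP : (1 + |y 0|) * (1 + |y 1|) * (1 + |y 2|) ≤ 36 * (1 + ρ) ^ 2 := by
      calc _ ≤ (1 + ρ) * (6 * (1 + ρ) ^ (1 / 2 : ℝ)) * (6 * (1 + ρ) ^ (1 / 2 : ℝ)) := by gcongr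
        _ = 36 * (1 + ρ) * ((1 + ρ) ^ (1 / 2 : ℝ) * (1 + ρ) ^ (1 / 2 : ℝ)) := by ring
        _ = _ := by rw [← Real.rpow_add (by positivity)]; norm_num; ring
    simp only [Real.norm_eq_abs]
    rw [← Real.mul_rpow (by positivity) (by positivity), ← Real.mul_rpow (by positivity) (by positivity)]
    calc (1 + ρ) ^ (-3 : ℝ) = 36 ^ (3 / 2 : ℝ) * (36 * (1 + ρ) ^ 2) ^ (-(3 / 2) : ℝ) := by
          rw [Real.mul_rpow (by norm_num) (by positivity), ← mul_assoc, ← Real.rpow_add (by norm_num),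
            ← Real.rpow_natCast, ← Real.rpow_mul (by positivity)]
          norm_num
      _ ≤ 36 ^ (3 / 2 : ℝ) * ((1 + |y 0|) * (1 + |y 1|) * (1 + |y 2|)) ^ (-(3 / 2) : ℝ) := by
          gcongr 36 ^ (3 / 2 : ℝ) * ?_
          exact Real.rpow_le_rpow_of_nonpos (by positivity) hP (by norm_num)
      _ ≤ _ := by
          gcongr
          calc (36 : ℝ) ^ (3 / 2 : ℝ) ≤ 36 ^ (2 : ℝ) :=
                Real.rpow_le_rpow_of_exponent_le (by norm_num) (by norm_num)
            _ ≤ 10000 := by norm_num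
  · positivity

lemma domInt_parab_axis : ∃ V : ℝ, DomInt (parab (EuclideanSpace.single 0 1) 1) V := by
  have h1 : Integrable (fun t : ℝ => (1 + ‖t‖) ^ (-(3 / 2) : ℝ)) :=
    integrable_one_add_norm (by simp; norm_num)
  have h2 : Integrable (fun y : Fin 3 → ℝ => ∏ i, (fun t : ℝ => (1 + ‖t‖) ^ (-(3 / 2) : ℝ)) (y i)) :=
    Integrable.fintype_prod fun _ => h1
  have h3 := (EuclideanSpace.volume_preserving_symm_measurableEquiv_toLp (Fin 3)).integrable_comp_of_integrable h2
  refine ⟨_, (Integrable.domInt (h3.const_mul 10000)).mono (fun y => (parab_axis_le y).trans ?_) le_rfl⟩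
  simp only [Function.comp, Fin.prod_univ_three]
  rfl

lemma exists_isometry_map_axis {ω : Space} (hω : ‖ω‖ = 1) :
    ∃ e : Space ≃ₗᵢ[ℝ] Space, e ω = EuclideanSpace.single 0 1 :=
  ⟨_, Submodule.reflection_sub (by simp [hω])⟩

/-- The weight (b + |y|)⁻³ d³y is scale invariant and the width 6b scales along with it, so dilation
by b and an isometry moving ω to the first axis reduce to one fixed integral. The independence of b
is what removes the logarithm. -/
lemma domInt_parab : ∃ V : ℝ, ∀ ω : Space, ‖ω‖ = 1 → ∀ b : ℝ, 0 < b → DomInt (parab ω b) V := by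
  obtain ⟨V, hV⟩ := domInt_parab_axis
  refine ⟨V, fun ω hω b hb => ?_⟩
  obtain ⟨e, he⟩ := exists_isometry_map_axis hω
  have := ((hV.comp_isometry e).comp_smul hb).const_mul (c := b ^ (-3 : ℝ)) (by positivity)
  refine this.mono (fun y => le_of_eq ?_) (le_of_eq ?_)
  · have hin : inner ℝ (EuclideanSpace.single 0 1) (e (b⁻¹ • y)) = b⁻¹ * inner ℝ ω y := by
      rw [← he, e.inner_map_map, inner_smul_right]
    unfold parab
    rw [hin, e.norm_map, norm_smul, Real.norm_of_nonneg (by positivity)]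
    have hiff : b⁻¹ * ‖y‖ - b⁻¹ * inner ℝ ω y ≤ 6 * 1 ↔ ‖y‖ - inner ℝ ω y ≤ 6 * b := by
      rw [← mul_sub, inv_mul_le_iff₀ hb, mul_one, mul_comm]
    simp only [hiff]
    split_ifs
    · rw [← Real.mul_rpow hb.le (by positivity)]
      congr 1; field_simp
    · simp
  · rw [← mul_assoc, ← Real.rpow_natCast b 3, ← Real.rpow_add hb]; norm_num

/-! ### Integrals over the past light cone -/

lemma DomInt.mono_ae {k k' : Space → ℝ} {b b' : ℝ} (h : DomInt k b) (hk : k' ≤ᵐ[volume] k)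
    (hb : b ≤ b') : DomInt k' b' := by
  classical
  obtain ⟨G, h1, h2, h3⟩ := h
  -- `DomInt` asks for a bound at every point, so the majorant is altered on the exceptional null
  -- set.
  have e : (fun u => if k' u ≤ G u then G u else k' u) =ᵐ[volume] G := by
    filter_upwards [hk] with u hu
    rw [if_pos (hu.trans (h2 u))]
  refine ⟨fun u => if k' u ≤ G u then G u else k' u, h1.congr e.symm, fun u => ?_, ?_⟩
  · dsimp only; split_ifs with h <;> simp [h]
  · rw [integral_congr_ae e]; exact h3.trans hb

/-- The weight `(1 + |y|)^{-p}`. -/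
def wt (p : ℝ) (y : Spacetime) : ℝ := (1 + ‖y‖) ^ (-p)

lemma wt_nonneg (p : ℝ) (y : Spacetime) : 0 ≤ wt p y := by unfold wt; positivity

lemma wt_add (p q : ℝ) (y : Spacetime) : wt (p + q) y = wt p y * wt q y := by
  unfold wt; rw [neg_add, Real.rpow_add (by positivity)]

lemma wt_anti {p q : ℝ} (h : p ≤ q) (y : Spacetime) : wt q y ≤ wt p y :=
  Real.rpow_le_rpow_of_exponent_le (by linarith [norm_nonneg y]) (by linarith)

lemma one_add_mul_wt (p : ℝ) (y : Spacetime) : (1 + ‖y‖) * wt (p + 1) y = wt p y := by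
  rw [wt_add, wt, wt, Real.rpow_neg_one]; field_simp

lemma rpow_neg_le_of_le {a b c p : ℝ} (ha : 0 < a) (hc : 0 < c) (hp : 0 ≤ p) (h : a ≤ c * b) :
    b ^ (-p) ≤ c ^ p * a ^ (-p) := by
  have hb : 0 < b := pos_of_mul_pos_right (ha.trans_le h) hc.le
  calc b ^ (-p) = c ^ p * (c * b) ^ (-p) := by
        rw [Real.mul_rpow hc.le hb.le, ← mul_assoc, ← Real.rpow_add hc]; simp
    _ ≤ _ := by
        gcongr c ^ p * ?_
        exact Real.rpow_le_rpow_of_nonpos ha h (by linarith)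

lemma wt_le {p a c : ℝ} {y : Spacetime} (ha : 0 < a) (hc : 0 < c) (hp : 0 ≤ p)
    (h : a ≤ c * (1 + ‖y‖)) : wt p y ≤ c ^ p * a ^ (-p) :=
  rpow_neg_le_of_le ha hc hp h

lemma norm_le_cone (x : Spacetime) (u : Space) : ‖u‖ ≤ ‖x + nul u‖ + ‖x‖ := by
  have h1 : ‖u‖ ≤ ‖nul u‖ := by simpa using norm_spacePart_le (nul u)
  have h2 := norm_sub_le (x + nul u) x
  rw [add_sub_cancel_left] at h2
  linarith

lemma one_add_retTime_le (x : Spacetime) : 1 + |retTime x| ≤ 2 * wPlus x := by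
  have : |retTime x| ≤ |x 0| + ‖spacePart x‖ := by
    simpa [retTime] using abs_sub (x 0) ‖spacePart x‖
  unfold wPlus
  linarith [abs_time_le x, norm_spacePart_le x]

/-- When the retarded time controls |x|, so does every |y| on the past cone, and y then controls |u|
as well: `wPlus x` ≤ 12 (1 + |y|) and |u| ≤ |y| + |x|, whence the factor 25. The integral becomes a
radial one at scale `wPlus x`. -/
lemma domInt_far {p : ℝ} (hp : 2 < p) {x : Spacetime} (hx : wPlus x ≤ 6 * (1 + |retTime x|)) :
    DomInt (fun u => ‖u‖ ^ (-1 : ℝ) * wt p (x + nul u))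
      (25 ^ p * radialConst 1 p * wPlus x ^ (2 - p)) := by
  have h := (domInt_radial (k := 1) (p := p) (wPlus_pos x) (by linarith) (by norm_num)
    (by linarith)).const_mul (c := 25 ^ p) (by positivity)
  refine h.mono (fun u => ?_) (le_of_eq ?_)
  · have h1 := abs_retTime_le x u
    have h2 := norm_le_cone x u
    have h3 : wPlus x + ‖u‖ ≤ 25 * (1 + ‖x + nul u‖) := by
      have : ‖x‖ = wPlus x - 1 := by simp [wPlus]
      linarith
    have := wPlus_pos x
    have := wt_le (p := p) (by positivity) (by norm_num) (by linarith) h3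
    unfold radial
    calc _ ≤ ‖u‖ ^ (-1 : ℝ) * (25 ^ p * (wPlus x + ‖u‖) ^ (-p)) := by gcongr
      _ = _ := by ring
  · rw [show (3 : ℝ) - 1 - p = 2 - p by ring]; ring

/-- Outside the shell r/4 < |u| < 4r the space part of y has size at least of order r + |u|, and the
plain weight suffices. Inside, the kernel is frozen at order r⁻ᵏ and the remaining integral, over
the space part of y, is left to the majorant `M`. -/
lemma domInt_near {k p b : ℝ} (hk0 : 0 ≤ k) (hk : k < 3) (hp : 0 ≤ p) (hkp : 3 < k + p)
    {x : Spacetime} (hr : 0 < ‖spacePart x‖) {g : Spacetime → ℝ} (hg : ∀ y, g y ≤ wt p y)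
    {M : Space → ℝ} (hM0 : ∀ u, 0 ≤ M u)
    (hM : ∀ u, ‖u‖ < 4 * ‖spacePart x‖ → g (x + nul u) ≤ M (spacePart x + u)) (hD : DomInt M b) :
    DomInt (fun u => ‖u‖ ^ (-k) * g (x + nul u))
      (2 ^ p * (‖spacePart x‖ ^ (3 - k - p) * radialConst k p) +
        4 ^ k * ‖spacePart x‖ ^ (-k) * b) := by
  set r := ‖spacePart x‖ with hrdef
  have h1 := (domInt_radial (k := k) (p := p) hr hp hk hkp).const_mul (c := 2 ^ p) (by positivity)
  have h2 := (hD.comp_add (spacePart x)).const_mul (c := 4 ^ k * r ^ (-k)) (by positivity)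
  refine (h1.add h2).mono (fun u => ?_) le_rfl
  have hr1 := norm_nonneg u
  have hc := abs_le.mp (abs_norm_sub_le_cone x u)
  have hn := norm_spacePart_le (x + nul u)
  by_cases hmid : r / 4 < ‖u‖ ∧ ‖u‖ < 4 * r
  · have h3 : ‖u‖ ^ (-k) ≤ 4 ^ k * r ^ (-k) :=
      rpow_neg_le_of_le hr (by norm_num) hk0 (by linarith)
    calc ‖u‖ ^ (-k) * g (x + nul u) ≤ ‖u‖ ^ (-k) * M (spacePart x + u) := by
          gcongr; exact hM u hmid.2
      _ ≤ 4 ^ k * r ^ (-k) * M (spacePart x + u) := mul_le_mul_of_nonneg_right h3 (hM0 _)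
      _ ≤ _ := le_add_of_nonneg_left (mul_nonneg (by positivity) (radial_nonneg hr.le _))
  · have h3 : r + ‖u‖ ≤ 2 * (1 + ‖x + nul u‖) := by
      rw [not_and_or, not_lt, not_lt] at hmid
      rcases hmid with h | h <;> linarith
    have h4 := wt_le (p := p) (by positivity) (by norm_num) hp h3
    calc ‖u‖ ^ (-k) * g (x + nul u) ≤ ‖u‖ ^ (-k) * (2 ^ p * (r + ‖u‖) ^ (-p)) := by
          gcongr; exact (hg _).trans h4
      _ = 2 ^ p * radial k p r u := by unfold radial; ring
      _ ≤ _ := le_add_of_nonneg_right (mul_nonneg (by positivity) (hM0 _))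

/-- The neighbourhood of the future light cone of the origin, away from the origin. -/
def NearCone (x : Spacetime) : Prop :=
  1 < ‖spacePart x‖ ∧ |retTime x| < ‖spacePart x‖ / 2 ∧ wPlus x ≤ 4 * ‖spacePart x‖

lemma NearCone.rpow_le {x : Spacetime} (hx : NearCone x) {q : ℝ} (hq : 0 ≤ q) :
    ‖spacePart x‖ ^ (-q) ≤ 4 ^ q * wPlus x ^ (-q) :=
  rpow_neg_le_of_le (wPlus_pos x) (by norm_num) hq hx.2.2

lemma one_add_retTime_add_le (x : Spacetime) (u : Space) :
    1 + |retTime x| + ‖spacePart (x + nul u)‖ ≤ 3 * (1 + ‖x + nul u‖) := by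
  linarith [abs_retTime_le x u, norm_spacePart_le (x + nul u)]

/-- Let z be the space part of a timelike point y of the past cone and ω = 𝐱/|𝐱|. If y is in the
future cone of the origin, |z| ≤ x⁰ - |u| and ω·z ≥ |𝐱| - |u| place z in the paraboloid about ω. If
y is in the past cone, squaring |u| ≥ |z| + x⁰ places it in the one about -ω. -/
lemma theta_paraboloid {x : Spacetime} (hx : NearCone x) (u : Space)
    (hu : ‖u‖ < 4 * ‖spacePart x‖) :
    wt 3 (x + nul u) * thetaSq (x + nul u) ≤
      27 * (parab (‖spacePart x‖⁻¹ • spacePart x) (1 + |retTime x|) (spacePart x + u) +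
        parab (-(‖spacePart x‖⁻¹ • spacePart x)) (1 + |retTime x|) (spacePart x + u)) := by
  set r := ‖spacePart x‖ with hr
  set ω := r⁻¹ • spacePart x with hω
  set b := 1 + |retTime x| with hb
  set z := spacePart x + u with hz
  have hb0 : 0 < b := by positivity
  have hr0 : 0 < r := zero_lt_one.trans hx.1
  have hP : ∀ ω', 0 ≤ parab ω' b z := fun ω' => by unfold parab; split_ifs <;> positivity
  have hw : wt 3 (x + nul u) ≤ 27 * (b + ‖z‖) ^ (-3 : ℝ) := by
    have := wt_le (p := 3) (a := b + ‖z‖) (y := x + nul u) (c := 3) (by positivity) (by norm_num)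
      (by norm_num) (by simpa using one_add_retTime_add_le x u)
    norm_num at this ⊢; exact this
  have hsp : spacePart (x + nul u) = z := by simp [hz]
  have ht : (x + nul u) 0 = x 0 - ‖u‖ := by simp; ring
  by_cases hth : ‖z‖ ≤ |x 0 - ‖u‖|
  swap
  · rw [thetaSq_eq_zero (by rw [hsp, ht]; exact not_le.mp hth), mul_zero]
    have := hP ω; have := hP (-ω); positivity
  have hin : inner ℝ ω z = r + inner ℝ ω u := by
    rw [hz, inner_add_right, hω, real_inner_smul_left, real_inner_self_eq_norm_sq, ← hr]
    field_simp
  have hωn : ‖ω‖ = 1 := by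
    rw [hω, norm_smul, norm_inv, norm_norm, ← hr]; field_simp
  have hcs : |inner ℝ ω u| ≤ ‖u‖ := by
    have := abs_real_inner_le_norm ω u; rwa [hωn, one_mul] at this
  have hor : ‖z‖ - inner ℝ ω z ≤ 6 * b ∨ ‖z‖ - inner ℝ (-ω) z ≤ 6 * b := by
    have ha := le_abs_self (retTime x)
    have ha' := neg_abs_le (retTime x)
    set a := |retTime x| with haa
    have ha0 : 0 ≤ a := abs_nonneg _
    have hax := hx.2.1
    have hxt : x 0 = r + retTime x := by simp [retTime, hr]
    rcases abs_cases (x 0 - ‖u‖) with ⟨h, _⟩ | ⟨h, _⟩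
    · left
      rw [h] at hth
      linarith [neg_abs_le (inner ℝ ω u)]
    · right
      rw [h] at hth
      rw [inner_neg_left]
      have hz2 : ‖u‖ ^ 2 = ‖z‖ ^ 2 - 2 * r * inner ℝ ω z + r ^ 2 := by
        have e : u = z - r • ω := by
          rw [hω, smul_smul, mul_inv_cancel₀ hr0.ne', one_smul, hz]; abel
        rw [e, norm_sub_sq_real, real_inner_smul_right, norm_smul, hωn, real_inner_comm, mul_one,
          Real.norm_of_nonneg hr0.le]; ring
      have hzle : ‖z‖ ≤ 5 * r := by
        have := norm_add_le (spacePart x) u; rw [← hz, ← hr] at this; linarith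
      have hR : ‖z‖ + r - a ≤ ‖u‖ := by linarith
      have hpos : 0 ≤ ‖z‖ + r - a := by linarith [norm_nonneg z]
      have hsq : (‖z‖ + r - a) ^ 2 ≤ ‖u‖ ^ 2 := by gcongr
      -- Expanding the squares leaves r(|z| + ω·z) ≤ a(|z| + r); with |z| ≤ 5r, which uses |u| < 4r,
      -- this fixes the width 6 in `parab`.
      have h5 : r * (‖z‖ + inner ℝ ω z) ≤ r * (6 * a) := by nlinarith
      have h6 := le_of_mul_le_mul_left h5 hr0
      linarith
  have hle : (b + ‖z‖) ^ (-3 : ℝ) ≤ parab ω b z + parab (-ω) b z := by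
    rcases hor with h | h
    · have : parab ω b z = (b + ‖z‖) ^ (-3 : ℝ) := if_pos h
      linarith [hP (-ω)]
    · have : parab (-ω) b z = (b + ‖z‖) ^ (-3 : ℝ) := if_pos h
      linarith [hP ω]
  calc wt 3 (x + nul u) * thetaSq (x + nul u) ≤ wt 3 (x + nul u) * 1 := by
        gcongr
        · exact wt_nonneg _ _
        · exact thetaSq_le_one _
    _ ≤ _ := by rw [mul_one]; exact hw.trans (by gcongr)

lemma domInt_theta_near {k : ℝ} (hk0 : 0 < k) (hk : k < 3) :
    ∃ C : ℝ, 0 ≤ C ∧ ∀ x, NearCone x →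
      DomInt (fun u => ‖u‖ ^ (-k) * (wt 3 (x + nul u) * thetaSq (x + nul u)))
        (C * wPlus x ^ (-k)) := by
  obtain ⟨V, hV⟩ := domInt_parab
  have hrc := radialConst_nonneg k 3
  refine ⟨(2 ^ (3 : ℝ) * radialConst k 3 + 4 ^ k * (27 * (|V| + |V|))) * 4 ^ k, by positivity,
    fun x hx => ?_⟩
  have hr0 : 0 < ‖spacePart x‖ := zero_lt_one.trans hx.1
  have hω : ‖‖spacePart x‖⁻¹ • spacePart x‖ = 1 := by
    rw [norm_smul, norm_inv, norm_norm]; field_simp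
  have hb : 0 < 1 + |retTime x| := by positivity
  have hP : ∀ ω z, 0 ≤ parab ω (1 + |retTime x|) z := fun ω z => by
    unfold parab; split_ifs <;> positivity
  have := domInt_near (g := fun y => wt 3 y * thetaSq y) hk0.le hk (by norm_num : (0 : ℝ) ≤ 3)
    (by linarith) hr0
    (fun y => mul_le_of_le_one_right (wt_nonneg _ _) (thetaSq_le_one _))
    (fun z => mul_nonneg (by norm_num) (add_nonneg (hP _ z) (hP _ z)))
    (theta_paraboloid hx)
    (((hV _ hω _ hb).add (hV _ (by rw [norm_neg, hω]) _ hb)).const_mul (by norm_num : (0:ℝ) ≤ 27))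
  refine this.mono (fun _ => le_rfl) ?_
  have hV' := le_abs_self V
  rw [show 3 - k - 3 = -k by ring]
  calc _ = (2 ^ (3 : ℝ) * radialConst k 3 + 4 ^ k * (27 * (V + V))) * ‖spacePart x‖ ^ (-k) := by ring
    _ ≤ (2 ^ (3 : ℝ) * radialConst k 3 + 4 ^ k * (27 * (|V| + |V|))) *
        (4 ^ k * wPlus x ^ (-k)) := by
      gcongr
      exact hx.rpow_le hk0.le
    _ = _ := by ring

/-- A weight of order 2 + ε is not integrable over all of space, but in the shell only |z| ≤ 5r
occurs. There the factor 6r/(r + |z|) is at least one and supplies the missing power at infinity; ε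
< 1 keeps the singularity |z|^(-2-ε) integrable. -/
lemma domInt_wt_two_near {ε k : ℝ} (hε : 0 < ε) (hε' : ε < 1) (hk1 : 1 ≤ k) (hk : k < 3) :
    ∃ C : ℝ, 0 ≤ C ∧ ∀ x, NearCone x →
      DomInt (fun u => ‖u‖ ^ (-k) * wt (2 + ε) (x + nul u)) (C * wPlus x ^ (1 - k - ε)) := by
  have hrc := radialConst_nonneg k (2 + ε)
  have hrc' := radialConst_nonneg (2 + ε) 1
  refine ⟨(2 ^ (2 + ε) * radialConst k (2 + ε) + 4 ^ k * (6 * radialConst (2 + ε) 1)) *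
    4 ^ (k + ε - 1), by positivity, fun x hx => ?_⟩
  have hr0 : 0 < ‖spacePart x‖ := zero_lt_one.trans hx.1
  set r := ‖spacePart x‖ with hr
  have hM : DomInt (fun z : Space => if ‖z‖ ≤ 5 * r then (1 + ‖z‖) ^ (-(2 + ε)) else 0)
      (6 * r * (r ^ (3 - (2 + ε) - 1) * radialConst (2 + ε) 1)) := by
    refine ((domInt_radial (k := 2 + ε) (p := 1) hr0 (by norm_num) (by linarith)
      (by linarith)).const_mul (c := 6 * r) (by positivity)).mono_ae ?_ le_rfl
    -- The origin is excluded because the real power of zero with this negative exponent is zero.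
    filter_upwards [compl_mem_ae_iff.mpr (measure_singleton (0 : Space))] with z hz
    have hz0 : 0 < ‖z‖ := norm_pos_iff.mpr hz
    split_ifs with h
    · unfold radial
      have h1 : 1 ≤ 6 * r * (r + ‖z‖) ^ (-1 : ℝ) := by
        rw [Real.rpow_neg_one, ← div_eq_mul_inv, one_le_div (by positivity)]; linarith
      calc (1 + ‖z‖) ^ (-(2 + ε)) ≤ ‖z‖ ^ (-(2 + ε)) :=
            Real.rpow_le_rpow_of_nonpos hz0 (by linarith) (by linarith)
        _ ≤ ‖z‖ ^ (-(2 + ε)) * (6 * r * (r + ‖z‖) ^ (-1 : ℝ)) :=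
            le_mul_of_one_le_right (by positivity) h1
        _ = _ := by ring
    · exact mul_nonneg (by positivity) (radial_nonneg hr0.le _)
  have := domInt_near (g := wt (2 + ε)) (by linarith) hk (by linarith : (0 : ℝ) ≤ 2 + ε)
    (by linarith) hr0 (fun y => le_rfl) (fun z => by split_ifs <;> positivity)
    (fun u hu => ?_) hM
  · refine this.mono (fun _ => le_rfl) ?_
    have e1 : r ^ (-k) * (r * r ^ (3 - (2 + ε) - 1)) = r ^ (-(k + ε - 1)) := by
      nth_rewrite 2 [← Real.rpow_one r]
      rw [← Real.rpow_add hr0, ← Real.rpow_add hr0]; congr 1; ring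
    rw [show 3 - k - (2 + ε) = -(k + ε - 1) by ring]
    calc _ = 2 ^ (2 + ε) * radialConst k (2 + ε) * r ^ (-(k + ε - 1)) + 4 ^ k *
          (6 * radialConst (2 + ε) 1) * (r ^ (-k) * (r * r ^ (3 - (2 + ε) - 1))) := by ring
      _ = (2 ^ (2 + ε) * radialConst k (2 + ε) + 4 ^ k * (6 * radialConst (2 + ε) 1)) *
          r ^ (-(k + ε - 1)) := by rw [e1]; ring
      _ ≤ (2 ^ (2 + ε) * radialConst k (2 + ε) + 4 ^ k * (6 * radialConst (2 + ε) 1)) *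
          (4 ^ (k + ε - 1) * wPlus x ^ (-(k + ε - 1))) := by
        gcongr
        exact hx.rpow_le (by linarith)
      _ = _ := by rw [show -(k + ε - 1) = 1 - k - ε by ring]; ring
  · have h1 := norm_add_le (spacePart x) u
    rw [if_pos (by linarith)]
    refine Real.rpow_le_rpow_of_nonpos (by positivity) ?_ (by linarith)
    have := norm_spacePart_le (x + nul u)
    simp at this
    linarith

lemma domInt_wt_two {ε : ℝ} (hε : 0 < ε) (hε' : ε < 1) :
    ∃ C : ℝ, 0 ≤ C ∧ ∀ x,
      DomInt (fun u => ‖u‖ ^ (-1 : ℝ) * wt (2 + ε) (x + nul u)) (C * wPlus x ^ (-ε)) := by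
  obtain ⟨C, hC, h⟩ := domInt_wt_two_near hε hε' le_rfl (by norm_num)
  have hrc := radialConst_nonneg 1 (2 + ε)
  refine ⟨C + 25 ^ (2 + ε) * radialConst 1 (2 + ε), by positivity, fun x => ?_⟩
  have hw := wPlus_pos x
  rcases far_or_near x with hx | hx
  · refine (domInt_far (by linarith) hx).mono (fun _ => le_rfl) ?_
    rw [show 2 - (2 + ε) = -ε by ring]
    gcongr; linarith
  · refine (h x hx).mono (fun _ => le_rfl) ?_
    rw [show 1 - 1 - ε = -ε by ring]
    gcongr
    exact le_add_of_nonneg_right (by positivity)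

/-- In the shell the weight is at most a multiple of (b + |z|)^(-3-ε) with b = 1 + |s|, s the
retarded time. Its integral over space is of order b^(-ε), which produces the decay in the retarded
time; the factor 1/|x| is the frozen kernel. -/
lemma domInt_wt_three {ε : ℝ} (hε : 0 < ε) :
    ∃ C : ℝ, 0 ≤ C ∧ ∀ x,
      DomInt (fun u => ‖u‖ ^ (-1 : ℝ) * wt (3 + ε) (x + nul u))
        (C * (wPlus x ^ (-1 : ℝ) * (1 + |retTime x|) ^ (-ε))) := by
  have hrc := radialConst_nonneg 1 (3 + ε)
  have hrc' := radialConst_nonneg 0 (3 + ε)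
  refine ⟨(25 ^ (3 + ε) * radialConst 1 (3 + ε) + (2 ^ (3 + ε) * radialConst 1 (3 + ε)) *
      4 ^ (1 + ε)) * 2 ^ ε + 4 ^ (1 : ℝ) * 3 ^ (3 + ε) * radialConst 0 (3 + ε) * 4 ^ (1 : ℝ),
    by positivity, fun x => ?_⟩
  have hw := wPlus_pos x
  have hb : 0 < 1 + |retTime x| := by positivity
  have hwb : wPlus x ^ (-(1 + ε)) ≤ 2 ^ ε * (wPlus x ^ (-1 : ℝ) * (1 + |retTime x|) ^ (-ε)) := by
    rw [neg_add, Real.rpow_add hw]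
    calc _ ≤ wPlus x ^ (-1 : ℝ) * (2 ^ ε * (1 + |retTime x|) ^ (-ε)) := by
          gcongr
          exact rpow_neg_le_of_le hb (by norm_num) hε.le (one_add_retTime_le x)
      _ = _ := by ring
  rcases far_or_near x with hx | hx
  · refine (domInt_far (by linarith) hx).mono (fun _ => le_rfl) ?_
    rw [show 2 - (3 + ε) = -(1 + ε) by ring]
    calc _ ≤ 25 ^ (3 + ε) * radialConst 1 (3 + ε) *
          (2 ^ ε * (wPlus x ^ (-1 : ℝ) * (1 + |retTime x|) ^ (-ε))) := by gcongr
      _ = 25 ^ (3 + ε) * radialConst 1 (3 + ε) * 2 ^ ε *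
          (wPlus x ^ (-1 : ℝ) * (1 + |retTime x|) ^ (-ε)) := by ring
      _ ≤ _ := by
        gcongr ?_ * _
        rw [add_mul, add_assoc]
        exact le_add_of_nonneg_right (by positivity)
  · replace hx : NearCone x := hx
    have hr0 : 0 < ‖spacePart x‖ := zero_lt_one.trans hx.1
    have hM := (domInt_radial (k := 0) (p := 3 + ε) hb (by linarith) (by norm_num)
      (by linarith)).const_mul (c := 3 ^ (3 + ε)) (by positivity)
    have := domInt_near (g := wt (3 + ε)) (k := 1) (by norm_num) (by norm_num)
      (by linarith : (0 : ℝ) ≤ 3 + ε) (by linarith) hr0 (fun y => le_rfl)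
      (fun z => mul_nonneg (by positivity) (radial_nonneg hb.le z)) (fun u _ => ?_) hM
    · refine this.mono (fun _ => le_rfl) ?_
      rw [show 3 - 1 - (3 + ε) = -(1 + ε) by ring, show 3 - 0 - (3 + ε) = -ε by ring]
      have h1 := hx.rpow_le (q := 1 + ε) (by positivity)
      have h2 := hx.rpow_le (q := 1) (by positivity)
      calc _ ≤ 2 ^ (3 + ε) * ((4 ^ (1 + ε) * (2 ^ ε * (wPlus x ^ (-1 : ℝ) *
            (1 + |retTime x|) ^ (-ε)))) * radialConst 1 (3 + ε)) +
            4 ^ (1 : ℝ) * (4 ^ (1 : ℝ) * wPlus x ^ (-1 : ℝ)) *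
              (3 ^ (3 + ε) * ((1 + |retTime x|) ^ (-ε) * radialConst 0 (3 + ε))) := by
            gcongr
            exact h1.trans (by gcongr)
        _ = (((2 ^ (3 + ε) * radialConst 1 (3 + ε)) * 4 ^ (1 + ε)) * 2 ^ ε +
            4 ^ (1 : ℝ) * 3 ^ (3 + ε) * radialConst 0 (3 + ε) * 4 ^ (1 : ℝ)) *
            (wPlus x ^ (-1 : ℝ) * (1 + |retTime x|) ^ (-ε)) := by ring
        _ ≤ _ := by
          gcongr ?_ * _
          gcongr
          exact le_add_of_nonneg_left (by positivity)
    · have h3 := one_add_retTime_add_le x u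
      have := wt_le (p := 3 + ε) (by positivity) (by norm_num) (by linarith) h3
      simpa [radial] using this

lemma domInt_theta {ε : ℝ} (hε : 0 < ε) :
    ∃ C : ℝ, 0 ≤ C ∧ ∀ x,
      DomInt (fun u => ‖u‖ ^ (-1 : ℝ) *
        (wt 3 (x + nul u) * thetaSq (x + nul u) + wt (3 + ε) (x + nul u)))
        (C * wPlus x ^ (-1 : ℝ)) := by
  obtain ⟨C, hC, h⟩ := domInt_theta_near (k := 1) (by norm_num) (by norm_num)
  obtain ⟨C', hC', h'⟩ := domInt_wt_three hε
  have hrc := radialConst_nonneg 1 3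
  refine ⟨(C + 25 ^ (3 : ℝ) * radialConst 1 3) + C', by positivity, fun x => ?_⟩
  have hw := wPlus_pos x
  have hth : DomInt (fun u => ‖u‖ ^ (-1 : ℝ) * (wt 3 (x + nul u) * thetaSq (x + nul u)))
      ((C + 25 ^ (3 : ℝ) * radialConst 1 3) * wPlus x ^ (-1 : ℝ)) := by
    rcases far_or_near x with hx | hx
    · refine (domInt_far (p := 3) (by norm_num) hx).mono (fun u => ?_) ?_
      · gcongr
        exact mul_le_of_le_one_right (wt_nonneg _ _) (thetaSq_le_one _)
      · norm_num only
        gcongr; linarith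
    · refine (h x hx).mono (fun _ => le_rfl) ?_
      gcongr
      exact le_add_of_nonneg_right (by positivity)
  refine (hth.add (h' x)).mono (fun u => le_of_eq (by ring)) ?_
  rw [add_mul _ C']
  gcongr
  exact mul_le_of_le_one_right (by positivity)
    (Real.rpow_le_one_of_one_le_of_nonpos (by linarith [abs_nonneg (retTime x)]) (by linarith))

/-! ### Differentiation of integrals over the past light cone -/



/-- The embedding of space at time zero. -/
def incl : Space →L[ℝ] Spacetime :=
  LinearMap.toContinuousLinearMap
    { toFun := point 0
      map_add' := fun y z => by simpa using point_add 0 0 y z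
      map_smul' := fun c y => by simpa using point_smul c 0 y }

/-- The unit vector of the time axis. -/
def timeVec : Spacetime := EuclideanSpace.single 0 1

lemma point_eq (t : ℝ) (y : Space) : point t y = t • timeVec + incl y := by
  apply spacetime_ext
  · simp [timeVec, incl]
  · ext i; fin_cases i <;> simp [timeVec, incl, spacePart, point]

lemma continuous_point {X : Type*} [TopologicalSpace X] {t : X → ℝ} {y : X → Space}
    (ht : Continuous t) (hy : Continuous y) : Continuous fun a => point (t a) (y a) := by
  simp_rw [point_eq]; fun_prop

lemma continuous_nul : Continuous nul :=
  continuous_point continuous_norm.neg continuous_id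

lemma norm_point_le (t : ℝ) (y : Space) : ‖point t y‖ ≤ |t| + ‖y‖ := by
  simpa using norm_le_add_split (point t y)

/-- `f` decays like `(1 + |y|)^{-p}`. -/
def Decays (p : ℝ) (f : Spacetime → E) : Prop := ∃ c : ℝ, ∀ y, ‖f y‖ ≤ c * wt p y

lemma Decays.exists_nonneg {p : ℝ} {f : Spacetime → E} (h : Decays p f) :
    ∃ c : ℝ, 0 ≤ c ∧ ∀ y, ‖f y‖ ≤ c * wt p y := by
  obtain ⟨c, hc⟩ := h
  exact ⟨|c|, abs_nonneg c, fun y => (hc y).trans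
    (mul_le_mul_of_nonneg_right (le_abs_self c) (wt_nonneg _ _))⟩

lemma Decays.mono {p q : ℝ} {f : Spacetime → E} (h : Decays p f) (hq : q ≤ p) : Decays q f := by
  obtain ⟨c, hc0, hc⟩ := h.exists_nonneg
  exact ⟨c, fun y => (hc y).trans (mul_le_mul_of_nonneg_left (wt_anti hq y) hc0)⟩

lemma Decays.of_norm_le {p C : ℝ} {f : Spacetime → E} {g : Spacetime → F} (h : Decays p f)
    (hC : 0 ≤ C) (hg : ∀ y, ‖g y‖ ≤ C * ‖f y‖) : Decays p g := by
  obtain ⟨c, hc⟩ := h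
  exact ⟨C * c, fun y => (hg y).trans (by rw [mul_assoc]; exact mul_le_mul_of_nonneg_left (hc y) hC)⟩

lemma Decays.add {p : ℝ} {f g : Spacetime → E} (hf : Decays p f) (hg : Decays p g) :
    Decays p (fun y => f y + g y) := by
  obtain ⟨c, hc⟩ := hf
  obtain ⟨c', hc'⟩ := hg
  exact ⟨c + c', fun y => (norm_add_le _ _).trans (by rw [add_mul]; exact add_le_add (hc y) (hc' y))⟩

lemma Decays.const_smul {p : ℝ} {f : Spacetime → E} (hf : Decays p f) (a : ℝ) :
    Decays p (fun y => a • f y) :=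
  hf.of_norm_le (norm_nonneg a) fun y => (norm_smul a (f y)).le

lemma Decays.clm {p : ℝ} {f : Spacetime → E} (hf : Decays p f) (L : E →L[ℝ] F) :
    Decays p (fun y => L (f y)) :=
  hf.of_norm_le (norm_nonneg L) fun _ => L.le_opNorm _

lemma Decays.clm_apply {p : ℝ} {f : Spacetime → E →L[ℝ] F} (hf : Decays p f) (v : E) :
    Decays p (fun y => f y v) :=
  hf.of_norm_le (norm_nonneg v) fun y => by rw [mul_comm]; exact (f y).le_opNorm v

/-- A measurable kernel on space bounded by `|u|^{-k}`. -/
def IsKernel (k : ℝ) (κ : Space → ℝ) : Prop :=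
  Measurable κ ∧ ∃ C : ℝ, 0 ≤ C ∧ ∀ u, |κ u| ≤ C * ‖u‖ ^ (-k)

/-- The integral over the past light cone with kernel `κ`. -/
def cone (κ : Space → ℝ) (f : Spacetime → E) (x : Spacetime) : E :=
  ∫ u : Space, κ u • f (x + nul u)

/-- The bound is uniform for `x` in a ball, which is exactly the domination needed for continuity
and for differentiation under the integral. -/
lemma norm_cone_integrand_le {k p C c : ℝ} {κ : Space → ℝ} {f : Spacetime → E} (hC : 0 ≤ C)
    (hκ : ∀ u, |κ u| ≤ C * ‖u‖ ^ (-k)) (hp : 0 ≤ p) (hc : 0 ≤ c) (hf : ∀ y, ‖f y‖ ≤ c * wt p y)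
    {M : ℝ} {x : Spacetime} (hx : ‖x‖ ≤ M) (u : Space) :
    ‖κ u • f (x + nul u)‖ ≤ C * c * (1 + M) ^ p * radial k p 1 u := by
  have h1 := one_add_norm_le x u (spacePart_nul u)
  have hM : 0 ≤ M := (norm_nonneg x).trans hx
  have h2 : 1 + ‖u‖ ≤ (1 + M) * (1 + ‖x + nul u‖) := h1.trans (by gcongr)
  have h3 := wt_le (p := p) (by positivity) (by positivity) hp h2
  rw [norm_smul, Real.norm_eq_abs]
  calc |κ u| * ‖f (x + nul u)‖ ≤ (C * ‖u‖ ^ (-k)) * (c * ((1 + M) ^ p * (1 + ‖u‖) ^ (-p))) := by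
        gcongr
        · exact hκ u
        · exact (hf _).trans (by gcongr)
    _ = _ := by unfold radial; ring

lemma aestronglyMeasurable_cone {κ : Space → ℝ} (hκ : Measurable κ) {f : Spacetime → E}
    (hf : Continuous f) (x : Spacetime) :
    AEStronglyMeasurable (fun u => κ u • f (x + nul u)) (volume : Measure Space) :=
  hκ.aestronglyMeasurable.smul
    (hf.comp (continuous_const.add continuous_nul)).aestronglyMeasurable

lemma integrable_cone {k p : ℝ} {κ : Space → ℝ} (hκ : IsKernel k κ) {f : Spacetime → E}
    (hf : Continuous f) (hd : Decays p f) (hp : 0 ≤ p) (hk : k < 3) (hkp : 3 < k + p)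
    (x : Spacetime) : Integrable (fun u => κ u • f (x + nul u)) := by
  obtain ⟨hm, C, hC, hκ⟩ := hκ
  obtain ⟨c, hc, hd⟩ := hd.exists_nonneg
  refine ((integrable_radial one_pos hp hk hkp).const_mul (C * c * (1 + ‖x‖) ^ p)).mono'
    (aestronglyMeasurable_cone hm hf x) (Eventually.of_forall fun u => ?_)
  exact norm_cone_integrand_le hC hκ hp hc hd le_rfl u

lemma continuous_cone {k p : ℝ} {κ : Space → ℝ} (hκ : IsKernel k κ) {f : Spacetime → E}
    (hf : Continuous f) (hd : Decays p f) (hp : 0 ≤ p) (hk : k < 3) (hkp : 3 < k + p) :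
    Continuous (cone κ f) := by
  obtain ⟨hm, C, hC, hκ⟩ := hκ
  obtain ⟨c, hc, hd⟩ := hd.exists_nonneg
  refine continuous_iff_continuousAt.mpr fun x₀ => ?_
  refine continuousAt_of_dominated (bound := fun u => C * c * (1 + (‖x₀‖ + 1)) ^ p * radial k p 1 u)
    (Eventually.of_forall fun x => aestronglyMeasurable_cone hm hf x) ?_
    ((integrable_radial one_pos hp hk hkp).const_mul _) (Eventually.of_forall fun u => ?_)
  · filter_upwards [Metric.ball_mem_nhds x₀ one_pos] with x hx
    refine Eventually.of_forall fun u => norm_cone_integrand_le hC hκ hp hc hd ?_ u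
    have := norm_le_norm_add_norm_sub x₀ x
    rw [mem_ball_iff_norm'] at hx
    linarith
  · exact (continuous_const.smul (hf.comp (continuous_id.add continuous_const))).continuousAt

lemma hasFDerivAt_cone {k p : ℝ} {κ : Space → ℝ} (hκ : IsKernel k κ) {f : Spacetime → E}
    (hf : ContDiff ℝ 1 f) (hd : Decays p f) (hd' : Decays p (fderiv ℝ f)) (hp : 0 ≤ p) (hk : k < 3)
    (hkp : 3 < k + p) (x₀ : Spacetime) :
    HasFDerivAt (cone κ f) (cone κ (fderiv ℝ f) x₀) x₀ := by
  have hint := integrable_cone hκ hf.continuous hd hp hk hkp x₀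
  obtain ⟨hm, C, hC, hκ⟩ := hκ
  obtain ⟨c, hc, hd'⟩ := hd'.exists_nonneg
  refine hasFDerivAt_integral_of_dominated_of_fderiv_le
    (bound := fun u => C * c * (1 + (‖x₀‖ + 1)) ^ p * radial k p 1 u)
    (F' := fun x u => κ u • fderiv ℝ f (x + nul u)) (Metric.ball_mem_nhds x₀ one_pos)
    (Eventually.of_forall fun x => aestronglyMeasurable_cone hm hf.continuous x) hint
    (aestronglyMeasurable_cone hm (hf.continuous_fderiv one_ne_zero) x₀) ?_
    ((integrable_radial one_pos hp hk hkp).const_mul _) ?_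
  · refine Eventually.of_forall fun u x hx => norm_cone_integrand_le hC hκ hp hc hd' ?_ u
    have := norm_le_norm_add_norm_sub x₀ x
    rw [mem_ball_iff_norm'] at hx
    linarith
  · refine Eventually.of_forall fun u x _ => ?_
    have h := (hf.differentiable one_ne_zero (x + nul u)).hasFDerivAt
    have h2 : HasFDerivAt (fun x : Spacetime => x + nul u) (ContinuousLinearMap.id ℝ Spacetime) x :=
      (hasFDerivAt_id x).add_const _
    have h3 := (h.comp x h2).const_smul (κ u)
    rw [ContinuousLinearMap.comp_id] at h3
    exact h3

lemma clm_cone [CompleteSpace E] [CompleteSpace F] (L : E →L[ℝ] F) {κ : Space → ℝ}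
    {f : Spacetime → E} {x : Spacetime} (h : Integrable (fun u => κ u • f (x + nul u))) :
    L (cone κ f x) = cone κ (fun y => L (f y)) x := by
  unfold cone
  rw [← L.integral_comp_comm h]
  simp

lemma cone_add {κ : Space → ℝ} {f g : Spacetime → E} {x : Spacetime}
    (hf : Integrable (fun u => κ u • f (x + nul u))) (hg : Integrable (fun u => κ u • g (x + nul u))) :
    cone κ (fun y => f y + g y) x = cone κ f x + cone κ g x := by
  unfold cone
  rw [← integral_add hf hg]
  simp

lemma isometryEquiv_cone (L : E ≃ₗᵢ[ℝ] F) (κ : Space → ℝ) (f : Spacetime → E) (x : Spacetime) :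
    cone κ (fun y => L (f y)) x = L (cone κ f x) := by
  have := L.toContinuousLinearEquiv.integral_comp_comm (μ := volume) fun u => κ u • f (x + nul u)
  simpa [cone] using this

lemma hasFDerivAt_cone_iteratedFDeriv {k p : ℝ} {κ : Space → ℝ} (hκ : IsKernel k κ)
    {n : ℕ} {f : Spacetime → E} (hf : ContDiff ℝ n f)
    (hd : ∀ m ≤ n, Decays p (iteratedFDeriv ℝ m f)) (hp : 0 ≤ p) (hk : k < 3) (hkp : 3 < k + p)
    {m : ℕ} (hm : m < n) (x : Spacetime) : HasFDerivAt (cone κ (iteratedFDeriv ℝ m f))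
      (cone κ (iteratedFDeriv ℝ (m + 1) f) x).curryLeft x := by
  have hc1 : ContDiff ℝ 1 (iteratedFDeriv ℝ m f) := hf.iteratedFDeriv_right (by norm_cast; omega)
  have hd' : Decays p (fderiv ℝ (iteratedFDeriv ℝ m f)) := by
    refine (hd (m + 1) hm).of_norm_le zero_le_one fun y => ?_
    rw [norm_fderiv_iteratedFDeriv, one_mul]
  have h := hasFDerivAt_cone hκ hc1 (hd m hm.le) hd' hp hk hkp x
  have e : cone κ (fderiv ℝ (iteratedFDeriv ℝ m f)) x =
      continuousMultilinearCurryLeftEquiv ℝ (fun _ : Fin (m + 1) => Spacetime) E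
        (cone κ (iteratedFDeriv ℝ (m + 1) f) x) := by
    rw [fderiv_iteratedFDeriv]
    exact isometryEquiv_cone _ κ _ x
  rw [e] at h
  exact h

/-- All derivatives are handled at once: the cone integrals of the iterated derivatives form a
Taylor series. Regularity and the formula for each iterated derivative follow together. -/
lemma hasFTaylorSeriesUpTo_cone {k p : ℝ} {κ : Space → ℝ} (hκ : IsKernel k κ)
    {n : ℕ} {f : Spacetime → E} (hf : ContDiff ℝ n f)
    (hd : ∀ m ≤ n, Decays p (iteratedFDeriv ℝ m f)) (hp : 0 ≤ p) (hk : k < 3) (hkp : 3 < k + p) :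
    HasFTaylorSeriesUpTo n (cone κ f) (fun x m => cone κ (iteratedFDeriv ℝ m f) x) where
  zero_eq x := by
    have h : cone κ (fun y => (continuousMultilinearCurryFin0 ℝ Spacetime E).symm (f y)) x =
      (continuousMultilinearCurryFin0 ℝ Spacetime E).symm (cone κ f x) := isometryEquiv_cone _ κ f x
    have h' := congrArg (continuousMultilinearCurryFin0 ℝ Spacetime E) h
    rw [LinearIsometryEquiv.apply_symm_apply] at h'
    exact h'
  fderiv m hm x := hasFDerivAt_cone_iteratedFDeriv hκ hf hd hp hk hkp (by exact_mod_cast hm) x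
  cont m hm := continuous_cone hκ (hf.continuous_iteratedFDeriv hm) (hd m (by exact_mod_cast hm))
    hp hk hkp

lemma contDiff_cone {k p : ℝ} {κ : Space → ℝ} (hκ : IsKernel k κ)
    {n : ℕ} {f : Spacetime → E} (hf : ContDiff ℝ n f)
    (hd : ∀ m ≤ n, Decays p (iteratedFDeriv ℝ m f)) (hp : 0 ≤ p) (hk : k < 3) (hkp : 3 < k + p) :
    ContDiff ℝ n (cone κ f) :=
  (hasFTaylorSeriesUpTo_cone hκ hf hd hp hk hkp).contDiff

lemma iteratedFDeriv_cone {k p : ℝ} {κ : Space → ℝ} (hκ : IsKernel k κ)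
    {n : ℕ} {f : Spacetime → E} (hf : ContDiff ℝ n f)
    (hd : ∀ m ≤ n, Decays p (iteratedFDeriv ℝ m f)) (hp : 0 ≤ p) (hk : k < 3) (hkp : 3 < k + p)
    {m : ℕ} (hm : m ≤ n) : iteratedFDeriv ℝ m (cone κ f) = cone κ (iteratedFDeriv ℝ m f) :=
  funext fun x => ((hasFTaylorSeriesUpTo_cone hκ hf hd hp hk hkp).eq_iteratedFDeriv
    (by exact_mod_cast hm) x).symm

/-! ### The retarded integral -/

/-- The retarded integral of a function with values in a normed space. -/
def ret (f : Spacetime → E) : Spacetime → E := cone (fun u => ‖u‖ ^ (-1 : ℝ)) f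

lemma isKernel_rpow (k : ℝ) : IsKernel k fun u => ‖u‖ ^ (-k) :=
  ⟨by fun_prop, 1, zero_le_one, fun u => by rw [abs_of_nonneg (by positivity), one_mul]⟩

lemma norm_ret_le {f : Spacetime → E} {g : Spacetime → ℝ} {x : Spacetime} {b : ℝ}
    (h : DomInt (fun u => ‖u‖ ^ (-1 : ℝ) * g (x + nul u)) b) (hf : ∀ y, ‖f y‖ ≤ g y) :
    ‖ret f x‖ ≤ b := by
  refine h.norm_integral_le fun u => ?_
  rw [norm_smul, Real.norm_of_nonneg (by positivity)]
  gcongr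
  exact hf _

/-- The past cone is invariant under positive dilations. The exponent 2 is 3 from the volume minus 1
from the kernel. -/
lemma ret_scale (f : Spacetime → E) {c : ℝ} (hc : 0 < c) (x : Spacetime) :
    ret f (c • x) = c ^ 2 • ret (fun y => f (c • y)) x := by
  have h := Measure.integral_comp_smul (volume : Measure Space)
    (fun u => ‖u‖ ^ (-1 : ℝ) • f (c • x + nul u)) c
  have e : ∀ u : Space, ‖c • u‖ ^ (-1 : ℝ) • f (c • x + nul (c • u)) =
      c⁻¹ • (‖u‖ ^ (-1 : ℝ) • f (c • (x + nul u))) := fun u => by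
    rw [nul_smul hc.le, ← smul_add, norm_smul, Real.norm_of_nonneg hc.le,
      Real.mul_rpow hc.le (norm_nonneg u), Real.rpow_neg_one c, mul_smul]
  simp only [e] at h
  rw [integral_smul, finrank_euclideanSpace, Fintype.card_fin, abs_of_pos (by positivity)] at h
  unfold ret cone
  calc _ = c ^ 3 • ((c ^ 3)⁻¹ • ∫ u : Space, ‖u‖ ^ (-1 : ℝ) • f (c • x + nul u)) := by
        rw [smul_smul, mul_inv_cancel₀ (by positivity), one_smul]
    _ = _ := by
        rw [← h, smul_smul]; congr 1; field_simp

lemma norm_xDeriv_le (f : Spacetime → E) (y : Spacetime) :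
    ‖xDeriv f y‖ ≤ ‖fderiv ℝ f y‖ * ‖y‖ := (fderiv ℝ f y).le_opNorm y

lemma Decays.xDeriv {p : ℝ} {f : Spacetime → E} (h : Decays (p + 1) (fderiv ℝ f)) :
    Decays p (xDeriv f) := by
  obtain ⟨c, hc0, hc⟩ := h.exists_nonneg
  refine ⟨c, fun y => (norm_xDeriv_le f y).trans ?_⟩
  calc ‖fderiv ℝ f y‖ * ‖y‖ ≤ (c * wt (p + 1) y) * (1 + ‖y‖) := by
        gcongr
        · exact mul_nonneg hc0 (wt_nonneg _ _)
        · exact hc y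
        · linarith
    _ = c * ((1 + ‖y‖) * wt (p + 1) y) := by ring
    _ = _ := by rw [one_add_mul_wt]

lemma continuous_xDeriv {f : Spacetime → E} (hf : ContDiff ℝ 1 f) : Continuous (xDeriv f) :=
  (hf.continuous_fderiv one_ne_zero).clm_apply continuous_id

/-- The scaling operator commutes with the retarded integral up to the homogeneity shift. -/
lemma xDeriv_ret {p : ℝ} {f : Spacetime → E} (hf : ContDiff ℝ 1 f) (hd : Decays p f)
    (hd' : Decays (p + 1) (fderiv ℝ f)) (hp : 2 < p) (x : Spacetime) :
    xDeriv (ret f) x = ret (fun y => xDeriv f y + (2 : ℝ) • f y) x := by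
  have hp0 : 0 ≤ p := by linarith
  have hk : IsKernel 1 fun u : Space => ‖u‖ ^ (-1 : ℝ) := isKernel_rpow 1
  have hi := integrable_cone hk hf.continuous hd hp0 (by norm_num) (by linarith) x
  have hi' := integrable_cone hk (continuous_xDeriv hf) hd'.xDeriv hp0 (by norm_num) (by linarith) x
  -- Both sides of `ret_scale` are differentiated at c = 1; uniqueness of the derivative gives the
  -- identity.
  have h1 : HasDerivAt (fun c : ℝ => ret f (c • x)) (xDeriv (ret f) x) 1 := by
    have h := hasFDerivAt_cone hk hf hd (hd'.mono (by linarith)) hp0 (by norm_num) (by linarith) x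
    have h' : HasFDerivAt (ret f) (fderiv ℝ (ret f) x) ((1 : ℝ) • x) := by
      rw [one_smul]; exact h.differentiableAt.hasFDerivAt
    have h2 : HasDerivAt (fun c : ℝ => c • x) x 1 := by
      simpa using (hasDerivAt_id (1 : ℝ)).smul_const x
    exact h'.comp_hasDerivAt 1 h2
  have h2 : HasDerivAt (fun c : ℝ => ret (fun y => f (c • y)) x) (ret (xDeriv f) x) 1 := by
    obtain ⟨c₀, hc₀, hb⟩ := hd'.exists_nonneg
    have main := hasDerivAt_integral_of_dominated_loc_of_deriv_le (x₀ := (1 : ℝ))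
      (F := fun c u => ‖u‖ ^ (-1 : ℝ) • f (c • (x + nul u)))
      (F' := fun c (u : Space) => ‖u‖ ^ (-1 : ℝ) • fderiv ℝ f (c • (x + nul u)) (x + nul u))
      (bound := fun u => 1 * (c₀ * 2 ^ (p + 1)) * (1 + ‖x‖) ^ p * radial 1 p 1 u) (μ := volume)
      (Metric.ball_mem_nhds 1 (by norm_num : (0 : ℝ) < 1 / 2))
      (Eventually.of_forall fun c => aestronglyMeasurable_cone hk.1
        (hf.continuous.comp (continuous_const_smul c)) x) (by simpa using hi) ?_ ?_
      ((integrable_radial one_pos hp0 (by norm_num) (by linarith)).const_mul _) ?_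
    · simpa [ret, cone, xDeriv] using main.2
    · simp only [one_smul]; exact hi'.aestronglyMeasurable
    · refine Eventually.of_forall fun u c hc => ?_
      rw [Metric.mem_ball, Real.dist_eq, abs_lt] at hc
      refine norm_cone_integrand_le (f := fun y => fderiv ℝ f (c • y) y) (c := c₀ * 2 ^ (p + 1))
        (κ := fun u => ‖u‖ ^ (-1 : ℝ)) zero_le_one (fun u => ?_) hp0 (by positivity) (fun y => ?_)
        le_rfl u
      · rw [abs_of_nonneg (by positivity), one_mul]
      -- The ball |c - 1| < 1/2 keeps c above 1/2, so the decay at c • y is comparable with that at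
      -- y.
      · have hle : 1 + ‖y‖ ≤ 2 * (1 + ‖c • y‖) := by
          rw [norm_smul, Real.norm_of_nonneg (by linarith)]
          nlinarith [norm_nonneg y]
        have := wt_le (p := p + 1) (by positivity) (by norm_num) (by linarith) hle
        calc ‖fderiv ℝ f (c • y) y‖ ≤ ‖fderiv ℝ f (c • y)‖ * ‖y‖ := ContinuousLinearMap.le_opNorm _ _
          _ ≤ (c₀ * (2 ^ (p + 1) * (1 + ‖y‖) ^ (-(p + 1)))) * (1 + ‖y‖) := by
            gcongr
            · exact (hb _).trans (by gcongr)
            · linarith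
          _ = c₀ * 2 ^ (p + 1) * ((1 + ‖y‖) * wt (p + 1) y) := by unfold wt; ring
          _ = _ := by rw [one_add_mul_wt]
    · refine Eventually.of_forall fun u c _ => ?_
      have h := (hf.differentiable one_ne_zero (c • (x + nul u))).hasFDerivAt
      have h2 : HasDerivAt (fun c : ℝ => c • (x + nul u)) (x + nul u) c := by
        simpa using (hasDerivAt_id c).smul_const (x + nul u)
      exact (h.comp_hasDerivAt c h2).const_smul _
  have h3 : HasDerivAt (fun c : ℝ => c ^ 2 • ret (fun y => f (c • y)) x)
      (ret (xDeriv f) x + (2 : ℝ) • ret f x) 1 := by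
    have h := (hasDerivAt_pow 2 (1 : ℝ)).smul h2
    norm_num at h
    exact h
  have h4 : (fun c : ℝ => ret f (c • x)) =ᶠ[𝓝 1] fun c => c ^ 2 • ret (fun y => f (c • y)) x := by
    filter_upwards [lt_mem_nhds zero_lt_one] with c hc
    exact ret_scale f hc x
  rw [h1.unique (h3.congr_of_eventuallyEq h4)]
  have hi2 : Integrable (fun u : Space => ‖u‖ ^ (-1 : ℝ) • ((2 : ℝ) • f (x + nul u))) :=
    (hi.smul (2 : ℝ)).congr (Eventually.of_forall fun u => smul_comm _ _ _)
  unfold ret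
  rw [cone_add (g := fun y => (2 : ℝ) • f y) hi' hi2]
  congr 1
  unfold cone
  rw [← integral_smul]
  exact integral_congr_ae (Eventually.of_forall fun u => smul_comm _ _ _)

/-! ### Integration by parts on the past light cone -/

/-- Integration by parts against the constant function 1. -/
lemma integral_eq_zero_of_hasLineDerivAt {G G' : Space → E} {v : Space} (hG : Integrable G)
    (hG' : Integrable G') (h : ∀ u, HasLineDerivAt ℝ G (G' u) u v) : ∫ u, G' u = 0 := by
  have := integral_bilinear_hasLineDerivAt_right_eq_neg_left_of_integrable (μ := volume) (v := v)
    (f := G) (f' := G') (g := fun _ => (1 : ℝ)) (g' := fun _ => (0 : ℝ))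
    (B := (ContinuousLinearMap.lsmul ℝ ℝ).flip) (by simpa using hG') (by simp) (by simpa using hG)
    (fun u _ => h u) (fun u _ => hasDerivAt_const _ _)
  simpa using this.symm

/-- The radius `(|u|² + δ²)^{1/2}` of the regularised light cone. -/
def hypRadius (δ : ℝ) (u : Space) : ℝ := √(‖u‖ ^ 2 + δ ^ 2)

/-- The point of the regularised past light cone over `u`. -/
def hypNul (δ : ℝ) (u : Space) : Spacetime := point (-hypRadius δ u) u

lemma hypRadius_zero (u : Space) : hypRadius 0 u = ‖u‖ := by simp [hypRadius]

lemma hypNul_zero (u : Space) : hypNul 0 u = nul u := by rw [hypNul, hypRadius_zero]; rfl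

lemma norm_le_hypRadius (δ : ℝ) (u : Space) : ‖u‖ ≤ hypRadius δ u :=
  Real.le_sqrt_of_sq_le (by nlinarith [sq_nonneg δ])

/-- The integrand of the regularised integration by parts formula. -/
def hypDeriv (m : ℕ) (f : Spacetime → E) (x : Spacetime) (v : Space) (δ : ℝ) (u : Space) : E :=
  (hypRadius δ u)⁻¹ ^ m •
      fderiv ℝ f (x + hypNul δ u) (point (-(inner ℝ u v * (hypRadius δ u)⁻¹)) v) -
    (m * inner ℝ u v * (hypRadius δ u)⁻¹ ^ (m + 2)) • f (x + hypNul δ u)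

/-- The light cone and the kernel are singular at u = 0. Replacing |u| by (|u|² + δ²)^(1/2) turns
the cone into a smooth hyperboloid, on which the chain rule holds everywhere. -/
lemma hasLineDerivAt_hyp (m : ℕ) {f : Spacetime → E} (hf : Differentiable ℝ f) (x : Spacetime)
    (v : Space) {δ : ℝ} (hδ : 0 < δ) (u : Space) :
    HasLineDerivAt ℝ (fun u => (hypRadius δ u)⁻¹ ^ m • f (x + hypNul δ u))
      (hypDeriv m f x v δ u) u v := by
  have hpos : ∀ u : Space, 0 < hypRadius δ u := fun u => Real.sqrt_pos.mpr (by positivity)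
  have h0 : HasDerivAt (fun t : ℝ => u + t • v) v 0 := by
    simpa using ((hasDerivAt_id (0 : ℝ)).smul_const v).const_add u
  have hq : HasDerivAt (fun t : ℝ => hypRadius δ (u + t • v))
      (inner ℝ u v * (hypRadius δ u)⁻¹) 0 := by
    have h1 := (h0.norm_sq.add_const (δ ^ 2)).sqrt (by simp; positivity)
    refine h1.congr_deriv ?_
    simp only [zero_smul, add_zero]
    unfold hypRadius
    field_simp
  have hi : HasDerivAt (fun t : ℝ => (hypRadius δ (u + t • v))⁻¹ ^ m)
      (-(m * inner ℝ u v * (hypRadius δ u)⁻¹ ^ (m + 2))) 0 := by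
    have h1 := (hq.inv (by simpa using (hpos u).ne')).pow m
    refine h1.congr_deriv ?_
    simp only [zero_smul, add_zero, Pi.inv_apply]
    rcases m with _ | m
    · simp
    · simp only [Nat.add_sub_cancel, div_eq_mul_inv, ← inv_pow]
      ring
  have hp : HasDerivAt (fun t : ℝ => x + hypNul δ (u + t • v))
      (point (-(inner ℝ u v * (hypRadius δ u)⁻¹)) v) 0 := by
    simp only [hypNul, point_eq]
    exact ((hq.neg.smul_const timeVec).add (incl.hasFDerivAt.comp_hasDerivAt 0 h0)).const_add x
  have hf' : HasFDerivAt f (fderiv ℝ f (x + hypNul δ u)) (x + hypNul δ (u + (0 : ℝ) • v)) := by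
    simpa using (hf (x + hypNul δ u)).hasFDerivAt
  have := hi.smul (hf'.comp_hasDerivAt 0 hp)
  refine this.congr_deriv ?_
  simp [hypDeriv, sub_eq_add_neg]

lemma inv_pow_eq_rpow (a : ℝ) (m : ℕ) (ha : 0 ≤ a) : a⁻¹ ^ m = a ^ (-(m : ℝ)) := by
  rw [Real.rpow_neg ha, Real.rpow_natCast, inv_pow]

lemma norm_hyp_le {p c : ℝ} (hp : 0 ≤ p) {f : Spacetime → E} (hc : 0 ≤ c)
    (hf : ∀ y, ‖f y‖ ≤ c * wt p y) (x : Spacetime) (δ : ℝ) (u : Space) :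
    ‖f (x + hypNul δ u)‖ ≤ c * (1 + ‖x‖) ^ p * (1 + ‖u‖) ^ (-p) := by
  have h1 := one_add_norm_le x u (y := hypNul δ u) (spacePart_point _ _)
  have h2 := wt_le (p := p) (by positivity) (by positivity) hp h1
  calc _ ≤ c * wt p (x + hypNul δ u) := hf _
    _ ≤ c * ((1 + ‖x‖) ^ p * (1 + ‖u‖) ^ (-p)) := by gcongr
    _ = _ := by ring

lemma hypRadius_inv_le (δ : ℝ) {u : Space} (hu : u ≠ 0) (m : ℕ) :
    (hypRadius δ u)⁻¹ ^ m ≤ ‖u‖ ^ (-(m : ℝ)) := by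
  rw [← inv_pow_eq_rpow _ _ (norm_nonneg u)]
  have := norm_pos_iff.mpr hu
  exact pow_le_pow_left₀ (inv_nonneg.mpr (Real.sqrt_nonneg _))
    (inv_anti₀ this (norm_le_hypRadius δ u)) m

lemma hypRadius_nonneg (δ : ℝ) (u : Space) : 0 ≤ hypRadius δ u := Real.sqrt_nonneg _

/-- Independent of δ, because the regularised radius is at least |u|; this permits dominated
convergence as δ → 0. -/
lemma norm_hypDeriv_le {p c : ℝ} (hp : 0 ≤ p) {f : Spacetime → E} (hc : 0 ≤ c)
    (hf : ∀ y, ‖f y‖ ≤ c * wt p y) (hf' : ∀ y, ‖fderiv ℝ f y‖ ≤ c * wt p y) (m : ℕ)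
    (x : Spacetime) (v : Space) (δ : ℝ) {u : Space} (hu : u ≠ 0) :
    ‖hypDeriv m f x v δ u‖ ≤ 2 * ‖v‖ * c * (1 + ‖x‖) ^ p * radial m p 1 u +
      m * ‖v‖ * c * (1 + ‖x‖) ^ p * radial (m + 1) p 1 u := by
  have hu0 := norm_pos_iff.mpr hu
  have hq := norm_le_hypRadius δ u
  have hq0 := hypRadius_nonneg δ u
  have hin : |inner ℝ u v| ≤ ‖u‖ * ‖v‖ := abs_real_inner_le_norm u v
  have hi1 : |inner ℝ u v| * (hypRadius δ u)⁻¹ ≤ ‖v‖ := by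
    rw [← div_eq_mul_inv, div_le_iff₀ (hu0.trans_le hq)]
    nlinarith [norm_nonneg v]
  have hpt : ‖point (-(inner ℝ u v * (hypRadius δ u)⁻¹)) v‖ ≤ 2 * ‖v‖ := by
    refine (norm_point_le _ _).trans ?_
    rw [abs_neg, abs_mul, abs_of_nonneg (inv_nonneg.mpr hq0)]
    linarith
  refine (norm_sub_le _ _).trans (add_le_add ?_ ?_)
  · rw [norm_smul, Real.norm_of_nonneg (by positivity)]
    calc _ ≤ ‖u‖ ^ (-(m : ℝ)) * ((c * (1 + ‖x‖) ^ p * (1 + ‖u‖) ^ (-p)) * (2 * ‖v‖)) := by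
          gcongr
          · exact hypRadius_inv_le δ hu m
          · exact (ContinuousLinearMap.le_opNorm _ _).trans
              (mul_le_mul (norm_hyp_le hp hc hf' x δ u) hpt (norm_nonneg _) (by positivity))
      _ = _ := by unfold radial; ring
  · rw [norm_smul, Real.norm_eq_abs, abs_mul, abs_mul, Nat.abs_cast,
      abs_of_nonneg (show 0 ≤ (hypRadius δ u)⁻¹ ^ (m + 2) by positivity)]
    calc _ = m * (|inner ℝ u v| * (hypRadius δ u)⁻¹ * (hypRadius δ u)⁻¹ ^ (m + 1)) *
            ‖f (x + hypNul δ u)‖ := by ring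
      _ ≤ m * (‖v‖ * ‖u‖ ^ (-((m + 1 : ℕ) : ℝ))) * (c * (1 + ‖x‖) ^ p * (1 + ‖u‖) ^ (-p)) := by
          gcongr
          · exact hypRadius_inv_le δ hu (m + 1)
          · exact norm_hyp_le hp hc hf x δ u
      _ = _ := by unfold radial; push_cast; ring

lemma measurable_point {t : Space → ℝ} {y : Space → Space} (ht : Measurable t) (hy : Measurable y) :
    Measurable fun a => point (t a) (y a) := by
  simp_rw [point_eq]
  exact (ht.smul_const _).add (incl.continuous.measurable.comp hy)

lemma measurable_hypRadius (δ : ℝ) : Measurable (hypRadius δ) := by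
  unfold hypRadius; fun_prop

lemma continuous_hypNul (δ : ℝ) : Continuous (hypNul δ) :=
  continuous_point (by unfold hypRadius; fun_prop) continuous_id

lemma aestronglyMeasurable_hypDeriv (m : ℕ) {f : Spacetime → E} (hf : ContDiff ℝ 1 f)
    (x : Spacetime) (v : Space) (δ : ℝ) :
    AEStronglyMeasurable (hypDeriv m f x v δ) (volume : Measure Space) := by
  have hm := measurable_hypRadius δ
  have hin : Measurable fun u : Space => inner ℝ u v := by fun_prop
  have hp : Measurable fun u : Space => point (-(inner ℝ u v * (hypRadius δ u)⁻¹)) v :=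
    measurable_point (hin.mul hm.inv).neg measurable_const
  have hc := continuous_const.add (continuous_hypNul δ) (f := fun _ => x)
  refine AEStronglyMeasurable.sub ?_ ?_
  · refine (hm.inv.pow_const m).aestronglyMeasurable.smul ?_
    exact Continuous.comp_aestronglyMeasurable₂ (g := fun (L : Spacetime →L[ℝ] E) w => L w)
      isBoundedBilinearMap_apply.continuous
      ((hf.continuous_fderiv one_ne_zero).comp hc).aestronglyMeasurable hp.aestronglyMeasurable
  · exact ((measurable_const.mul hin).mul (hm.inv.pow_const _)).aestronglyMeasurable.smul
      (hf.continuous.comp hc).aestronglyMeasurable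

lemma ae_ne_zero : ∀ᵐ u : Space, u ≠ 0 :=
  compl_mem_ae_iff.mpr (measure_singleton (0 : Space))

/-- The statement is clear for δ > 0 and passes to the limit. With m ≤ 1 the worst kernel |u|^(-m-1)
stays integrable at the vertex, so the vertex contributes no boundary term. The case m = 0 serves
the flux, m = 1 the retarded integral. -/
lemma integral_hypDeriv_zero {m : ℕ} (hm : m ≤ 1) {p : ℝ} (hp : 0 ≤ p) (hmp : 3 < m + p)
    {f : Spacetime → E} (hf : ContDiff ℝ 1 f) (hd : Decays p f) (hd' : Decays p (fderiv ℝ f))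
    (x : Spacetime) (v : Space) : ∫ u, hypDeriv m f x v 0 u = 0 := by
  obtain ⟨c₁, hc₁, h₁⟩ := hd.exists_nonneg
  obtain ⟨c₂, hc₂, h₂⟩ := hd'.exists_nonneg
  set c := c₁ + c₂ with hc
  have hc0 : 0 ≤ c := by positivity
  have h1 : ∀ y, ‖f y‖ ≤ c * wt p y := fun y => (h₁ y).trans
    (mul_le_mul_of_nonneg_right (by linarith) (wt_nonneg _ _))
  have h2 : ∀ y, ‖fderiv ℝ f y‖ ≤ c * wt p y := fun y => (h₂ y).trans
    (mul_le_mul_of_nonneg_right (by linarith) (wt_nonneg _ _))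
  have hm1 : (m : ℝ) ≤ 1 := by exact_mod_cast hm
  have hB : Integrable (fun u => 2 * ‖v‖ * c * (1 + ‖x‖) ^ p * radial m p 1 u +
      m * ‖v‖ * c * (1 + ‖x‖) ^ p * radial (m + 1) p 1 u) :=
    ((integrable_radial one_pos hp (by linarith) hmp).const_mul _).add
      ((integrable_radial one_pos hp (by linarith) (by linarith)).const_mul _)
  have hb : ∀ δ, ∀ᵐ u : Space, ‖hypDeriv m f x v δ u‖ ≤
      2 * ‖v‖ * c * (1 + ‖x‖) ^ p * radial m p 1 u +
        m * ‖v‖ * c * (1 + ‖x‖) ^ p * radial (m + 1) p 1 u := fun δ => by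
    filter_upwards [ae_ne_zero] with u hu
    exact norm_hypDeriv_le hp hc0 h1 h2 m x v δ hu
  have hz : ∀ δ : ℝ, 0 < δ → ∫ u, hypDeriv m f x v δ u = 0 := by
    intro δ hδ
    refine integral_eq_zero_of_hasLineDerivAt (v := v) (G := fun u => (hypRadius δ u)⁻¹ ^ m •
      f (x + hypNul δ u)) ?_ (hB.mono' (aestronglyMeasurable_hypDeriv m hf x v δ) (hb δ))
      (hasLineDerivAt_hyp m (hf.differentiable one_ne_zero) x v hδ)
    refine ((integrable_radial one_pos hp (by linarith) hmp).const_mul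
      (c * (1 + ‖x‖) ^ p)).mono' ?_ ?_
    · exact ((measurable_hypRadius δ).inv.pow_const m).aestronglyMeasurable.smul
        (hf.continuous.comp (continuous_const.add (continuous_hypNul δ))).aestronglyMeasurable
    · filter_upwards [ae_ne_zero] with u hu
      rw [norm_smul, Real.norm_of_nonneg (pow_nonneg (inv_nonneg.mpr (hypRadius_nonneg δ u)) m)]
      calc _ ≤ ‖u‖ ^ (-(m : ℝ)) * (c * (1 + ‖x‖) ^ p * (1 + ‖u‖) ^ (-p)) := by
            gcongr
            · exact hypRadius_inv_le δ hu m
            · exact norm_hyp_le hp hc0 h1 x δ u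
        _ = _ := by unfold radial; ring
  have hlim := tendsto_integral_of_dominated_convergence (μ := volume)
    (F := fun n : ℕ => hypDeriv m f x v (1 / ((n : ℝ) + 1))) (f := hypDeriv m f x v 0) _
    (fun n => aestronglyMeasurable_hypDeriv m hf x v _) hB (fun n => hb _) ?_
  · refine tendsto_nhds_unique hlim ?_
    have : (fun n : ℕ => ∫ u, hypDeriv m f x v (1 / ((n : ℝ) + 1)) u) = fun _ => 0 :=
      funext fun n => hz _ (by positivity)
    rw [this]
    exact tendsto_const_nhds
  · filter_upwards [ae_ne_zero] with u hu
    have hq : ContinuousAt (fun δ => hypRadius δ u) 0 := by unfold hypRadius; fun_prop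
    have hi : ContinuousAt (fun δ => (hypRadius δ u)⁻¹) 0 :=
      hq.inv₀ (by rw [hypRadius_zero]; exact norm_ne_zero_iff.mpr hu)
    have hpt : ContinuousAt (fun δ => x + hypNul δ u) 0 := by
      simp only [hypNul, point_eq]; fun_prop
    have hcont : ContinuousAt (fun δ => hypDeriv m f x v δ u) 0 := by
      unfold hypDeriv
      refine ContinuousAt.sub ((hi.pow m).smul (ContinuousAt.clm_apply ?_ ?_))
        ((continuousAt_const.mul (hi.pow _)).smul ?_)
      · exact (hf.continuous_fderiv one_ne_zero).continuousAt.comp hpt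
      · simp only [point_eq]; fun_prop
      · exact hf.continuous.continuousAt.comp hpt
    exact hcont.tendsto.comp tendsto_one_div_add_atTop_nhds_zero_nat

/-! ### Conserved fluxes through the light cone -/

lemma point_single (t : ℝ) (i : Fin 3) :
    point t (EuclideanSpace.single i 1) = t • timeVec + EuclideanSpace.single i.succ 1 := by
  rw [point_eq]; congr 1
  ext j; fin_cases i <;> fin_cases j <;> simp [incl, point]

lemma fderiv_comp_clm {f : Spacetime → E} (hf : Differentiable ℝ f) (L : E →L[ℝ] F)
    (y v : Spacetime) : fderiv ℝ (fun y => L (f y)) y v = L (fderiv ℝ f y v) := by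
  have := (L.hasFDerivAt.comp y (hf y).hasFDerivAt).fderiv
  exact congrArg (fun A => A v) this

lemma Decays.fderiv_clm {p : ℝ} {f : Spacetime → E} (hf : Differentiable ℝ f)
    (hd : Decays p (fderiv ℝ f)) (L : E →L[ℝ] F) : Decays p (fderiv ℝ fun y => L (f y)) := by
  refine hd.of_norm_le (norm_nonneg L) fun y => ?_
  have := (L.hasFDerivAt.comp y (hf y).hasFDerivAt).fderiv
  change fderiv ℝ (fun y => L (f y)) y = _ at this
  rw [this]
  exact ContinuousLinearMap.opNorm_comp_le _ _

lemma abs_comp_mul_inv_le (u : Space) (i : Fin 3) : |u i * ‖u‖⁻¹| ≤ 1 := by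
  rw [abs_mul, abs_inv, abs_norm, ← div_eq_mul_inv]
  refine div_le_one_of_le₀ ?_ (norm_nonneg u)
  exact PiLp.norm_apply_le u i

lemma isKernel_one : IsKernel 0 fun _ => (1 : ℝ) := ⟨measurable_const, 1, zero_le_one, by simp⟩

lemma isKernel_comp (i : Fin 3) : IsKernel 0 fun u => u i * ‖u‖⁻¹ :=
  ⟨by fun_prop, 1, zero_le_one, fun u => by simpa using abs_comp_mul_inv_le u i⟩

/-- At late t every point y of the translated cone satisfies t + |u| ≤ (3 + 3|x|)(1 + |y|), since a
small space part of y forces |u| to be bounded and hence its time to be large. The radial integral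
at scale t is then of order t^(-ε). -/
lemma tendsto_cone_time {ε : ℝ} (hε : 0 < ε) {κ : Space → ℝ} (hκ : ∀ u, |κ u| ≤ 1)
    {f : Spacetime → E} (hd : Decays (3 + ε) f) (x : Spacetime) :
    Tendsto (fun t : ℝ => cone κ f (x + t • timeVec)) atTop (𝓝 0) := by
  obtain ⟨c, hc, hf⟩ := hd.exists_nonneg
  have hlim : Tendsto (fun t : ℝ => c * (3 + 3 * ‖x‖) ^ (3 + ε) *
      (t ^ (-ε) * radialConst 0 (3 + ε))) atTop (𝓝 0) := by
    simpa using ((tendsto_rpow_neg_atTop hε).mul_const _).const_mul _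
  refine squeeze_zero_norm' ?_ hlim
  filter_upwards [eventually_gt_atTop (0 : ℝ)] with t ht
  have hD := (domInt_radial (k := 0) (p := 3 + ε) ht (by linarith) (by norm_num)
    (by linarith)).const_mul (c := c * (3 + 3 * ‖x‖) ^ (3 + ε)) (by positivity)
  rw [show 3 - 0 - (3 + ε) = -ε by ring] at hD
  refine hD.norm_integral_le fun u => ?_
  set y := x + t • timeVec + nul u with hy
  have h1 : ‖u‖ ≤ ‖y‖ + ‖x‖ := by
    have h2 : spacePart y = spacePart x + u := by
      ext i; fin_cases i <;> simp [hy, timeVec, spacePart, nul, point]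
    have h3 := norm_sub_le (spacePart y) (spacePart x)
    rw [h2, add_sub_cancel_left, ← h2] at h3
    linarith [norm_spacePart_le x, norm_spacePart_le y]
  have h2 : t ≤ ‖y‖ + ‖x‖ + ‖u‖ := by
    have h3 : y 0 = x 0 + t - ‖u‖ := by simp [hy, timeVec]; ring
    have h4 := abs_time_le y
    have h5 := abs_time_le x
    rw [h3] at h4
    linarith [abs_le.mp h4, abs_le.mp h5]
  have h3 : t + ‖u‖ ≤ (3 + 3 * ‖x‖) * (1 + ‖y‖) := by
    nlinarith [norm_nonneg x, norm_nonneg y]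
  have h4 := wt_le (p := 3 + ε) (by positivity) (by positivity) (by linarith) h3
  rw [norm_smul, Real.norm_eq_abs]
  calc |κ u| * ‖f y‖ ≤ 1 * (c * ((3 + 3 * ‖x‖) ^ (3 + ε) * (t + ‖u‖) ^ (-(3 + ε)))) := by
        gcongr
        · exact hκ u
        · exact (hf y).trans (by gcongr)
    _ = _ := by simp [radial]; ring

/-- The coordinate functional. -/
abbrev coordL (a : Fin 4) : Spacetime →L[ℝ] ℝ := EuclideanSpace.proj a

/-- The derivative of f(x + nul u) in uᵢ is ∂ᵢf - (uᵢ/|u|) ∂₀f, and its integral vanishes. -/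
lemma cone_time_eq {p : ℝ} (hp : 3 < p) {f : Spacetime → ℝ} (hf : ContDiff ℝ 1 f)
    (hd : Decays p f) (hd' : Decays p (fderiv ℝ f)) (x : Spacetime) (i : Fin 3) :
    cone (fun u => u i * ‖u‖⁻¹) (fun y => fderiv ℝ f y timeVec) x =
      cone (fun _ => 1) (fun y => fderiv ℝ f y (EuclideanSpace.single i.succ 1)) x := by
  have h := integral_hypDeriv_zero (m := 0) (by norm_num) (p := p) (by linarith)
    (by simpa using hp) hf hd hd' x (EuclideanSpace.single i 1)
  have hc : ∀ v : Spacetime, Continuous fun y => fderiv ℝ f y v := fun v =>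
    (hf.continuous_fderiv one_ne_zero).clm_apply continuous_const
  have i1 := integrable_cone (isKernel_comp i) (hc timeVec) (hd'.clm_apply timeVec)
    (by linarith) (by norm_num) (by linarith) x
  have i2 := integrable_cone isKernel_one (hc (EuclideanSpace.single i.succ 1))
    (hd'.clm_apply (EuclideanSpace.single i.succ 1)) (by linarith) (by norm_num) (by linarith) x
  have e : ∀ u, hypDeriv 0 f x (EuclideanSpace.single i 1) 0 u =
      (1 : ℝ) • fderiv ℝ f (x + nul u) (EuclideanSpace.single i.succ 1) -
        (u i * ‖u‖⁻¹) • fderiv ℝ f (x + nul u) timeVec := fun u => by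
    simp [hypDeriv, hypRadius_zero, hypNul_zero, point_single, EuclideanSpace.inner_single_right]
    ring
  simp_rw [e] at h
  rw [integral_sub i2 i1, sub_eq_zero] at h
  exact h.symm

/-- The charge flowing through the past light cone of `x`. -/
def flux (K : Spacetime → Spacetime) (x : Spacetime) : ℝ :=
  cone (fun _ => 1) (fun y => K y 0) x + ∑ i : Fin 3, cone (fun u => u i * ‖u‖⁻¹)
    (fun y => K y i.succ) x

/-- After integration by parts the time derivative of the flux is the cone integral of the
divergence, hence zero. So the flux is constant along the time axis, and its limit at late times is
zero. -/
lemma flux_eq_zero {ε : ℝ} (hε : 0 < ε) {K : Spacetime → Spacetime} (hK : ContDiff ℝ 1 K)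
    (hd : Decays (3 + ε) K) (hd' : Decays (3 + ε) (fderiv ℝ K)) (hdiv : ∀ x, divergence K x = 0)
    (x : Spacetime) : flux K x = 0 := by
  have hKd := hK.differentiable one_ne_zero
  have hc1 : ∀ a, ContDiff ℝ 1 fun y => K y a := fun a => (coordL a).contDiff.comp hK
  have hcd : ∀ a, Decays (3 + ε) fun y => K y a := fun a => hd.clm (coordL a)
  have hcd' : ∀ a, Decays (3 + ε) (fderiv ℝ fun y => K y a) := fun a => hd'.fderiv_clm hKd (coordL a)
  have hker : ∀ {κ : Space → ℝ} (_ : IsKernel 0 κ) (a : Fin 4) (x : Spacetime),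
      HasDerivAt (fun t : ℝ => cone κ (fun y => K y a) (x + t • timeVec))
        (cone κ (fun y => fderiv ℝ (fun y => K y a) y timeVec) x) 0 := by
    intro κ hκ a x
    have h1 := hasFDerivAt_cone hκ (hc1 a) (hcd a) (hcd' a) (by linarith) (by norm_num)
      (by linarith) (x + (0 : ℝ) • timeVec)
    have h2 : HasDerivAt (fun t : ℝ => x + t • timeVec) timeVec 0 := by
      simpa using ((hasDerivAt_id (0 : ℝ)).smul_const timeVec).const_add x
    refine (h1.comp_hasDerivAt 0 h2).congr_deriv ?_
    rw [zero_smul, add_zero]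
    exact clm_cone (ContinuousLinearMap.apply ℝ ℝ timeVec)
      (integrable_cone hκ ((hc1 a).continuous_fderiv one_ne_zero) (hcd' a) (by linarith)
        (by norm_num) (by linarith) x)
  have hder0 : ∀ x, HasDerivAt (fun t : ℝ => flux K (x + t • timeVec)) 0 0 := by
    intro x
    have h := (hker isKernel_one 0 x).add
      (HasDerivAt.fun_sum fun (i : Fin 3) (_ : i ∈ Finset.univ) => hker (isKernel_comp i) i.succ x)
    refine h.congr_deriv ?_
    have e : ∀ i : Fin 3, cone (fun u => u i * ‖u‖⁻¹)
        (fun y => fderiv ℝ (fun y => K y i.succ) y timeVec) x = cone (fun _ => 1)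
          (fun y => fderiv ℝ (fun y => K y i.succ) y (EuclideanSpace.single i.succ 1)) x :=
      fun i => cone_time_eq (by linarith) (hc1 _) (hcd _) (hcd' _) x i
    simp_rw [e]
    have hint : ∀ a : Fin 4, ∀ v : Spacetime, Integrable fun u =>
        (1 : ℝ) • fderiv ℝ (fun y => K y a) (x + nul u) v := fun a v =>
      integrable_cone isKernel_one
        (((hc1 a).continuous_fderiv one_ne_zero).clm_apply continuous_const)
        ((hcd' a).clm_apply v) (by linarith) (by norm_num) (by linarith) x
    have key : ∫ u : Space, ((1 : ℝ) • fderiv ℝ (fun y => K y 0) (x + nul u) timeVec +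
        ∑ i : Fin 3, (1 : ℝ) • fderiv ℝ (fun y => K y i.succ) (x + nul u)
          (EuclideanSpace.single i.succ 1)) = 0 := by
      rw [← integral_zero Space ℝ]
      congr 1
      ext u
      have := hdiv (x + nul u)
      simp only [divergence, partialD, Fin.sum_univ_succ (n := 3)] at this
      simpa [timeVec] using this
    have hint' : ∀ i : Fin 3, Integrable fun u : Space => (1 : ℝ) •
        fderiv ℝ (fun y => K y i.succ) (x + nul u) (EuclideanSpace.single i.succ 1) :=
      fun i => hint _ _
    rw [integral_add (hint _ _) (integrable_finsetSum _ fun i _ => hint' i),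
      integral_finsetSum _ fun i _ => hint' i] at key
    exact key
  have hder : ∀ t, HasDerivAt (fun t : ℝ => flux K (x + t • timeVec)) 0 t := by
    intro t
    have h := hder0 (x + t • timeVec)
    have h2 : HasDerivAt (fun s : ℝ => s - t) 1 t := (hasDerivAt_id t).sub_const t
    have h3 : HasDerivAt (fun t_1 : ℝ => flux K (x + t • timeVec + t_1 • timeVec)) 0 (t - t) := by
      rwa [sub_self]
    have h4 := HasDerivAt.scomp (h := fun s => s - t) t h3 h2
    simp only [smul_zero] at h4
    refine h4.congr_of_eventuallyEq (Eventually.of_forall fun s => ?_)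
    simp only [Function.comp, add_assoc, ← add_smul, add_sub_cancel]
  have hconst : ∀ t, flux K (x + t • timeVec) = flux K x := fun t => by
    have := is_const_of_deriv_eq_zero (fun t => (hder t).differentiableAt)
      (fun t => (hder t).deriv) t 0
    simpa using this
  have hlim : Tendsto (fun t : ℝ => flux K (x + t • timeVec)) atTop (𝓝 0) := by
    have h0 := tendsto_cone_time hε (κ := fun _ => (1 : ℝ)) (by simp) (hcd 0) x
    have h1 := tendsto_finsetSum Finset.univ fun (i : Fin 3) (_ : i ∈ Finset.univ) =>
      tendsto_cone_time hε (fun u => abs_comp_mul_inv_le u i) (hcd i.succ) x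
    simpa [flux] using h0.add h1
  simp_rw [hconst] at hlim
  exact tendsto_nhds_unique tendsto_const_nhds hlim

/-- The Minkowski product as a bilinear map. -/
def minkL : Spacetime →L[ℝ] Spacetime →L[ℝ] ℝ :=
  ∑ a, metric a • (coordL a).smulRight (coordL a)

lemma minkL_apply (x y : Spacetime) : minkL x y = minkowski x y := by
  simp [minkL, minkowski, mul_assoc]

/-- For a conserved current the contraction with the position commutes with the retarded integral. -/
lemma minkowski_ret {ε : ℝ} (hε : 0 < ε) {K : Spacetime → Spacetime} (hK : ContDiff ℝ 1 K)
    (hd : Decays (3 + ε) K) (hd' : Decays (3 + ε) (fderiv ℝ K)) (hdiv : ∀ x, divergence K x = 0)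
    (x : Spacetime) : minkowski x (ret K x) = ret (fun y => minkowski y (K y)) x := by
  have hk : IsKernel 1 fun u : Space => ‖u‖ ^ (-1 : ℝ) := isKernel_rpow 1
  have hi := integrable_cone hk hK.continuous hd (by linarith) (by norm_num) (by linarith) x
  have h0 : ∀ a, Continuous fun y => K y a := fun a => (coordL a).continuous.comp hK.continuous
  have hcd : ∀ a, Decays (3 + ε) fun y => K y a := fun a => hd.clm (coordL a)
  have i0 := integrable_cone isKernel_one (h0 0) (hcd 0) (by linarith) (by norm_num)
    (by linarith) x
  have i1 : ∀ i : Fin 3, Integrable fun u : Space => (u i * ‖u‖⁻¹) • K (x + nul u) i.succ := fun i =>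
    integrable_cone (isKernel_comp i) (h0 i.succ) (hcd _) (by linarith) (by norm_num)
      (by linarith) x
  have i2 : Integrable fun u : Space => (1 : ℝ) • K (x + nul u) 0 +
      ∑ i : Fin 3, (u i * ‖u‖⁻¹) • K (x + nul u) i.succ :=
    i0.add (integrable_finsetSum Finset.univ fun i _ => i1 i)
  have hflux : ∫ u : Space, ((1 : ℝ) • K (x + nul u) 0 +
      ∑ i : Fin 3, (u i * ‖u‖⁻¹) • K (x + nul u) i.succ) = 0 := by
    rw [integral_add i0 (integrable_finsetSum Finset.univ fun i _ => i1 i),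
      integral_finsetSum _ fun i _ => i1 i]
    exact flux_eq_zero hε hK hd hd' hdiv x
  have i3 := (minkL x).integrable_comp hi
  rw [← minkL_apply, ret, clm_cone (minkL x) hi]
  unfold ret cone
  -- With y = x + nul u, the extra term |u|⁻¹ nul u · K equals -(K⁰ + Σ uᵢKⁱ/|u|), minus the flux
  -- density.
  have e : (fun u : Space => ‖u‖ ^ (-1 : ℝ) • minkowski (x + nul u) (K (x + nul u))) =ᵐ[volume]
      fun u => minkL x (‖u‖ ^ (-1 : ℝ) • K (x + nul u)) - ((1 : ℝ) • K (x + nul u) 0 +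
        ∑ i : Fin 3, (u i * ‖u‖⁻¹) • K (x + nul u) i.succ) := by
    filter_upwards [ae_ne_zero] with u hu
    have hu' : ‖u‖ ≠ 0 := norm_ne_zero_iff.mpr hu
    rw [← minkL_apply, map_add, add_apply, minkL_apply (nul u), map_smul,
      Real.rpow_neg_one]
    simp [minkowski, metric, Fin.sum_univ_four, Fin.sum_univ_three, nul, point]
    field_simp
    ring
  rw [integral_congr_ae e, integral_sub i3 i2, hflux, sub_zero]
  simp

/-! ### Vanishing at the light cone -/

/-- Decay of order `p` inside the light cone and of order `p + ε` outside. -/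
def ConeDecays (p ε : ℝ) (f : Spacetime → E) : Prop :=
  ∃ c : ℝ, 0 ≤ c ∧ ∀ y, ‖f y‖ ≤ c * (wt p y * thetaSq y + wt (p + ε) y)

lemma ConeDecays.decays {p ε : ℝ} (hε : 0 ≤ ε) {f : Spacetime → E} (h : ConeDecays p ε f) :
    Decays p f := by
  obtain ⟨c, hc, h⟩ := h
  refine ⟨2 * c, fun y => (h y).trans ?_⟩
  have h1 : wt p y * thetaSq y ≤ wt p y := mul_le_of_le_one_right (wt_nonneg _ _) (thetaSq_le_one _)
  have h2 := wt_anti (le_add_of_nonneg_right hε : p ≤ p + ε) y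
  nlinarith

lemma exists_direction (z : Space) : ∃ e : Space, ‖e‖ = 1 ∧ z = ‖z‖ • e := by
  by_cases hz : z = 0
  · exact ⟨EuclideanSpace.single 0 1, by simp, by simp [hz]⟩
  · have := norm_ne_zero_iff.mpr hz
    refine ⟨‖z‖⁻¹ • z, ?_, ?_⟩
    · rw [norm_smul, norm_inv, norm_norm]; field_simp
    · rw [smul_smul, mul_inv_cancel₀ this, one_smul]

/-- For causal y the time alone controls |y|, so moving y in space at fixed time costs only a factor
in the weight. -/
lemma wt_le_of_time {p : ℝ} (hp : 0 ≤ p) {y z : Spacetime} (h : ‖spacePart y‖ ≤ |y 0|)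
    (hz : z 0 = y 0) : wt p z ≤ 2 ^ p * wt p y := by
  refine wt_le (by positivity) (by norm_num) hp ?_
  have h1 := norm_le_add_split y
  have h2 := abs_time_le z
  rw [hz] at h2
  linarith

/-- A function which decays faster outside the light cone is small near the cone. -/
lemma coneDecays_dist {p ε : ℝ} (hp : 0 ≤ p) (hε : 0 ≤ ε) (hε1 : ε ≤ 1) {f : Spacetime → E}
    (hf : Differentiable ℝ f) (h : ConeDecays p ε f) (h' : Decays (p + 1) (fderiv ℝ f)) :
    ∃ C : ℝ, 0 ≤ C ∧ ∀ y, ‖f y‖ ≤ C * (wt (p + 1) y * thetaSq y * (|y 0| - ‖spacePart y‖) +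
      wt (p + ε) y) := by
  obtain ⟨c, hc, h⟩ := h
  obtain ⟨c', hc', h'⟩ := h'.exists_nonneg
  refine ⟨c + c * 2 ^ (p + ε) + c' * 2 ^ (p + 1), by positivity, fun y => ?_⟩
  have hw := wt_nonneg (p + ε) y
  have hw1 := wt_nonneg (p + 1) y
  rcases le_or_gt ‖spacePart y‖ |y 0| with hy | hy
  · rw [thetaSq_eq_one hy]
    obtain ⟨e, he, hye⟩ := exists_direction (spacePart y)
    set d := |y 0| - ‖spacePart y‖ with hd
    have hd0 : 0 ≤ d := by linarith
    -- Moving radially at constant time by d reaches the light cone. The additional unit makes the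
    -- end point strictly spacelike, where the faster decay applies; its cost in the mean value
    -- bound is absorbed because p + ε ≤ p + 1.
    set z := y + incl ((d + 1) • e) with hz
    have hz0 : z 0 = y 0 := by
      rw [hz, PiLp.add_apply]; simp [incl]
    have hzs : ‖spacePart z‖ = |y 0| + 1 := by
      have h1 : spacePart (incl ((d + 1) • e)) = (d + 1) • e := spacePart_point _ _
      rw [hz, spacePart_add, h1]
      nth_rewrite 1 [hye]
      rw [← add_smul, norm_smul, he, mul_one, Real.norm_of_nonneg (by positivity)]
      linarith
    have hfz : ‖f z‖ ≤ c * (2 ^ (p + ε) * wt (p + ε) y) := by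
      refine (h z).trans ?_
      rw [thetaSq_eq_zero (by rw [hz0, hzs]; linarith), mul_zero, zero_add]
      gcongr
      exact wt_le_of_time (by linarith) hy hz0
    -- The mean value inequality is used on the whole hyperplane of constant time, where the
    -- derivative is bounded uniformly by its weight at y.
    have hconv : Convex ℝ {w : Spacetime | w 0 = y 0} :=
      convex_hyperplane (f := fun w : Spacetime => w 0) (coordL 0).isLinear _
    have hmv := hconv.norm_image_sub_le_of_norm_fderiv_le (𝕜 := ℝ) (f := f)
      (C := c' * (2 ^ (p + 1) * wt (p + 1) y)) (x := z) (y := y) (fun w _ => hf w)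
      (fun w hw => (h' w).trans (by
        gcongr
        exact wt_le_of_time (by linarith) hy hw)) hz0 rfl
    have hdist : ‖y - z‖ = d + 1 := by
      have h1 : ‖incl ((d + 1) • e)‖ = ‖(d + 1) • e‖ := by
        have := norm_sq_split (incl ((d + 1) • e))
        have h2 : spacePart (incl ((d + 1) • e)) = (d + 1) • e := spacePart_point _ _
        have h3 : (incl ((d + 1) • e)) 0 = 0 := rfl
        rw [h2, h3] at this
        nlinarith [norm_nonneg (incl ((d + 1) • e)), norm_nonneg ((d + 1) • e)]
      rw [hz, sub_add_cancel_left, norm_neg, h1, norm_smul, he, mul_one,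
        Real.norm_of_nonneg (by positivity)]
    rw [hdist] at hmv
    have h3 : ‖f y‖ ≤ ‖f z‖ + ‖f y - f z‖ := norm_le_norm_add_norm_sub' _ _
    have h4 := wt_anti (by linarith : p + ε ≤ p + 1) y
    have h5 : 0 ≤ (c + c * 2 ^ (p + ε)) * (wt (p + 1) y * d) := by positivity
    have h6 : c' * 2 ^ (p + 1) * wt (p + 1) y ≤ c' * 2 ^ (p + 1) * wt (p + ε) y := by gcongr
    have h7 : 0 ≤ c * wt (p + ε) y := by positivity
    nlinarith
  · rw [thetaSq_eq_zero hy]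
    refine (h y).trans ?_
    rw [thetaSq_eq_zero hy]
    simp only [mul_zero, zero_mul, zero_add]
    gcongr
    rw [add_assoc]
    exact le_add_of_nonneg_right (by positivity)

/-! ### The gradient of the retarded integral near the light cone -/

lemma isKernel_inner (v : Space) {k q : ℝ} (h : q = k + 1) :
    IsKernel k fun u => inner ℝ u v * ‖u‖ ^ (-q) := by
  refine ⟨by fun_prop, ‖v‖, norm_nonneg v, fun u => ?_⟩
  rw [abs_mul, abs_of_nonneg (by positivity : 0 ≤ ‖u‖ ^ (-q))]
  rcases eq_or_ne u 0 with rfl | hu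
  · simp; positivity
  have hu0 := norm_pos_iff.mpr hu
  calc _ ≤ (‖u‖ * ‖v‖) * ‖u‖ ^ (-q) := by gcongr; exact abs_real_inner_le_norm u v
    _ = ‖v‖ * (‖u‖ ^ (1 : ℝ) * ‖u‖ ^ (-q)) := by rw [Real.rpow_one]; ring
    _ = _ := by rw [← Real.rpow_add hu0, h]; ring_nf

lemma cone_add_kernel {κ κ' : Space → ℝ} {f : Spacetime → E} {x : Spacetime}
    (h : Integrable (fun u => κ u • f (x + nul u))) (h' : Integrable (fun u => κ' u • f (x + nul u))) :
    cone κ f x + cone κ' f x = cone (fun u => κ u + κ' u) f x := by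
  unfold cone
  rw [← integral_add h h']
  simp [add_smul]

lemma cone_const_mul (a : ℝ) (κ : Space → ℝ) (f : Spacetime → E) (x : Spacetime) :
    a • cone κ f x = cone (fun u => a * κ u) f x := by
  unfold cone
  rw [← integral_smul]
  simp [mul_smul]

/-- Integration by parts for the spatial derivatives of the retarded integral. -/
lemma ret_incl {p : ℝ} (hp : 2 < p) {f : Spacetime → E} (hf : ContDiff ℝ 1 f) (hd : Decays p f)
    (hd' : Decays p (fderiv ℝ f)) (x : Spacetime) (v : Space) :
    ret (fun y => fderiv ℝ f y (incl v)) x =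
      cone (fun u => inner ℝ u v * ‖u‖ ^ (-2 : ℝ)) (fun y => fderiv ℝ f y timeVec) x +
        cone (fun u => inner ℝ u v * ‖u‖ ^ (-3 : ℝ)) f x := by
  have h := integral_hypDeriv_zero (m := 1) le_rfl (p := p) (by linarith)
    (by push_cast; linarith) hf hd hd' x v
  have hc : ∀ v : Spacetime, Continuous fun y => fderiv ℝ f y v := fun v =>
    (hf.continuous_fderiv one_ne_zero).clm_apply continuous_const
  have i1 := integrable_cone (isKernel_rpow 1) (hc (incl v)) (hd'.clm_apply _)
    (by linarith) (by norm_num) (by linarith) x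
  have i2 := integrable_cone (isKernel_inner v (k := 1) (q := 2) (by norm_num)) (hc timeVec)
    (hd'.clm_apply _) (by linarith) (by norm_num) (by linarith) x
  have i3 := integrable_cone (isKernel_inner v (k := 2) (q := 3) (by norm_num)) hf.continuous
    hd (by linarith) (by norm_num) (by linarith) x
  have e : ∀ u, hypDeriv 1 f x v 0 u = ‖u‖ ^ (-1 : ℝ) • fderiv ℝ f (x + nul u) (incl v) -
      (inner ℝ u v * ‖u‖ ^ (-2 : ℝ)) • fderiv ℝ f (x + nul u) timeVec -
        (inner ℝ u v * ‖u‖ ^ (-3 : ℝ)) • f (x + nul u) := fun u => by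
    have h1 : ‖u‖ ^ (-2 : ℝ) = ‖u‖⁻¹ ^ 2 := by rw [inv_pow_eq_rpow _ _ (norm_nonneg u)]; norm_num
    have h2 : ‖u‖ ^ (-3 : ℝ) = ‖u‖⁻¹ ^ 3 := by rw [inv_pow_eq_rpow _ _ (norm_nonneg u)]; norm_num
    rw [h1, h2, Real.rpow_neg_one]
    simp only [hypDeriv, hypRadius_zero, hypNul_zero, point_eq, map_add, map_smul]
    simp only [pow_one, Nat.cast_one, one_mul]
    module
  simp_rw [e] at h
  have i12 : Integrable fun u : Space => ‖u‖ ^ (-1 : ℝ) • fderiv ℝ f (x + nul u) (incl v) -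
      (inner ℝ u v * ‖u‖ ^ (-2 : ℝ)) • fderiv ℝ f (x + nul u) timeVec := i1.sub i2
  rw [integral_sub i12 i3, integral_sub i1 i2, sub_sub, sub_eq_zero] at h
  exact h

lemma fderiv_ret {p : ℝ} (hp : 2 < p) {f : Spacetime → E} (hf : ContDiff ℝ 1 f) (hd : Decays p f)
    (hd' : Decays p (fderiv ℝ f)) (x : Spacetime) : fderiv ℝ (ret f) x = ret (fderiv ℝ f) x :=
  (hasFDerivAt_cone (isKernel_rpow 1) hf hd hd' (by linarith) (by norm_num) (by linarith) x).fderiv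

lemma ret_clm [CompleteSpace E] [CompleteSpace F] {p : ℝ} (hp : 2 < p) (L : E →L[ℝ] F)
    {f : Spacetime → E} (hf : Continuous f) (hd : Decays p f) (x : Spacetime) :
    L (ret f x) = ret (fun y => L (f y)) x :=
  clm_cone L (integrable_cone (isKernel_rpow 1) hf hd (by linarith) (by norm_num) (by linarith) x)

lemma fderiv_ret_apply [CompleteSpace E] {p : ℝ} (hp : 2 < p) {f : Spacetime → E}
    (hf : ContDiff ℝ 1 f) (hd : Decays p f) (hd' : Decays p (fderiv ℝ f)) (x v : Spacetime) :
    fderiv ℝ (ret f) x v = ret (fun y => fderiv ℝ f y v) x := by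
  rw [fderiv_ret hp hf hd hd']
  exact ret_clm hp (ContinuousLinearMap.apply ℝ E v) (hf.continuous_fderiv one_ne_zero) hd' x

lemma ret_add {p : ℝ} (hp : 2 < p) {f g : Spacetime → E} (hf : Continuous f) (hd : Decays p f)
    (hg : Continuous g) (hd' : Decays p g) (x : Spacetime) :
    ret (fun y => f y + g y) x = ret f x + ret g x :=
  cone_add
    (integrable_cone (isKernel_rpow 1) hf hd (by linarith) (by norm_num) (by linarith) x)
    (integrable_cone (isKernel_rpow 1) hg hd' (by linarith) (by norm_num) (by linarith) x)

/-- The retarded integral raises the degree of homogeneity by two: degree -3 sources produce degree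
-1 potentials, so the defects of both correspond. -/
lemma xDeriv_ret_add [CompleteSpace E] {p : ℝ} (hp : 2 < p) {f : Spacetime → E}
    (hf : ContDiff ℝ 1 f) (hd : Decays p f) (hd' : Decays (p + 1) (fderiv ℝ f)) (x : Spacetime) :
    xDeriv (ret f) x + ret f x = ret (fun y => xDeriv f y + (3 : ℝ) • f y) x := by
  have h := ret_add (f := fun y => xDeriv f y + (2 : ℝ) • f y) hp
    ((continuous_xDeriv hf).add (hf.continuous.const_smul 2)) (hd'.xDeriv.add (hd.const_smul 2))
    hf.continuous hd x
  rw [xDeriv_ret hf hd hd' hp, ← h]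
  congr 1
  funext y
  rw [add_assoc]
  congr 1
  module

lemma fderiv_self_split (g : Spacetime → E) (x : Spacetime) :
    xDeriv g x = x 0 • fderiv ℝ g x timeVec + fderiv ℝ g x (incl (spacePart x)) := by
  have h := map_add (fderiv ℝ g x) (x 0 • timeVec) (incl (spacePart x))
  rwa [← point_eq, point_eta, map_smul] at h

/-- The time derivative of the retarded integral, multiplied by the retarded time. -/
lemma retTime_smul_fderiv [CompleteSpace E] {p : ℝ} (hp : 2 < p) {f : Spacetime → E}
    (hf : ContDiff ℝ 1 f) (hd : Decays p f) (hd' : Decays (p + 1) (fderiv ℝ f)) (x : Spacetime) :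
    retTime x • fderiv ℝ (ret f) x timeVec = ret (fun y => xDeriv f y + (3 : ℝ) • f y) x -
      cone (fun u => ‖u‖ ^ (-1 : ℝ) + inner ℝ u (spacePart x) * ‖u‖ ^ (-3 : ℝ)) f x -
      cone (fun u => ‖spacePart x‖ * ‖u‖ ^ (-1 : ℝ) + inner ℝ u (spacePart x) * ‖u‖ ^ (-2 : ℝ))
        (fun y => fderiv ℝ f y timeVec) x := by
  have hd1 : Decays p (fderiv ℝ f) := hd'.mono (by linarith)
  have hc : Continuous fun y => fderiv ℝ f y timeVec :=
    (hf.continuous_fderiv one_ne_zero).clm_apply continuous_const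
  have i1 := integrable_cone (isKernel_rpow 1) hf.continuous hd (by linarith) (by norm_num)
    (by linarith) x
  have i2 := integrable_cone (isKernel_inner (spacePart x) (k := 2) (q := 3) (by norm_num))
    hf.continuous hd (by linarith) (by norm_num) (by linarith) x
  have i3 := integrable_cone (isKernel_rpow 1) hc (hd1.clm_apply _) (by linarith) (by norm_num)
    (by linarith) x
  have i4 := integrable_cone (isKernel_inner (spacePart x) (k := 1) (q := 2) (by norm_num))
    hc (hd1.clm_apply _) (by linarith) (by norm_num) (by linarith) x
  have i3' : Integrable fun u : Space =>
      (‖spacePart x‖ * ‖u‖ ^ (-1 : ℝ)) • fderiv ℝ f (x + nul u) timeVec :=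
    (i3.smul ‖spacePart x‖).congr (Eventually.of_forall fun u => (mul_smul _ _ _).symm)
  have e1 := fderiv_ret_apply hp hf hd hd1 x (incl (spacePart x))
  rw [ret_incl hp hf hd hd1] at e1
  have e2 : cone (fun u => ‖u‖ ^ (-1 : ℝ)) (fun y => fderiv ℝ f y timeVec) x =
      fderiv ℝ (ret f) x timeVec := (fderiv_ret_apply hp hf hd hd1 x timeVec).symm
  have e3 : cone (fun u => ‖u‖ ^ (-1 : ℝ)) f x = ret f x := rfl
  have e4 := cone_add_kernel i1 i2
  have e5 := cone_add_kernel (κ := fun u => ‖spacePart x‖ * ‖u‖ ^ (-1 : ℝ))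
    (κ' := fun u => inner ℝ u (spacePart x) * ‖u‖ ^ (-2 : ℝ))
    (f := fun y => fderiv ℝ f y timeVec) (x := x) i3' i4
  have e6 := cone_const_mul ‖spacePart x‖ (fun u => ‖u‖ ^ (-1 : ℝ))
    (fun y => fderiv ℝ f y timeVec) x
  rw [← e6, e2] at e5
  rw [e3] at e4
  rw [← xDeriv_ret_add hp hf hd hd' x, fderiv_self_split, e1, ← e4, ← e5]
  have e7 : retTime x • fderiv ℝ (ret f) x timeVec = x 0 • fderiv ℝ (ret f) x timeVec -
      ‖spacePart x‖ • fderiv ℝ (ret f) x timeVec := sub_smul _ _ _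
  -- Writing x⁰ = s + |𝐱|, with s the retarded time, the term |𝐱| ∂₀ joins the time-derivative part
  -- of the integrated spatial derivative, and `ret f` joins its remaining part. These two pairings
  -- make both kernels vanish at 𝐱 + 𝐮 = 0.
  rw [e7]
  abel

/-! ### The gradient estimate -/

/-- The weight controlling `(1 + |y|) f` on the past light cone of `x`. -/
def coneWeight (ε : ℝ) (x : Spacetime) (u : Space) : ℝ :=
  |retTime x| * (wt 3 (x + nul u) * thetaSq (x + nul u)) + wt (2 + ε) (x + nul u)

lemma pow_mul_wt (n : ℕ) (p : ℝ) (y : Spacetime) : (1 + ‖y‖) ^ n * wt (p + n) y = wt p y := by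
  have h : 0 < 1 + ‖y‖ := by positivity
  unfold wt
  rw [← Real.rpow_natCast, ← Real.rpow_add h]; congr 1; ring

/-- Smallness near the light cone is converted into a factor of the retarded time: timelike points
of the past cone of `x` have distance to the cone at most `|retTime x|`. The prefactor (1 + |y|)ⁿ is
what the vanishing kernels leave over. -/
lemma le_coneWeight {n : ℕ} {ε : ℝ} (hε : 0 ≤ ε) (hε1 : ε ≤ 1) {f : Spacetime → E}
    (hf : Differentiable ℝ f) (h : ConeDecays (2 + n) ε f) (h' : Decays (3 + n) (fderiv ℝ f)) :
    ∃ C : ℝ, 0 ≤ C ∧ ∀ x u, (1 + ‖x + nul u‖) ^ n * ‖f (x + nul u)‖ ≤ C * coneWeight ε x u := by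
  obtain ⟨C, hC, hb⟩ := coneDecays_dist (by positivity) hε hε1 hf h (by convert h' using 1; ring)
  refine ⟨C, hC, fun x u => ?_⟩
  set y := x + nul u
  have h1 := pow_mul_wt n 3 y
  have h2 := pow_mul_wt n (2 + ε) y
  have h3 := thetaSq_nonneg y
  have h4 := timelike_dist_le x u
  calc (1 + ‖y‖) ^ n * ‖f y‖ ≤ (1 + ‖y‖) ^ n * (C * (wt (2 + n + 1) y * thetaSq y *
        (|y 0| - ‖spacePart y‖) + wt (2 + n + ε) y)) := by gcongr; exact hb y
    _ = C * ((((1 + ‖y‖) ^ n * wt (3 + n) y) * thetaSq y) * (|y 0| - ‖spacePart y‖) +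
        (1 + ‖y‖) ^ n * wt (2 + ε + n) y) := by
      rw [show (2 : ℝ) + n + 1 = 3 + n by ring, show (2 : ℝ) + n + ε = 2 + ε + n by ring]; ring
    _ ≤ C * (wt 3 y * thetaSq y * |retTime x| + wt (2 + ε) y) := by
      rw [h1, h2]
      have := wt_nonneg 3 y
      gcongr
    _ = _ := by unfold coneWeight; ring

lemma domInt_coneWeight {ε : ℝ} (hε : 0 < ε) (hε1 : ε < 1) :
    ∃ C : ℝ, 0 ≤ C ∧ ∀ x, NearCone x →
      DomInt (fun u => ‖u‖ ^ (-2 : ℝ) * coneWeight ε x u)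
        (C * (|retTime x| * wPlus x ^ (-2 : ℝ) + wPlus x ^ (-1 - ε))) := by
  obtain ⟨C, hC, h⟩ := domInt_theta_near (k := 2) (by norm_num) (by norm_num)
  obtain ⟨C', hC', h'⟩ := domInt_wt_two_near (k := 2) hε hε1 (by norm_num) (by norm_num)
  refine ⟨C + C', by positivity, fun x hx => ?_⟩
  have hw := wPlus_pos x
  refine (((h x hx).const_mul (abs_nonneg (retTime x))).add (h' x hx)).mono
    (fun u => le_of_eq (by unfold coneWeight; ring)) ?_
  rw [show 1 - 2 - ε = -1 - ε by ring]
  have h1 : 0 ≤ C * wPlus x ^ (-1 - ε) := by positivity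
  have h2 : 0 ≤ C' * (|retTime x| * wPlus x ^ (-2 : ℝ)) := by positivity
  linarith

lemma norm_rpow_neg_one_eq {u : Space} (hu : u ≠ 0) : ‖u‖ ^ (-1 : ℝ) = ‖u‖ ^ (-2 : ℝ) * ‖u‖ := by
  nth_rewrite 3 [← Real.rpow_one ‖u‖]
  rw [← Real.rpow_add (norm_pos_iff.mpr hu)]; norm_num

lemma norm_rpow_neg_two_eq {u : Space} (hu : u ≠ 0) : ‖u‖ ^ (-2 : ℝ) = ‖u‖ ^ (-3 : ℝ) * ‖u‖ := by
  nth_rewrite 3 [← Real.rpow_one ‖u‖]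
  rw [← Real.rpow_add (norm_pos_iff.mpr hu)]; norm_num

lemma kernel_bound_inner (u v : Space) :
    |inner ℝ u v * ‖u‖ ^ (-3 : ℝ)| ≤ ‖v‖ * ‖u‖ ^ (-2 : ℝ) := by
  rcases eq_or_ne u 0 with rfl | hu
  · simp
  rw [abs_mul, abs_of_nonneg (by positivity : 0 ≤ ‖u‖ ^ (-3 : ℝ)), norm_rpow_neg_two_eq hu]
  calc _ ≤ (‖u‖ * ‖v‖) * ‖u‖ ^ (-3 : ℝ) := by gcongr; exact abs_real_inner_le_norm u v
    _ = _ := by ring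

/-- The kernel equals u·(z + u)/|u|³, hence vanishes to first order at u = -z. -/
lemma kernel_bound_radial (z u : Space) :
    |‖u‖ ^ (-1 : ℝ) + inner ℝ u z * ‖u‖ ^ (-3 : ℝ)| ≤ ‖u‖ ^ (-2 : ℝ) * ‖z + u‖ := by
  rcases eq_or_ne u 0 with rfl | hu
  · simp
  have e : ‖u‖ ^ (-1 : ℝ) + inner ℝ u z * ‖u‖ ^ (-3 : ℝ) = inner ℝ u (z + u) * ‖u‖ ^ (-3 : ℝ) := by
    rw [norm_rpow_neg_one_eq hu, norm_rpow_neg_two_eq hu, inner_add_right,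
      real_inner_self_eq_norm_sq]; ring
  rw [e, mul_comm (‖u‖ ^ (-2 : ℝ))]
  exact kernel_bound_inner u (z + u)

/-- Up to |u|⁻² the kernel is |z||u| + u·z = (|z + u|² - (|u| - |z|)²)/2, hence vanishes to second
order at u = -z. -/
lemma kernel_bound_time (z u : Space) :
    |‖z‖ * ‖u‖ ^ (-1 : ℝ) + inner ℝ u z * ‖u‖ ^ (-2 : ℝ)| ≤ ‖u‖ ^ (-2 : ℝ) * ‖z + u‖ ^ 2 := by
  rcases eq_or_ne u 0 with rfl | hu
  · simp
  have e : ‖z‖ * ‖u‖ ^ (-1 : ℝ) + inner ℝ u z * ‖u‖ ^ (-2 : ℝ) =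
      ‖u‖ ^ (-2 : ℝ) * (‖z‖ * ‖u‖ + inner ℝ u z) := by
    rw [norm_rpow_neg_one_eq hu]; ring
  rw [e, abs_mul, abs_of_nonneg (by positivity : 0 ≤ ‖u‖ ^ (-2 : ℝ))]
  gcongr
  have h1 := abs_real_inner_le_norm u z
  have h2 := norm_add_sq_real u z
  rw [add_comm u z] at h2
  rw [abs_of_nonneg (by linarith [neg_abs_le (inner ℝ u z)])]
  nlinarith [sq_nonneg (‖u‖ - ‖z‖), sq_nonneg ‖z + u‖]

/-- The vector u + |u| z/|z| vanishes to first order at u = -z. The kernel belongs to the derivative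
along v plus (z·v/|z|) times the time derivative, the combination tangent to the outgoing cone,
which gives the spatial derivatives once ∂₀ is known. -/
lemma kernel_bound_direction {z : Space} (hz : z ≠ 0) (u v : Space) :
    |inner ℝ u v * ‖u‖ ^ (-2 : ℝ) + ‖z‖⁻¹ * inner ℝ z v * ‖u‖ ^ (-1 : ℝ)| ≤
      2 * ‖v‖ * (‖u‖ ^ (-2 : ℝ) * ‖z + u‖) := by
  rcases eq_or_ne u 0 with rfl | hu
  · simp
  have hz0 := norm_pos_iff.mpr hz
  have e : inner ℝ u v * ‖u‖ ^ (-2 : ℝ) + ‖z‖⁻¹ * inner ℝ z v * ‖u‖ ^ (-1 : ℝ) =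
      ‖u‖ ^ (-2 : ℝ) * inner ℝ (u + (‖u‖ * ‖z‖⁻¹) • z) v := by
    rw [norm_rpow_neg_one_eq hu, inner_add_left, real_inner_smul_left]; ring
  have h1 : ‖u + (‖u‖ * ‖z‖⁻¹) • z‖ ≤ 2 * ‖z + u‖ := by
    have e2 : u + (‖u‖ * ‖z‖⁻¹) • z = (z + u) + ((‖u‖ - ‖z‖) * ‖z‖⁻¹) • z := by
      rw [sub_mul, mul_inv_cancel₀ hz0.ne']; module
    have h3 := abs_norm_sub_norm_le u (-z)
    rw [norm_neg, sub_neg_eq_add, add_comm u z] at h3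
    rw [e2]
    refine (norm_add_le _ _).trans ?_
    rw [norm_smul, norm_mul, norm_inv, norm_norm, Real.norm_eq_abs, mul_assoc,
      inv_mul_cancel₀ hz0.ne', mul_one]
    linarith
  rw [e, abs_mul, abs_of_nonneg (by positivity : 0 ≤ ‖u‖ ^ (-2 : ℝ))]
  calc _ ≤ ‖u‖ ^ (-2 : ℝ) * (‖u + (‖u‖ * ‖z‖⁻¹) • z‖ * ‖v‖) := by
        gcongr; exact abs_real_inner_le_norm _ _
    _ ≤ ‖u‖ ^ (-2 : ℝ) * ((2 * ‖z + u‖) * ‖v‖) := by gcongr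
    _ = _ := by ring

/-- A cone integral whose kernel and integrand match the cone weight. -/
lemma norm_cone_le_of_weight {ε C M b : ℝ} (hM : 0 ≤ M) (hC : 0 ≤ C) {κ : Space → ℝ}
    {f : Spacetime → E} {x : Spacetime} {n : ℕ}
    (hκ : ∀ u, |κ u| ≤ M * (‖u‖ ^ (-2 : ℝ) * (1 + ‖x + nul u‖) ^ n))
    (hf : ∀ u, (1 + ‖x + nul u‖) ^ n * ‖f (x + nul u)‖ ≤ C * coneWeight ε x u)
    (hD : DomInt (fun u => ‖u‖ ^ (-2 : ℝ) * coneWeight ε x u) b) :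
    ‖cone κ f x‖ ≤ M * C * b := by
  refine (hD.const_mul (c := M * C) (by positivity)).norm_integral_le fun u => ?_
  rw [norm_smul, Real.norm_eq_abs]
  calc _ ≤ M * (‖u‖ ^ (-2 : ℝ) * (1 + ‖x + nul u‖) ^ n) * ‖f (x + nul u)‖ := by
        gcongr; exact hκ u
    _ = M * (‖u‖ ^ (-2 : ℝ) * ((1 + ‖x + nul u‖) ^ n * ‖f (x + nul u)‖)) := by ring
    _ ≤ M * (‖u‖ ^ (-2 : ℝ) * (C * coneWeight ε x u)) :=
        mul_le_mul_of_nonneg_left (mul_le_mul_of_nonneg_left (hf u) (by positivity)) hM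
    _ = _ := by ring

lemma norm_timeVec : ‖timeVec‖ = 1 := by simp [timeVec]

lemma norm_spacePart_add_le (x : Spacetime) (u : Space) :
    ‖spacePart x + u‖ ≤ 1 + ‖x + nul u‖ := by
  have := norm_spacePart_le (x + nul u)
  rw [spacePart_add, spacePart_nul] at this
  linarith

/-- The gradient near the future light cone, outside its unit neighbourhood. -/
lemma norm_fderiv_ret_near [CompleteSpace E] {ε : ℝ} (hε : 0 < ε) (hε1 : ε < 1)
    {f : Spacetime → E} (hf : ContDiff ℝ 2 f) (h0 : ConeDecays 3 ε f)
    (h1 : ConeDecays 4 ε (fderiv ℝ f)) (h2 : Decays 5 (fderiv ℝ (fderiv ℝ f)))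
    (hg : Decays (3 + ε) fun y => xDeriv f y + (3 : ℝ) • f y) :
    ∃ C : ℝ, 0 ≤ C ∧ ∀ x, NearCone x → 1 ≤ |retTime x| → ‖fderiv ℝ (ret f) x‖ ≤
      C * (wPlus x ^ (-2 : ℝ) + wPlus x ^ (-1 : ℝ) * (1 + |retTime x|) ^ (-(1 + ε))) := by
  have hf1 : ContDiff ℝ 1 f := hf.of_le (by norm_num)
  have hf' : ContDiff ℝ 1 (fderiv ℝ f) := hf.fderiv_right (by norm_num)
  have hd0 := h0.decays hε.le
  have hd1 : Decays (3 + 1) (fderiv ℝ f) := by convert h1.decays hε.le using 1; norm_num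
  have hd1' : Decays 3 (fderiv ℝ f) := hd1.mono (by norm_num)
  obtain ⟨C₀, hC₀, hb₀⟩ := le_coneWeight (n := 1) hε.le hε1.le (hf1.differentiable one_ne_zero)
    (by convert h0 using 1; norm_num) (by convert hd1 using 1; norm_num)
  obtain ⟨C₁, hC₁, hb₁⟩ := le_coneWeight (n := 2) hε.le hε1.le (hf'.differentiable one_ne_zero)
    (by convert h1 using 1; norm_num) (by convert h2 using 1; norm_num)
  have hbt : ∀ x u, (1 + ‖x + nul u‖) ^ 2 * ‖fderiv ℝ f (x + nul u) timeVec‖ ≤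
      C₁ * coneWeight ε x u := fun x u => by
    refine le_trans ?_ (hb₁ x u)
    gcongr
    simpa [norm_timeVec] using (fderiv ℝ f (x + nul u)).le_opNorm timeVec
  obtain ⟨C₂, hC₂, hD⟩ := domInt_coneWeight hε hε1
  obtain ⟨c, hc, hg⟩ := hg.exists_nonneg
  obtain ⟨C₃, hC₃, hD₃⟩ := domInt_wt_three hε
  set B₀ := c * C₃ + (C₀ + C₁) * C₂ * 2 ^ ε with hB₀
  refine ⟨2 * B₀ + 2 * (C₀ + C₁) * C₂ + 4 * (C₁ + C₀) * C₂ + 2 * (2 * B₀ + 8 * (C₁ + C₀) * C₂ * 2 ^ ε),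
    by positivity, fun x hx ha => ?_⟩
  have hw := wPlus_pos x
  set a := |retTime x| with hadef
  set b := C₂ * (a * wPlus x ^ (-2 : ℝ) + wPlus x ^ (-1 - ε)) with hb
  set q := wPlus x ^ (-1 : ℝ) * (1 + a) ^ (-ε) with hq
  have hDx : DomInt (fun u => ‖u‖ ^ (-2 : ℝ) * coneWeight ε x u) b := hD x hx
  have hr0 : spacePart x ≠ 0 := norm_pos_iff.mp (zero_lt_one.trans hx.1)
  have hret : ‖ret (fun y => xDeriv f y + (3 : ℝ) • f y) x‖ ≤ c * (C₃ * q) :=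
    norm_ret_le (((hD₃ x).const_mul hc).mono (fun u => le_of_eq (by ring)) le_rfl)
      (g := fun y => c * wt (3 + ε) y) hg
  have hwε : wPlus x ^ (-1 - ε) ≤ 2 ^ ε * q := by
    rw [sub_eq_add_neg, Real.rpow_add hw, hq]
    calc _ ≤ wPlus x ^ (-1 : ℝ) * (2 ^ ε * (1 + a) ^ (-ε)) := by
          gcongr
          exact rpow_neg_le_of_le (by positivity) (by norm_num) hε.le (one_add_retTime_le x)
      _ = _ := by ring
  have hq0 : 0 ≤ q := by positivity
  have hbq : b ≤ C₂ * (a * wPlus x ^ (-2 : ℝ)) + C₂ * 2 ^ ε * q := by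
    rw [hb, mul_add, mul_assoc C₂ (2 ^ ε)]; gcongr
  -- the time derivative
  have htime : a * ‖fderiv ℝ (ret f) x timeVec‖ ≤ c * (C₃ * q) + C₀ * b + C₁ * b := by
    have hid := retTime_smul_fderiv (p := 3) (by norm_num) hf1 hd0 hd1 x
    have e : a * ‖fderiv ℝ (ret f) x timeVec‖ = ‖retTime x • fderiv ℝ (ret f) x timeVec‖ := by
      rw [norm_smul, Real.norm_eq_abs]
    rw [e, hid]
    refine (norm_sub_le _ _).trans (add_le_add ((norm_sub_le _ _).trans (add_le_add hret ?_)) ?_)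
    · simpa only [one_mul] using norm_cone_le_of_weight (n := 1) zero_le_one hC₀ (fun u =>
        (kernel_bound_radial (spacePart x) u).trans (by
          rw [one_mul, pow_one]; gcongr; exact norm_spacePart_add_le x u)) (hb₀ x) hDx
    · simpa only [one_mul] using norm_cone_le_of_weight (f := fun y => fderiv ℝ f y timeVec) (n := 2) zero_le_one
        hC₁ (fun u => (kernel_bound_time (spacePart x) u).trans (by
          rw [one_mul]; gcongr; exact norm_spacePart_add_le x u)) (hbt x) hDx
  -- the spatial derivatives
  have hspace : ∀ v : Space, a * ‖fderiv ℝ (ret f) x (incl v)‖ ≤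
      ‖v‖ * (a * ‖fderiv ℝ (ret f) x timeVec‖ + 4 * C₁ * b + 2 * C₀ * b) := by
    intro v
    have hc : Continuous fun y => fderiv ℝ f y timeVec :=
      (hf1.continuous_fderiv one_ne_zero).clm_apply continuous_const
    have hid := fderiv_ret_apply (p := 3) (by norm_num) hf1 hd0 hd1' x (incl v)
    rw [ret_incl (p := 3) (by norm_num) hf1 hd0 hd1'] at hid
    set s := ‖spacePart x‖⁻¹ * inner ℝ (spacePart x) v with hs
    have e2 : s • fderiv ℝ (ret f) x timeVec =
        cone (fun u => s * ‖u‖ ^ (-1 : ℝ)) (fun y => fderiv ℝ f y timeVec) x := by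
      rw [fderiv_ret_apply (p := 3) (by norm_num) hf1 hd0 hd1']
      exact cone_const_mul s (fun u => ‖u‖ ^ (-1 : ℝ)) (fun y => fderiv ℝ f y timeVec) x
    have i4 := integrable_cone (isKernel_inner v (k := 1) (q := 2) (by norm_num))
      hc (hd1'.clm_apply _) (by norm_num) (by norm_num) (by norm_num) x
    have i3 := integrable_cone (isKernel_rpow 1) hc (hd1'.clm_apply _) (by norm_num) (by norm_num)
      (by norm_num) x
    have i3' : Integrable fun u : Space =>
        (s * ‖u‖ ^ (-1 : ℝ)) • fderiv ℝ f (x + nul u) timeVec :=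
      (i3.smul s).congr (Eventually.of_forall fun u => (mul_smul _ _ _).symm)
    have e3 := cone_add_kernel (κ := fun u => inner ℝ u v * ‖u‖ ^ (-2 : ℝ))
      (κ' := fun u => s * ‖u‖ ^ (-1 : ℝ)) (f := fun y => fderiv ℝ f y timeVec) (x := x) i4 i3'
    rw [← e2] at e3
    have e4 : fderiv ℝ (ret f) x (incl v) =
        cone (fun u => inner ℝ u v * ‖u‖ ^ (-2 : ℝ) + s * ‖u‖ ^ (-1 : ℝ))
          (fun y => fderiv ℝ f y timeVec) x +
        cone (fun u => inner ℝ u v * ‖u‖ ^ (-3 : ℝ)) f x - s • fderiv ℝ (ret f) x timeVec := by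
      rw [hid, ← e3]; abel
    have hs1 : |s| ≤ ‖v‖ := by
      rw [hs, abs_mul, abs_inv, abs_norm, inv_mul_le_iff₀ (norm_pos_iff.mpr hr0)]
      exact abs_real_inner_le_norm _ _
    -- Multiplication by the retarded time costs one power of 1 + |y|, so a first-order zero of the
    -- kernel is as good here as the second-order zero in the time derivative.
    have haw : ∀ u, a ≤ 2 * (1 + ‖x + nul u‖) := fun u => by
      linarith [abs_retTime_le x u]
    have k1 : ‖a • cone (fun u => inner ℝ u v * ‖u‖ ^ (-2 : ℝ) + s * ‖u‖ ^ (-1 : ℝ))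
        (fun y => fderiv ℝ f y timeVec) x‖ ≤ 4 * ‖v‖ * C₁ * b := by
      rw [cone_const_mul]
      refine norm_cone_le_of_weight (n := 2) (by positivity) hC₁ (fun u => ?_) (hbt x) hDx
      rw [abs_mul, abs_of_nonneg (abs_nonneg (retTime x) : 0 ≤ a)]
      calc _ ≤ (2 * (1 + ‖x + nul u‖)) * (2 * ‖v‖ * (‖u‖ ^ (-2 : ℝ) * (1 + ‖x + nul u‖))) := by
            gcongr
            · exact haw u
            · exact (kernel_bound_direction hr0 u v).trans (by
                gcongr; exact norm_spacePart_add_le x u)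
        _ = _ := by ring
    have k2 : ‖a • cone (fun u => inner ℝ u v * ‖u‖ ^ (-3 : ℝ)) f x‖ ≤ 2 * ‖v‖ * C₀ * b := by
      rw [cone_const_mul]
      refine norm_cone_le_of_weight (n := 1) (by positivity) hC₀ (fun u => ?_) (hb₀ x) hDx
      rw [abs_mul, abs_of_nonneg (abs_nonneg (retTime x) : 0 ≤ a)]
      calc _ ≤ (2 * (1 + ‖x + nul u‖)) * (‖v‖ * ‖u‖ ^ (-2 : ℝ)) := by
            gcongr
            · exact haw u
            · exact kernel_bound_inner u v
        _ = _ := by ring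
    have k3 : ‖a • (s • fderiv ℝ (ret f) x timeVec)‖ ≤
        ‖v‖ * (a * ‖fderiv ℝ (ret f) x timeVec‖) := by
      rw [norm_smul, norm_smul, Real.norm_eq_abs, Real.norm_eq_abs,
        abs_of_nonneg (abs_nonneg (retTime x) : 0 ≤ a)]
      calc _ ≤ a * (‖v‖ * ‖fderiv ℝ (ret f) x timeVec‖) := by gcongr
        _ = _ := by ring
    have e5 : a * ‖fderiv ℝ (ret f) x (incl v)‖ = ‖a • fderiv ℝ (ret f) x (incl v)‖ := by
      rw [norm_smul, Real.norm_eq_abs, abs_of_nonneg (abs_nonneg (retTime x) : 0 ≤ a)]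
    rw [e5, e4, smul_sub, smul_add]
    refine ((norm_sub_le _ _).trans (add_le_add ((norm_add_le _ _).trans (add_le_add k1 k2))
      k3)).trans (le_of_eq (by ring))
  have ha0 : 0 < a := by linarith
  set D := a * ‖fderiv ℝ (ret f) x timeVec‖ with hDdef
  have hb0 : 0 ≤ b := by positivity
  have hop : ‖fderiv ℝ (ret f) x‖ ≤ a⁻¹ * (2 * D + 4 * C₁ * b + 2 * C₀ * b) := by
    refine ContinuousLinearMap.opNorm_le_bound _ (by positivity) fun v => ?_
    have e : fderiv ℝ (ret f) x v = v 0 • fderiv ℝ (ret f) x timeVec +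
        fderiv ℝ (ret f) x (incl (spacePart v)) := by
      have h := map_add (fderiv ℝ (ret f) x) (v 0 • timeVec) (incl (spacePart v))
      rwa [← point_eq, point_eta, map_smul] at h
    rw [mul_assoc, le_inv_mul_iff₀ ha0, e]
    calc _ ≤ a * (|v 0| * ‖fderiv ℝ (ret f) x timeVec‖ +
          ‖fderiv ℝ (ret f) x (incl (spacePart v))‖) := by
          gcongr
          exact (norm_add_le _ _).trans (by rw [norm_smul, Real.norm_eq_abs])
      _ = |v 0| * D + a * ‖fderiv ℝ (ret f) x (incl (spacePart v))‖ := by rw [hDdef]; ring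
      _ ≤ ‖v‖ * D + ‖v‖ * (D + 4 * C₁ * b + 2 * C₀ * b) := by
          refine add_le_add ?_ ((hspace (spacePart v)).trans ?_)
          · gcongr
            exact abs_time_le v
          · gcongr
            exact norm_spacePart_le v
      _ = _ := by ring
  have hsum : 2 * D + 4 * C₁ * b + 2 * C₀ * b ≤ (2 * B₀ + 2 * (C₀ + C₁) * C₂ + 4 * (C₁ + C₀) * C₂) *
      (a * wPlus x ^ (-2 : ℝ)) + (2 * B₀ + 8 * (C₁ + C₀) * C₂ * 2 ^ ε) * q := by
    have h3 : (C₀ + C₁) * b ≤ (C₀ + C₁) * (C₂ * (a * wPlus x ^ (-2 : ℝ)) + C₂ * 2 ^ ε * q) := by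
      gcongr
    have h4 : 0 ≤ B₀ * (a * wPlus x ^ (-2 : ℝ)) := by positivity
    have h5 : 0 ≤ C₀ * b := by positivity
    have h6 : 0 ≤ (C₀ + C₁) * C₂ * 2 ^ ε * q := by positivity
    rw [hB₀] at h4 ⊢
    nlinarith
  -- Division by the retarded time is harmless because a ≥ 1, and it turns the exponent ε into 1 +
  -- ε.
  have hfin : a⁻¹ * q ≤ 2 * (wPlus x ^ (-1 : ℝ) * (1 + a) ^ (-(1 + ε))) := by
    have h3 : a⁻¹ ≤ 2 * (1 + a) ^ (-1 : ℝ) := by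
      rw [Real.rpow_neg_one, ← div_eq_mul_inv, le_div_iff₀ (by positivity), inv_mul_le_iff₀ ha0]
      linarith
    rw [neg_add, Real.rpow_add (by positivity), hq]
    calc _ ≤ (2 * (1 + a) ^ (-1 : ℝ)) * (wPlus x ^ (-1 : ℝ) * (1 + a) ^ (-ε)) := by gcongr
      _ = _ := by ring
  set P := 2 * B₀ + 2 * (C₀ + C₁) * C₂ + 4 * (C₁ + C₀) * C₂ with hP
  set Q := 2 * B₀ + 8 * (C₁ + C₀) * C₂ * 2 ^ ε with hQ
  have hP0 : 0 ≤ P := by positivity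
  have hQ0 : 0 ≤ Q := by positivity
  calc ‖fderiv ℝ (ret f) x‖ ≤ a⁻¹ * (P * (a * wPlus x ^ (-2 : ℝ)) + Q * q) :=
        hop.trans (by gcongr)
    _ = P * wPlus x ^ (-2 : ℝ) + Q * (a⁻¹ * q) := by field_simp
    _ ≤ P * wPlus x ^ (-2 : ℝ) + Q * (2 * (wPlus x ^ (-1 : ℝ) * (1 + a) ^ (-(1 + ε)))) := by gcongr
    _ ≤ _ := by
        have h7 : 0 ≤ P * (wPlus x ^ (-1 : ℝ) * (1 + a) ^ (-(1 + ε))) := by positivity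
        have h8 : 0 ≤ Q * wPlus x ^ (-2 : ℝ) := by positivity
        linarith

/-- The gradient of the retarded integral of a function with decay of order three, faster outside the light
cone, which is asymptotically homogeneous. -/
lemma norm_fderiv_ret_le [CompleteSpace E] {ε : ℝ} (hε : 0 < ε) (hε1 : ε < 1)
    {f : Spacetime → E} (hf : ContDiff ℝ 2 f) (h0 : ConeDecays 3 ε f)
    (h1 : ConeDecays 4 ε (fderiv ℝ f)) (h2 : Decays 5 (fderiv ℝ (fderiv ℝ f)))
    (hg : Decays (3 + ε) fun y => xDeriv f y + (3 : ℝ) • f y) :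
    ∃ C : ℝ, 0 ≤ C ∧ ∀ x, ‖fderiv ℝ (ret f) x‖ ≤
      C * (1 / wPlus x * (1 / wMinus x ^ (1 + ε) + 1 / wPlus x)) := by
  obtain ⟨C, hC, hnear⟩ := norm_fderiv_ret_near hε hε1 hf h0 h1 h2 hg
  obtain ⟨C', hC', hD⟩ := domInt_theta hε
  have hf1 : ContDiff ℝ 1 f := hf.of_le (by norm_num)
  have hd0 := h0.decays hε.le
  have hd1' : Decays 3 (fderiv ℝ f) := (h1.decays hε.le).mono (by norm_num)
  obtain ⟨c, hc, h1⟩ := h1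
  refine ⟨C + 2 * c * C' * (6 + 2 ^ (1 + ε)), by positivity, fun x => ?_⟩
  have hw := wPlus_pos x
  have hm := one_le_wMinus x
  have hm0 : 0 < wMinus x := by linarith
  have hrw : 1 / wPlus x * (1 / wMinus x ^ (1 + ε) + 1 / wPlus x) =
      wPlus x ^ (-1 : ℝ) * (wMinus x ^ (-(1 + ε)) + wPlus x ^ (-1 : ℝ)) := by
    rw [Real.rpow_neg_one, Real.rpow_neg hm0.le]; simp only [one_div]
  rw [hrw]
  -- A bound free of cancellations: the extra decay of the derivative is traded for one factor of
  -- the retarded time. It suffices when the retarded time controls |x|, and also when it is below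
  -- 1, where `wMinus x` stays below 2; only the remaining region needs `norm_fderiv_ret_near`.
  have hfar : ‖fderiv ℝ (ret f) x‖ ≤ 2 * c * C' * (wPlus x ^ (-1 : ℝ) * (1 + |retTime x|)⁻¹) := by
    rw [fderiv_ret (p := 3) (by norm_num) hf1 hd0 hd1']
    have hDx := (hD x).const_mul (c := 2 * c * (1 + |retTime x|)⁻¹) (by positivity)
    have : ‖ret (fderiv ℝ f) x‖ ≤ 2 * c * (1 + |retTime x|)⁻¹ * (C' * wPlus x ^ (-1 : ℝ)) := by
      refine hDx.norm_integral_le fun u => ?_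
      rw [norm_smul, Real.norm_of_nonneg (by positivity)]
      set y := x + nul u with hy
      have h3 : (1 + ‖y‖)⁻¹ ≤ 2 * (1 + |retTime x|)⁻¹ := by
        rw [← div_eq_mul_inv, le_div_iff₀ (by positivity), inv_mul_le_iff₀ (by positivity)]
        linarith [abs_retTime_le x u]
      have hwt : ∀ p, wt (p + 1) y = (1 + ‖y‖)⁻¹ * wt p y := fun p => by
        rw [← one_add_mul_wt p y]; field_simp
      have h4 : 0 ≤ wt 3 y * thetaSq y + wt (3 + ε) y :=
        add_nonneg (mul_nonneg (wt_nonneg _ _) (thetaSq_nonneg _)) (wt_nonneg _ _)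
      calc _ ≤ ‖u‖ ^ (-1 : ℝ) * (c * (wt 4 y * thetaSq y + wt (4 + ε) y)) := by
            gcongr; exact h1 y
        _ = c * (‖u‖ ^ (-1 : ℝ) * ((1 + ‖y‖)⁻¹ * (wt 3 y * thetaSq y + wt (3 + ε) y))) := by
            rw [show (4 : ℝ) = 3 + 1 by norm_num, show (3 : ℝ) + 1 + ε = (3 + ε) + 1 by ring,
              hwt, hwt]; ring
        _ ≤ c * (‖u‖ ^ (-1 : ℝ) * ((2 * (1 + |retTime x|)⁻¹) *
              (wt 3 y * thetaSq y + wt (3 + ε) y))) := by gcongr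
        _ = _ := by ring
    exact this.trans (le_of_eq (by ring))
  have hmb : wMinus x ^ (-(1 + ε)) ≥ (1 + |retTime x|) ^ (-(1 + ε)) :=
    Real.rpow_le_rpow_of_nonpos hm0 (wMinus_le x) (by linarith)
  have hsmall : ∀ K, K ≤ 6 + 2 ^ (1 + ε) → ‖fderiv ℝ (ret f) x‖ ≤ 2 * c * C' *
      (K * (wPlus x ^ (-1 : ℝ) * (wMinus x ^ (-(1 + ε)) + wPlus x ^ (-1 : ℝ)))) →
      ‖fderiv ℝ (ret f) x‖ ≤ (C + 2 * c * C' * (6 + 2 ^ (1 + ε))) *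
        (wPlus x ^ (-1 : ℝ) * (wMinus x ^ (-(1 + ε)) + wPlus x ^ (-1 : ℝ))) := by
    intro K hK h
    refine h.trans ?_
    rw [← mul_assoc]
    gcongr
    calc 2 * c * C' * K ≤ 2 * c * C' * (6 + 2 ^ (1 + ε)) := by gcongr
      _ ≤ _ := le_add_of_nonneg_left hC
  have hw1 : 0 ≤ wPlus x ^ (-1 : ℝ) := by positivity
  have hwm : 0 ≤ wMinus x ^ (-(1 + ε)) := by positivity
  rcases far_or_near x with hx | hx
  · refine hsmall 6 (by linarith [Real.rpow_pos_of_pos (two_pos : (0:ℝ) < 2) (1 + ε)])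
      (hfar.trans ?_)
    have h3 : (1 + |retTime x|)⁻¹ ≤ 6 * wPlus x ^ (-1 : ℝ) := by
      rw [Real.rpow_neg_one, ← div_eq_mul_inv, le_div_iff₀ hw, inv_mul_le_iff₀ (by positivity)]
      linarith
    gcongr 2 * c * C' * ?_
    calc _ ≤ wPlus x ^ (-1 : ℝ) * (6 * wPlus x ^ (-1 : ℝ)) := by gcongr
      _ ≤ _ := by nlinarith
  · rcases lt_or_ge |retTime x| 1 with ha | ha
    · refine hsmall (2 ^ (1 + ε)) (by linarith) (hfar.trans ?_)
      have h3 : 1 ≤ 2 ^ (1 + ε) * wMinus x ^ (-(1 + ε)) := by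
        have := rpow_neg_le_of_le (a := wMinus x) (b := 1) (c := 2) (p := 1 + ε) hm0 (by norm_num)
          (by linarith) (by linarith [wMinus_le x])
        simpa using this
      gcongr 2 * c * C' * ?_
      have h5 : (1 + |retTime x|)⁻¹ ≤ 1 := inv_le_one_of_one_le₀ (by linarith [abs_nonneg (retTime x)])
      calc _ ≤ wPlus x ^ (-1 : ℝ) * 1 := by gcongr
        _ ≤ wPlus x ^ (-1 : ℝ) * (2 ^ (1 + ε) * wMinus x ^ (-(1 + ε))) := by gcongr
        _ ≤ wPlus x ^ (-1 : ℝ) * (2 ^ (1 + ε) * (wMinus x ^ (-(1 + ε)) + wPlus x ^ (-1 : ℝ))) := by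
            gcongr; linarith
        _ = _ := by ring
    · refine (hnear x hx ha).trans ?_
      have h2 : wPlus x ^ (-2 : ℝ) = wPlus x ^ (-1 : ℝ) * wPlus x ^ (-1 : ℝ) := by
        rw [← Real.rpow_add hw]; norm_num
      rw [h2]
      calc _ ≤ C * (wPlus x ^ (-1 : ℝ) * (wMinus x ^ (-(1 + ε)) + wPlus x ^ (-1 : ℝ))) := by
            gcongr C * ?_
            rw [mul_add, add_comm]
            gcongr
        _ ≤ _ := by
            gcongr
            exact le_add_of_nonneg_right (by positivity)

/-! ### Bounds of retarded integrals -/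

/-- `f ≤ const · B`. -/
def BoundedBy (f B : Spacetime → ℝ) : Prop := ∃ C : ℝ, 0 ≤ C ∧ ∀ x, f x ≤ C * B x

lemma wt_eq_one_div (p : ℝ) (y : Spacetime) : wt p y = 1 / (‖y‖ + 1) ^ p := by
  rw [wt, add_comm, Real.rpow_neg (by positivity), one_div]

lemma coneDecays_iff {p ε : ℝ} {f : Spacetime → E} : ConeDecays p ε f ↔
    ∃ c : ℝ, 0 ≤ c ∧ ∀ y, ‖f y‖ ≤ c * (wt p y * (thetaSq y + wt ε y)) := by
  simp only [ConeDecays, wt_add, mul_add]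

lemma ConeDecays.mono {p q ε : ℝ} {f : Spacetime → E} (h : ConeDecays p ε f) (hq : q ≤ p) :
    ConeDecays q ε f := by
  rw [coneDecays_iff] at *
  obtain ⟨c, hc, h⟩ := h
  refine ⟨c, hc, fun y => (h y).trans ?_⟩
  have := add_nonneg (thetaSq_nonneg y) (wt_nonneg ε y)
  have := wt_anti hq y
  gcongr

lemma boundedBy_ret_cone {p ε : ℝ} (hε : 0 < ε) (hp : 3 ≤ p) {f : Spacetime → E}
    (h : ConeDecays p ε f) : BoundedBy (fun x => ‖ret f x‖) fun x => 1 / wPlus x := by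
  obtain ⟨c, hc, h⟩ := h.mono hp
  obtain ⟨C, hC, hD⟩ := domInt_theta hε
  refine ⟨c * C, by positivity, fun x => ?_⟩
  have := norm_ret_le (((hD x).const_mul hc).mono (fun u => le_of_eq (by ring)) le_rfl)
    (g := fun y => c * (wt 3 y * thetaSq y + wt (3 + ε) y)) h
  rw [Real.rpow_neg_one, ← one_div] at this
  linarith

lemma boundedBy_ret_three {ε : ℝ} (hε : 0 < ε) {f : Spacetime → E} (h : Decays (3 + ε) f) :
    BoundedBy (fun x => ‖ret f x‖) fun x => 1 / (wPlus x * wMinus x ^ ε) := by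
  obtain ⟨c, hc, h⟩ := h.exists_nonneg
  obtain ⟨C, hC, hD⟩ := domInt_wt_three hε
  refine ⟨c * C, by positivity, fun x => ?_⟩
  have := norm_ret_le (((hD x).const_mul hc).mono (fun u => le_of_eq (by ring)) le_rfl)
    (g := fun y => c * wt (3 + ε) y) h
  refine this.trans ?_
  have hw := wPlus_pos x
  have hm : 0 < wMinus x := by linarith [one_le_wMinus x]
  have h2 : (1 + |retTime x|) ^ (-ε) ≤ wMinus x ^ (-ε) :=
    Real.rpow_le_rpow_of_nonpos hm (wMinus_le x) (by linarith)
  calc _ ≤ c * (C * (wPlus x ^ (-1 : ℝ) * wMinus x ^ (-ε))) := by gcongr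
    _ = _ := by rw [Real.rpow_neg_one, Real.rpow_neg hm.le]; field_simp

lemma boundedBy_ret_two {ε : ℝ} (hε : 0 < ε) (hε1 : ε < 1) {f : Spacetime → E}
    (h : Decays (2 + ε) f) : BoundedBy (fun x => ‖ret f x‖) fun x => 1 / wPlus x ^ ε := by
  obtain ⟨c, hc, h⟩ := h.exists_nonneg
  obtain ⟨C, hC, hD⟩ := domInt_wt_two hε hε1
  refine ⟨c * C, by positivity, fun x => ?_⟩
  have := norm_ret_le (((hD x).const_mul hc).mono (fun u => le_of_eq (by ring)) le_rfl)
    (g := fun y => c * wt (2 + ε) y) h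
  rw [Real.rpow_neg (wPlus_pos x).le, ← one_div] at this
  linarith

/-! ### Contraction with the position -/

lemma norm_iteratedFDeriv_id_le (i : ℕ) (y : Spacetime) :
    ‖iteratedFDeriv ℝ i (fun y : Spacetime => y) y‖ ≤ if i = 0 then ‖y‖ else if i = 1 then 1 else 0 := by
  have e : fderiv ℝ (fun y : Spacetime => y) = fun _ => ContinuousLinearMap.id ℝ Spacetime :=
    funext fun y => fderiv_fun_id
  match i with
  | 0 => simp
  | 1 =>
    rw [← norm_iteratedFDeriv_fderiv, e, norm_iteratedFDeriv_zero]
    simp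
  | n + 2 =>
    rw [← norm_iteratedFDeriv_fderiv, e, iteratedFDeriv_succ_const]
    simp

lemma scalarC_eq (G : Spacetime → Spacetime) : scalarC G = fun y => minkL y (G y) :=
  funext fun y => (minkL_apply y (G y)).symm

lemma contDiff_scalarC {n : ℕ} {G : Spacetime → Spacetime} (hG : ContDiff ℝ n G) :
    ContDiff ℝ n (scalarC G) := by
  rw [scalarC_eq]; exact (minkL.contDiff).clm_apply hG

/-- In the Leibniz expansion only orders 0 and 1 of the position survive. For n = 0 the truncated `n
- 1` is harmless, since its term carries the factor n. -/
lemma norm_iteratedFDeriv_scalarC_le {n : ℕ} {G : Spacetime → Spacetime} (hG : ContDiff ℝ n G)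
    (y : Spacetime) : ‖iteratedFDeriv ℝ n (scalarC G) y‖ ≤
      ‖minkL‖ * (‖y‖ * ‖iteratedFDeriv ℝ n G y‖ + n * ‖iteratedFDeriv ℝ (n - 1) G y‖) := by
  rw [scalarC_eq]
  refine (minkL.norm_iteratedFDeriv_le_of_bilinear contDiff_id hG y (n := n) le_rfl).trans ?_
  gcongr
  rw [Finset.sum_range_succ']
  have h0 := norm_iteratedFDeriv_id_le 0 y
  rw [add_comm]
  refine add_le_add ?_ ?_
  · simp
  · calc _ ≤ ∑ i ∈ Finset.range n, if i = 0 then (n : ℝ) * ‖iteratedFDeriv ℝ (n - 1) G y‖ else 0 := by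
          refine Finset.sum_le_sum fun i _ => ?_
          have := norm_iteratedFDeriv_id_le (i + 1) y
          by_cases hi : i = 0
          · subst hi
            simp only [zero_add, if_true, Nat.choose_one_right] at *
            simp only [one_ne_zero, if_false] at this
            calc _ ≤ (n : ℝ) * 1 * ‖iteratedFDeriv ℝ (n - 1) G y‖ := by gcongr; exact this
              _ = _ := by ring
          · simp only [Nat.add_eq_zero_iff, one_ne_zero, and_false, if_false, Nat.add_eq_right, hi]
              at this ⊢
            have h1 : ‖iteratedFDeriv ℝ (i + 1) id y‖ = 0 := le_antisymm this (norm_nonneg _)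
            rw [h1]; simp
      _ ≤ _ := by
          rw [Finset.sum_ite_eq']
          split_ifs <;> [exact le_rfl; positivity]

/-- The contraction with the position lowers the order of decay by one. -/
lemma scalarC_bound {q : ℝ} {m : Spacetime → ℝ} (hm : ∀ y, 0 ≤ m y) {N : ℕ}
    {G : Spacetime → Spacetime} (hG : ContDiff ℝ N G)
    (h : ∀ k ≤ N, ∃ c : ℝ, 0 ≤ c ∧ ∀ y, ‖iteratedFDeriv ℝ k G y‖ ≤ c * (wt (q + k) y * m y))
    {n : ℕ} (hn : n ≤ N) :
    ∃ c : ℝ, 0 ≤ c ∧ ∀ y, ‖iteratedFDeriv ℝ n (scalarC G) y‖ ≤ c * (wt (q - 1 + n) y * m y) := by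
  obtain ⟨c, hc, h1⟩ := h n hn
  obtain ⟨c', hc', h2⟩ := h (n - 1) (by omega)
  refine ⟨‖minkL‖ * (c + n * c'), by positivity, fun y => ?_⟩
  have hmy := hm y
  have hw : ‖y‖ * wt (q + n) y ≤ wt (q - 1 + n) y := by
    rw [← one_add_mul_wt (q - 1 + n), show q - 1 + n + 1 = q + n by ring]
    have := wt_nonneg (q + n) y
    gcongr; linarith
  refine (norm_iteratedFDeriv_scalarC_le (hG.of_le (by exact_mod_cast hn)) y).trans ?_
  rw [mul_assoc]
  gcongr
  rw [add_mul]
  refine add_le_add ?_ ?_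
  · calc _ ≤ ‖y‖ * (c * (wt (q + n) y * m y)) := by gcongr; exact h1 y
      _ = c * ((‖y‖ * wt (q + n) y) * m y) := by ring
      _ ≤ _ := by gcongr
  · rcases n with _ | n
    · simp
    · rw [mul_assoc]
      gcongr
      refine (h2 y).trans (le_of_eq ?_)
      simp only [Nat.add_sub_cancel]
      congr 3; push_cast; ring

/-! ### Conservation -/

lemma divergence_eq {J : Spacetime → Spacetime} (hJ : Differentiable ℝ J) (y : Spacetime) :
    divergence J y = ∑ a, (fderiv ℝ J y (EuclideanSpace.single a 1)) a :=
  Finset.sum_congr rfl fun a _ => fderiv_comp_clm hJ (coordL a) y _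

/-- The vanishing divergence is differentiated along v and the two derivatives are interchanged. -/
lemma sum_second_deriv_eq_zero {J : Spacetime → Spacetime} (hJ : ContDiff ℝ 2 J)
    (hdiv : ∀ x, divergence J x = 0) (y v : Spacetime) :
    ∑ a, (fderiv ℝ (fderiv ℝ J) y (EuclideanSpace.single a 1) v) a = 0 := by
  have hJd := hJ.differentiable two_ne_zero
  have hJ' : Differentiable ℝ (fderiv ℝ J) :=
    (hJ.fderiv_right (m := 1) (by norm_num)).differentiable one_ne_zero
  have hs : IsSymmSndFDerivAt ℝ J y := hJ.contDiffAt.isSymmSndFDerivAt (by simp)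
  have h0 : (fun y => ∑ a, (fderiv ℝ J y (EuclideanSpace.single a 1)) a) = fun _ => (0 : ℝ) :=
    funext fun y => by rw [← divergence_eq hJd, hdiv]
  have hd : HasFDerivAt (fun y => ∑ a, (fderiv ℝ J y (EuclideanSpace.single a 1)) a)
      (∑ a, ((coordL a).comp (ContinuousLinearMap.apply ℝ Spacetime (EuclideanSpace.single a 1))).comp
        (fderiv ℝ (fderiv ℝ J) y)) y :=
    HasFDerivAt.fun_sum fun a _ => by
      have := ((coordL a).comp (ContinuousLinearMap.apply ℝ Spacetime
        (EuclideanSpace.single a (1 : ℝ)))).hasFDerivAt (x := fderiv ℝ J y)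
      exact this.comp y (hJ' y).hasFDerivAt
  rw [h0] at hd
  have h1 := congrArg (fun L => L v) (hd.unique (hasFDerivAt_const (0 : ℝ) y))
  simp only [sum_apply, ContinuousLinearMap.comp_apply, ContinuousLinearMap.apply_apply] at h1
  refine Eq.trans (Finset.sum_congr rfl fun a _ => ?_) h1
  rw [hs.eq]
  rfl

lemma divergence_fderiv {J : Spacetime → Spacetime} (hJ : ContDiff ℝ 2 J)
    (hdiv : ∀ x, divergence J x = 0) (v y : Spacetime) :
    divergence (fun y => fderiv ℝ J y v) y = 0 := by
  have hJ' : ContDiff ℝ 1 (fderiv ℝ J) := hJ.fderiv_right (by norm_num)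
  rw [divergence_eq ((hJ'.clm_apply contDiff_const).differentiable one_ne_zero),
    ← sum_second_deriv_eq_zero hJ hdiv y v]
  exact Finset.sum_congr rfl fun a _ => congrArg (fun w : Spacetime => w a)
    (fderiv_comp_clm (hJ'.differentiable one_ne_zero) (ContinuousLinearMap.apply ℝ Spacetime v) y _)

lemma hasFDerivAt_xDeriv {f : Spacetime → E} (hf : ContDiff ℝ 2 f) (y : Spacetime) :
    HasFDerivAt (xDeriv f) (fderiv ℝ f y + (fderiv ℝ (fderiv ℝ f) y).flip y) y := by
  have hf' : Differentiable ℝ (fderiv ℝ f) :=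
    (hf.fderiv_right (m := 1) (by norm_num)).differentiable one_ne_zero
  have := (hf' y).hasFDerivAt.clm_apply (hasFDerivAt_id y)
  simpa using! this

lemma contDiff_xDeriv {n : ℕ} {f : Spacetime → E} (hf : ContDiff ℝ (n + 1 : ℕ) f) :
    ContDiff ℝ n (xDeriv f) :=
  (hf.fderiv_right (by norm_cast)).clm_apply contDiff_id

/-- The divergence of (x·∇)J is (x·∇ + 1) applied to the divergence of J. Thus the homogeneity
defect of a conserved current is again a conserved current. -/
lemma divergence_xDeriv_add {J : Spacetime → Spacetime} (hJ : ContDiff ℝ 2 J)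
    (hdiv : ∀ x, divergence J x = 0) (c : ℝ) (y : Spacetime) :
    divergence (fun y => xDeriv J y + c • J y) y = 0 := by
  have hJd := hJ.differentiable two_ne_zero
  have h : ∀ y, HasFDerivAt (fun y => xDeriv J y + c • J y)
      (fderiv ℝ J y + (fderiv ℝ (fderiv ℝ J) y).flip y + c • fderiv ℝ J y) y :=
    fun y => (hasFDerivAt_xDeriv hJ y).add ((hJd y).hasFDerivAt.const_smul c)
  have h0 := hdiv y
  rw [divergence_eq hJd] at h0
  have h1 := sum_second_deriv_eq_zero hJ hdiv y y
  rw [divergence_eq fun y => (h y).differentiableAt]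
  rw [(h y).fderiv]
  simp only [add_apply, PiLp.add_apply, ContinuousLinearMap.flip_apply, smul_apply, PiLp.smul_apply,
    Finset.sum_add_distrib, h0, h1, ← Finset.smul_sum]
  simp

/-! ### Retarded potentials of admissible currents -/

lemma norm_fderiv_fderiv (f : Spacetime → E) (y : Spacetime) :
    ‖fderiv ℝ (fderiv ℝ f) y‖ = ‖iteratedFDeriv ℝ 2 f y‖ := by
  rw [← norm_iteratedFDeriv_one, norm_iteratedFDeriv_fderiv]

lemma decays_fderiv_fderiv {p : ℝ} {f : Spacetime → E} (h : Decays p (iteratedFDeriv ℝ 2 f)) :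
    Decays p (fderiv ℝ (fderiv ℝ f)) := by
  simpa only [Decays, norm_fderiv_fderiv] using h

/-- The field `(x · ∇ + 3) J`. -/
def homDefect (J : Spacetime → Spacetime) (y : Spacetime) : Spacetime :=
  xDeriv J y + (3 : ℝ) • J y

lemma AdmissibleCurrent.weight {ε : ℝ} {J : Spacetime → Spacetime} (h : AdmissibleCurrent ε J)
    (k : ℕ) (hk : k ≤ 3) : ∃ c : ℝ, 0 ≤ c ∧ ∀ y, ‖iteratedFDeriv ℝ k J y‖ ≤
      c * (wt (3 + k) y * (thetaSq y + wt ε y)) := by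
  obtain ⟨c, hc⟩ := h.decay k hk
  refine ⟨|c|, abs_nonneg c, fun y => (hc y).trans ?_⟩
  have e : (‖y‖ + 1) ^ (3 + k) = (‖y‖ + 1) ^ ((3 : ℝ) + k) := by
    rw [← Real.rpow_natCast]; norm_num
  rw [wt_eq_one_div, wt_eq_one_div, e, div_eq_mul_one_div, mul_assoc]
  have := thetaSq_nonneg y
  gcongr
  exact le_abs_self c

lemma AdmissibleCurrent.homWeight {ε : ℝ} {J : Spacetime → Spacetime}
    (h : AdmissibleCurrent ε J) (k : ℕ) (hk : k ≤ 2) : ∃ c : ℝ, 0 ≤ c ∧ ∀ y,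
      ‖iteratedFDeriv ℝ k (homDefect J) y‖ ≤ c * (wt (3 + ε + k) y * 1) := by
  obtain ⟨c, hc⟩ := h.homogeneous k hk
  refine ⟨|c|, abs_nonneg c, fun y => (hc y).trans ?_⟩
  rw [wt_eq_one_div, div_eq_mul_one_div, mul_one, show (3 : ℝ) + ε + k = 3 + k + ε by ring]
  gcongr
  exact le_abs_self c

lemma contDiff_homDefect {J : Spacetime → Spacetime} (hJ : ContDiff ℝ 3 J) :
    ContDiff ℝ 2 (homDefect J) :=
  (contDiff_xDeriv (n := 2) (by exact_mod_cast hJ)).add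
    ((hJ.of_le (by norm_num)).const_smul (3 : ℝ))

/-- A bound of all quantities of interest attached to the potential `A`. -/
structure PotentialBounds (ε : ℝ) (A : Spacetime → Spacetime) : Prop where
  contDiff : ContDiff ℝ 3 A
  value : BoundedBy (fun x => ‖A x‖) fun x => 1 / wPlus x
  second : BoundedBy (fun x => ‖iteratedFDeriv ℝ 2 A x‖) fun x => 1 / wPlus x
  scalar : BoundedBy (fun x => ‖fderiv ℝ (scalarC A) x‖) fun x => 1 / wPlus x
  first : BoundedBy (fun x => ‖fderiv ℝ A x‖) fun x =>
    1 / wPlus x * (1 / wMinus x ^ (1 + ε) + 1 / wPlus x)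
  scalarSecond : BoundedBy (fun x => ‖iteratedFDeriv ℝ 2 (scalarC A) x‖) fun x =>
    1 / wPlus x * (1 / wMinus x ^ (1 + ε) + 1 / wPlus x)
  homogeneous : BoundedBy (fun x => ‖xDeriv A x + A x‖) fun x => 1 / (wPlus x * wMinus x ^ ε)
  scalarHom : BoundedBy (fun x => ‖fderiv ℝ (xDeriv (scalarC A)) x‖) fun x =>
    1 / (wPlus x * wMinus x ^ ε)
  scalarX : BoundedBy (fun x => ‖xDeriv (scalarC A) x‖) fun x => 1 / wPlus x ^ ε
  scalarXX : BoundedBy (fun x => ‖xDeriv (xDeriv (scalarC A)) x‖) fun x => 1 / wPlus x ^ ε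

lemma fderiv_scalarC_apply {A : Spacetime → Spacetime} (hA : Differentiable ℝ A)
    (x v : Spacetime) :
    fderiv ℝ (scalarC A) x v = minkL v (A x) + minkL x (fderiv ℝ A x v) := by
  rw [scalarC_eq]
  have := (minkL.hasFDerivAt (x := x)).clm_apply (hA x).hasFDerivAt
  rw [this.fderiv]
  simp [add_comm]

lemma scalarC_homDefect {J : Spacetime → Spacetime} (hJ : Differentiable ℝ J) :
    scalarC (homDefect J) = fun y => xDeriv (scalarC J) y + (2 : ℝ) • scalarC J y := by
  funext y
  rw [xDeriv, fderiv_scalarC_apply hJ]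
  simp only [scalarC, homDefect, ← minkL_apply, map_add, map_smul, smul_eq_mul, xDeriv]
  ring

/-- Differentiation lowers the degree of homogeneity by one, so the gradient of the defect is the
defect of the gradient with the constant raised by one. -/
lemma xDeriv_fderiv_add {c : Spacetime → E} (hc : ContDiff ℝ 2 c) (a : ℝ) (y : Spacetime) :
    fderiv ℝ (fun y => xDeriv c y + a • c y) y =
      xDeriv (fderiv ℝ c) y + (a + 1) • fderiv ℝ c y := by
  have hs : IsSymmSndFDerivAt ℝ c y := hc.contDiffAt.isSymmSndFDerivAt (by simp)
  have h : HasFDerivAt (fun y => xDeriv c y + a • c y) _ y := (hasFDerivAt_xDeriv hc y).add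
    ((hc.differentiable two_ne_zero y).hasFDerivAt.const_smul a)
  rw [h.fderiv]
  ext v
  simp only [add_apply, ContinuousLinearMap.flip_apply, smul_apply, xDeriv]
  rw [hs.eq]
  module

/-- In ∂ᵥC = v·A + x·∂ᵥA the contraction with x is moved under the integral only for the conserved
current ∂ᵥJ, which decays with order four. The identity is therefore available for ∇C although the
order-three decay of J gives none for C itself. -/
lemma fderiv_scalarC_ret {p : ℝ} {J : Spacetime → Spacetime} (hJ : ContDiff ℝ 2 J)
    (hdiv : ∀ x, divergence J x = 0) (hp : 2 < p) (hd : Decays p J) (hd1 : Decays 4 (fderiv ℝ J))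
    (hd2 : Decays 4 (fderiv ℝ (fderiv ℝ J))) (hd' : Decays p (fderiv ℝ J))
    (hc : Decays p (fderiv ℝ (scalarC J))) (x : Spacetime) :
    fderiv ℝ (scalarC (ret J)) x = ret (fderiv ℝ (scalarC J)) x := by
  have hJ1 : ContDiff ℝ 1 J := hJ.of_le (by norm_num)
  have hJ' : ContDiff ℝ 1 (fderiv ℝ J) := hJ.fderiv_right (by norm_num)
  have hJ0 := hJ1.continuous
  have hcont : Continuous (fderiv ℝ (scalarC J)) :=
    (contDiff_scalarC (n := 1) (by exact_mod_cast hJ1)).continuous_fderiv one_ne_zero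
  have hA : Differentiable ℝ (ret J) := fun y =>
    (hasFDerivAt_cone (isKernel_rpow 1) hJ1 hd hd' (by linarith) (by norm_num)
      (by linarith) y).differentiableAt
  ext v
  have hG : ContDiff ℝ 1 fun y => fderiv ℝ J y v := hJ'.clm_apply contDiff_const
  have hGd : Decays 4 fun y => fderiv ℝ J y v := hd1.clm_apply v
  have hGd' : Decays 4 (fderiv ℝ fun y => fderiv ℝ J y v) :=
    Decays.fderiv_clm (hJ'.differentiable one_ne_zero) hd2 (ContinuousLinearMap.apply ℝ Spacetime v)
  have h1 := minkowski_ret one_pos hG (hGd.mono (by norm_num)) (hGd'.mono (by norm_num))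
    (divergence_fderiv hJ hdiv v) x
  have e2 : ret (fderiv ℝ (scalarC J)) x v = ret (fun y => fderiv ℝ (scalarC J) y v) x :=
    ret_clm hp (ContinuousLinearMap.apply ℝ ℝ v) hcont hc x
  rw [fderiv_scalarC_apply hA, fderiv_ret_apply hp hJ1 hd hd', minkL_apply x, h1, e2,
    ret_clm hp (minkL v) hJ0 hd]
  have hs : (fun y => fderiv ℝ (scalarC J) y v) =
      fun y => minkL v (J y) + minkL y (fderiv ℝ J y v) :=
    funext fun y => fderiv_scalarC_apply (hJ1.differentiable one_ne_zero) y v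
  -- The decay is read off from y·∂ᵥJ = ∂ᵥ(y·J) - v·J.
  have hd3 : Decays p fun y => minkL y (fderiv ℝ J y v) := by
    have h3 := (hc.clm_apply v).add ((hd.clm (minkL v)).const_smul (-1))
    refine h3.of_norm_le zero_le_one fun y => le_of_eq ?_
    rw [fderiv_scalarC_apply (hJ1.differentiable one_ne_zero)]
    simp
  rw [hs, ret_add (f := fun y => minkL v (J y)) hp ((minkL v).continuous.comp hJ0)
    (hd.clm (minkL v)) ((minkL.continuous).clm_apply hG.continuous) hd3]
  simp only [minkL_apply]

theorem potentialBounds_ret {ε : ℝ} (hε : 0 < ε) (hε1 : ε < 1) {J : Spacetime → Spacetime}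
    (h : AdmissibleCurrent ε J) : PotentialBounds ε (ret J) := by
  have hJ3 := h.contDiff
  have hJ2 : ContDiff ℝ 2 J := hJ3.of_le (by norm_num)
  have hJ1 : ContDiff ℝ 1 J := hJ3.of_le (by norm_num)
  have hJd := hJ1.differentiable one_ne_zero
  have hw := h.weight
  have hK2 := contDiff_homDefect hJ3
  have hK1 : ContDiff ℝ 1 (homDefect J) := hK2.of_le (by norm_num)
  have hKw := h.homWeight
  have hθ : ∀ y, 0 ≤ thetaSq y + wt ε y := fun y => add_nonneg (thetaSq_nonneg y) (wt_nonneg ε y)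
  -- the decay of the derivatives of the current
  have hcone : ∀ k : ℕ, k ≤ 3 → ConeDecays (3 + k) ε (iteratedFDeriv ℝ k J) := fun k hk =>
    coneDecays_iff.2 (hw k hk)
  have hJ0 : ConeDecays 3 ε J := by
    refine coneDecays_iff.2 ?_
    simpa using hw 0 (by norm_num)
  have hJ1' : ConeDecays 4 ε (fderiv ℝ J) := by
    refine coneDecays_iff.2 ?_
    obtain ⟨c, hc, hb⟩ := hw 1 (by norm_num)
    refine ⟨c, hc, fun y => ?_⟩
    have := hb y
    rw [norm_iteratedFDeriv_one] at this
    norm_num at this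
    exact this
  have hJ2' : ConeDecays 5 ε (fderiv ℝ (fderiv ℝ J)) := by
    refine coneDecays_iff.2 ?_
    obtain ⟨c, hc, hb⟩ := hw 2 (by norm_num)
    refine ⟨c, hc, fun y => ?_⟩
    have := hb y
    rw [← norm_fderiv_fderiv] at this
    norm_num at this
    exact this
  have dJ0 := hJ0.decays hε.le
  have dJ1 := hJ1'.decays hε.le
  have dJ2 := hJ2'.decays hε.le
  -- the contraction of the current with the position
  have hc3 : ContDiff ℝ 3 (scalarC J) := contDiff_scalarC (n := 3) (by exact_mod_cast hJ3)
  have hc2 : ContDiff ℝ 2 (scalarC J) := hc3.of_le (by norm_num)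
  have hcw : ∀ n ≤ 3, ∃ c : ℝ, 0 ≤ c ∧ ∀ y, ‖iteratedFDeriv ℝ n (scalarC J) y‖ ≤
      c * (wt (3 - 1 + n) y * (thetaSq y + wt ε y)) := fun n hn =>
    scalarC_bound (N := 3) hθ (by exact_mod_cast hJ3) hw hn
  have hf0 : ConeDecays 3 ε (fderiv ℝ (scalarC J)) := by
    refine coneDecays_iff.2 ?_
    obtain ⟨c, hc, hb⟩ := hcw 1 (by norm_num)
    refine ⟨c, hc, fun y => ?_⟩
    have := hb y
    rw [norm_iteratedFDeriv_one] at this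
    norm_num at this
    exact this
  have hf1 : ConeDecays 4 ε (fderiv ℝ (fderiv ℝ (scalarC J))) := by
    refine coneDecays_iff.2 ?_
    obtain ⟨c, hc, hb⟩ := hcw 2 (by norm_num)
    refine ⟨c, hc, fun y => ?_⟩
    have := hb y
    rw [← norm_fderiv_fderiv] at this
    norm_num at this
    exact this
  have hf2 : Decays 5 (iteratedFDeriv ℝ 2 (fderiv ℝ (scalarC J))) := by
    refine ConeDecays.decays hε.le (coneDecays_iff.2 ?_)
    obtain ⟨c, hc, hb⟩ := hcw 3 (by norm_num)
    refine ⟨c, hc, fun y => ?_⟩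
    have := hb y
    rw [← norm_iteratedFDeriv_fderiv] at this
    norm_num at this
    exact this
  -- the homogeneity defect
  have dK0 : Decays (3 + ε) (homDefect J) := by
    obtain ⟨c, -, hb⟩ := hKw 0 (by norm_num)
    exact ⟨c, fun y => by simpa using hb y⟩
  have dK1 : Decays (3 + ε) (fderiv ℝ (homDefect J)) := by
    obtain ⟨c, -, hb⟩ := hKw 1 (by norm_num)
    refine Decays.mono (p := 3 + ε + 1) ⟨c, fun y => ?_⟩ (by linarith)
    simpa [norm_iteratedFDeriv_one] using hb y
  have hs1 : ContDiff ℝ 1 (scalarC (homDefect J)) :=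
    contDiff_scalarC (n := 1) (by exact_mod_cast hK1)
  have hsw : ∀ n ≤ 1, ∃ c : ℝ, 0 ≤ c ∧ ∀ y, ‖iteratedFDeriv ℝ n (scalarC (homDefect J)) y‖ ≤
      c * (wt (3 + ε - 1 + n) y * 1) := fun n hn =>
    scalarC_bound (N := 1) (fun _ => zero_le_one) (by exact_mod_cast hK1)
      (fun k hk => hKw k (by omega)) hn
  have ds0 : Decays (2 + ε) (scalarC (homDefect J)) := by
    obtain ⟨c, -, hb⟩ := hsw 0 (by norm_num)
    refine Decays.mono (p := 3 + ε - 1) ⟨c, fun y => ?_⟩ (by linarith)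
    simpa using hb y
  have ds1 : Decays (3 + ε) (fderiv ℝ (scalarC (homDefect J))) := by
    obtain ⟨c, -, hb⟩ := hsw 1 (by norm_num)
    refine Decays.mono (p := 3 + ε - 1 + 1) ⟨c, fun y => ?_⟩ (by linarith)
    simpa [norm_iteratedFDeriv_one] using hb y
  -- the derivatives of the potential
  have hdm : ∀ m ≤ 3, Decays 3 (iteratedFDeriv ℝ m J) := fun m hm =>
    ((hcone m hm).decays hε.le).mono (by simp)
  have hA3 : ContDiff ℝ 3 (ret J) :=
    contDiff_cone (n := 3) (isKernel_rpow 1) (by exact_mod_cast hJ3) hdm (by norm_num) (by norm_num)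
      (by norm_num)
  have hAd := hA3.differentiable three_ne_zero
  have eS : ∀ x, xDeriv (ret J) x + ret J x = ret (homDefect J) x :=
    xDeriv_ret_add (p := 3) (by norm_num) hJ1 dJ0 (dJ1.mono (by norm_num))
  have eC : fderiv ℝ (scalarC (ret J)) = ret (fderiv ℝ (scalarC J)) := funext
    (fderiv_scalarC_ret (p := 3) hJ2 h.conserved (by norm_num) dJ0 dJ1 (dJ2.mono (by norm_num))
      (dJ1.mono (by norm_num)) (hf0.decays hε.le))
  -- Here x·∇C = x·((x·∇ + 1)A), and (x·∇ + 1)A is the retarded integral of a conserved current of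
  -- order 3 + ε, so `minkowski_ret` applies.
  have eX : xDeriv (scalarC (ret J)) = ret (scalarC (homDefect J)) := by
    funext x
    have h1 := minkowski_ret hε hK1 dK0 dK1 (divergence_xDeriv_add hJ2 h.conserved 3) x
    rw [xDeriv, fderiv_scalarC_apply hAd, ← map_add, add_comm]
    exact (congrArg (minkL x) (eS x)).trans ((minkL_apply x _).trans h1)
  have eXX : xDeriv (ret (scalarC (homDefect J))) = ret fun y =>
      xDeriv (scalarC (homDefect J)) y + (2 : ℝ) • scalarC (homDefect J) y :=
    funext (xDeriv_ret (p := 2 + ε) hs1 ds0 (ds1.mono (by linarith)) (by linarith))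
  have eXD : fderiv ℝ (ret (scalarC (homDefect J))) = ret (fderiv ℝ (scalarC (homDefect J))) :=
    funext (fderiv_ret (p := 2 + ε) (by linarith) hs1 ds0 (ds1.mono (by linarith)))
  refine ⟨hA3, boundedBy_ret_cone hε le_rfl hJ0, ?_, ?_, ?_, ?_, ?_, ?_, ?_, ?_⟩
  · have := iteratedFDeriv_cone (n := 3) (isKernel_rpow 1) (by exact_mod_cast hJ3) hdm
      (by norm_num) (by norm_num) (by norm_num) (m := 2) (by norm_num)
    rw [show iteratedFDeriv ℝ 2 (ret J) = ret (iteratedFDeriv ℝ 2 J) from this]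
    exact boundedBy_ret_cone hε (by norm_num) (hcone 2 (by norm_num))
  · rw [eC]
    exact boundedBy_ret_cone hε le_rfl hf0
  · exact norm_fderiv_ret_le hε hε1 hJ2 hJ0 hJ1' dJ2 dK0
  -- The gradient estimate for f = ∇(y·J): its defect (x·∇+3)f is the gradient of (x·∇+2)(y·J) =
  -- y·(x·∇+3)J, which has the required decay.
  · simp_rw [← norm_fderiv_fderiv, eC]
    refine norm_fderiv_ret_le hε hε1 (hc3.fderiv_right (by norm_num)) hf0 hf1
      (decays_fderiv_fderiv hf2) ?_
    refine ds1.of_norm_le zero_le_one fun y => ?_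
    rw [one_mul, scalarC_homDefect hJd, xDeriv_fderiv_add hc2]
    norm_num
  · simp_rw [eS]
    exact boundedBy_ret_three hε dK0
  · rw [eX, eXD]
    exact boundedBy_ret_three hε ds1
  · rw [eX]
    exact boundedBy_ret_two hε hε1 ds0
  · rw [eX, eXX]
    exact boundedBy_ret_two hε hε1 (Decays.add (ds1.mono (by linarith)).xDeriv (ds0.const_smul 2))

/-! ### Differences of potentials -/

lemma BoundedBy.of_le_add {f g h B : Spacetime → ℝ} (hf : BoundedBy f B) (hg : BoundedBy g B)
    (hh : ∀ x, h x ≤ f x + g x) : BoundedBy h B := by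
  obtain ⟨C, hC, hf⟩ := hf
  obtain ⟨C', hC', hg⟩ := hg
  exact ⟨C + C', by positivity, fun x => by linarith [hh x, hf x, hg x, add_mul C C' (B x)]⟩

lemma BoundedBy.norm_sub {f g : Spacetime → E} {B : Spacetime → ℝ}
    (hf : BoundedBy (fun x => ‖f x‖) B) (hg : BoundedBy (fun x => ‖g x‖) B) :
    BoundedBy (fun x => ‖f x - g x‖) B :=
  hf.of_le_add hg fun _ => norm_sub_le _ _

lemma xDeriv_sub {f g : Spacetime → E} (hf : Differentiable ℝ f) (hg : Differentiable ℝ g) :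
    xDeriv (f - g) = xDeriv f - xDeriv g := by
  funext x
  simp [xDeriv, fderiv_sub (hf x) (hg x)]

lemma scalarC_sub (A B : Spacetime → Spacetime) : scalarC (A - B) = scalarC A - scalarC B := by
  simp only [scalarC_eq]
  funext x
  simp

lemma PotentialBounds.sub {ε : ℝ} {A B : Spacetime → Spacetime} (hA : PotentialBounds ε A)
    (hB : PotentialBounds ε B) : PotentialBounds ε (A - B) := by
  have hAd := hA.contDiff.differentiable three_ne_zero
  have hBd := hB.contDiff.differentiable three_ne_zero
  have hcA : ContDiff ℝ 3 (scalarC A) := contDiff_scalarC (n := 3) (by exact_mod_cast hA.contDiff)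
  have hcB : ContDiff ℝ 3 (scalarC B) := contDiff_scalarC (n := 3) (by exact_mod_cast hB.contDiff)
  have hcAd := hcA.differentiable three_ne_zero
  have hcBd := hcB.differentiable three_ne_zero
  have hxA := (contDiff_xDeriv (n := 2) (by exact_mod_cast hcA)).differentiable two_ne_zero
  have hxB := (contDiff_xDeriv (n := 2) (by exact_mod_cast hcB)).differentiable two_ne_zero
  refine ⟨hA.contDiff.sub hB.contDiff, hA.value.norm_sub hB.value, ?_, ?_, ?_, ?_, ?_, ?_, ?_, ?_⟩
  · refine hA.second.of_le_add hB.second fun x => ?_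
    rw [iteratedFDeriv_sub_apply (hA.contDiff.contDiffAt.of_le (by norm_num))
      (hB.contDiff.contDiffAt.of_le (by norm_num))]
    exact norm_sub_le _ _
  · refine hA.scalar.of_le_add hB.scalar fun x => ?_
    rw [scalarC_sub, fderiv_sub (hcAd x) (hcBd x)]
    exact norm_sub_le _ _
  · refine hA.first.of_le_add hB.first fun x => ?_
    rw [fderiv_sub (hAd x) (hBd x)]
    exact norm_sub_le _ _
  · refine hA.scalarSecond.of_le_add hB.scalarSecond fun x => ?_
    rw [scalarC_sub, iteratedFDeriv_sub_apply (hcA.contDiffAt.of_le (by norm_num))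
      (hcB.contDiffAt.of_le (by norm_num))]
    exact norm_sub_le _ _
  · refine hA.homogeneous.of_le_add hB.homogeneous fun x => ?_
    rw [xDeriv_sub hAd hBd, Pi.sub_apply, Pi.sub_apply, sub_add_sub_comm]
    exact norm_sub_le _ _
  · refine hA.scalarHom.of_le_add hB.scalarHom fun x => ?_
    rw [scalarC_sub, xDeriv_sub hcAd hcBd, fderiv_sub (hxA x) (hxB x)]
    exact norm_sub_le _ _
  · refine hA.scalarX.of_le_add hB.scalarX fun x => ?_
    rw [scalarC_sub, xDeriv_sub hcAd hcBd]
    exact norm_sub_le _ _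
  · refine hA.scalarXX.of_le_add hB.scalarXX fun x => ?_
    rw [scalarC_sub, xDeriv_sub hcAd hcBd, xDeriv_sub hxA hxB]
    exact norm_sub_le _ _

/-! ### Time reflection -/

/-- The time reflection of spacetime. -/
def timeRefl : Spacetime ≃ₗᵢ[ℝ] Spacetime :=
  LinearIsometryEquiv.piLpCongrRight 2 fun a : Fin 4 =>
    if a = 0 then LinearIsometryEquiv.neg ℝ else LinearIsometryEquiv.refl ℝ ℝ

lemma timeRefl_apply (x : Spacetime) (a : Fin 4) : timeRefl x a = -(metric a * x a) := by
  rw [timeRefl, LinearIsometryEquiv.piLpCongrRight_apply]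
  by_cases h : a = 0 <;> simp [metric, h]

lemma metric_mul_self (a : Fin 4) : metric a * metric a = 1 := by
  by_cases h : a = 0 <;> simp [metric, h]

lemma timeRefl_timeRefl (x : Spacetime) : timeRefl (timeRefl x) = x := by
  ext a
  rw [timeRefl_apply, timeRefl_apply]
  linear_combination x a * metric_mul_self a

lemma timeRefl_single (a : Fin 4) :
    timeRefl (EuclideanSpace.single a 1) = -metric a • EuclideanSpace.single a 1 := by
  ext b
  rw [timeRefl_apply]
  by_cases h : b = a <;> simp [h]

lemma minkowski_timeRefl (x y : Spacetime) :
    minkowski (timeRefl x) (timeRefl y) = minkowski x y := by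
  refine Finset.sum_congr rfl fun a _ => ?_
  rw [timeRefl_apply, timeRefl_apply]
  linear_combination (metric a * x a * y a) * metric_mul_self a

lemma timeRefl_zero (x : Spacetime) : timeRefl x 0 = -x 0 := by
  simp [timeRefl_apply, metric]

lemma spacePart_timeRefl (x : Spacetime) : spacePart (timeRefl x) = spacePart x := by
  ext i
  fin_cases i <;> simp [spacePart, timeRefl_apply, metric]

lemma wPlus_timeRefl (x : Spacetime) : wPlus (timeRefl x) = wPlus x := by simp [wPlus]

lemma wMinus_timeRefl (x : Spacetime) : wMinus (timeRefl x) = wMinus x := by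
  simp [wMinus, timeRefl_zero, spacePart_timeRefl]

lemma thetaSq_timeRefl (x : Spacetime) : thetaSq (timeRefl x) = thetaSq x := by
  simp [thetaSq, minkowski_timeRefl]

/-- The time reflection of a vector field. -/
def reflected (A : Spacetime → Spacetime) : Spacetime → Spacetime := timeRefl ∘ (A ∘ timeRefl)

lemma fderiv_comp_timeRefl (f : Spacetime → E) (x v : Spacetime) :
    fderiv ℝ (f ∘ timeRefl) x v = fderiv ℝ f (timeRefl x) (timeRefl v) := by
  have := timeRefl.toContinuousLinearEquiv.comp_right_fderiv (f := f) (x := x)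
  exact congrArg (fun L => L v) this

lemma fderiv_reflected (A : Spacetime → Spacetime) (x v : Spacetime) :
    fderiv ℝ (reflected A) x v = timeRefl (fderiv ℝ A (timeRefl x) (timeRefl v)) := by
  rw [reflected, LinearIsometryEquiv.comp_fderiv, ← fderiv_comp_timeRefl]
  rfl

lemma norm_iteratedFDeriv_reflected (k : ℕ) (A : Spacetime → Spacetime) (x : Spacetime) :
    ‖iteratedFDeriv ℝ k (reflected A) x‖ = ‖iteratedFDeriv ℝ k A (timeRefl x)‖ := by
  rw [reflected, LinearIsometryEquiv.norm_iteratedFDeriv_comp_left,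
    LinearIsometryEquiv.norm_iteratedFDeriv_comp_right]

lemma contDiff_reflected {n : ℕ∞} {A : Spacetime → Spacetime} (hA : ContDiff ℝ n A) :
    ContDiff ℝ n (reflected A) :=
  timeRefl.contDiff.comp (hA.comp timeRefl.contDiff)

lemma xDeriv_comp_timeRefl (f : Spacetime → E) : xDeriv (f ∘ timeRefl) = xDeriv f ∘ timeRefl :=
  funext fun x => fderiv_comp_timeRefl f x x

lemma xDeriv_reflected (A : Spacetime → Spacetime) : xDeriv (reflected A) = reflected (xDeriv A) :=
  funext fun x => fderiv_reflected A x x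

lemma scalarC_reflected (A : Spacetime → Spacetime) :
    scalarC (reflected A) = scalarC A ∘ timeRefl := by
  funext x
  have := minkowski_timeRefl (timeRefl x) (A (timeRefl x))
  rwa [timeRefl_timeRefl] at this

/-- Each diagonal term acquires the same sign twice, from the component and from the direction of
differentiation. -/
lemma divergence_reflected {J : Spacetime → Spacetime} (hJ : ContDiff ℝ 1 J) (x : Spacetime) :
    divergence (reflected J) x = divergence J (timeRefl x) := by
  rw [divergence_eq (hJ.differentiable one_ne_zero),
    divergence_eq ((contDiff_reflected (n := 1) hJ).differentiable one_ne_zero)]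
  refine Finset.sum_congr rfl fun a _ => ?_
  rw [fderiv_reflected, timeRefl_apply, timeRefl_single, map_smul, PiLp.smul_apply, smul_eq_mul]
  linear_combination
    (fderiv ℝ J (timeRefl x) (EuclideanSpace.single a 1)) a * metric_mul_self a

lemma AdmissibleCurrent.reflected {ε : ℝ} {J : Spacetime → Spacetime}
    (h : AdmissibleCurrent ε J) : AdmissibleCurrent ε (reflected J) where
  contDiff := contDiff_reflected (n := 3) h.contDiff
  conserved x := by
    rw [divergence_reflected (h.contDiff.of_le (by norm_num)), h.conserved]
  decay k hk := by
    obtain ⟨c, hc⟩ := h.decay k hk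
    refine ⟨c, fun x => ?_⟩
    have := hc (timeRefl x)
    rwa [norm_iteratedFDeriv_reflected, ← thetaSq_timeRefl, ← timeRefl.norm_map x]
  homogeneous k hk := by
    obtain ⟨c, hc⟩ := h.homogeneous k hk
    refine ⟨c, fun x => ?_⟩
    have e : (fun y => xDeriv (ElectroDecay.reflected J) y + (3 : ℝ) • ElectroDecay.reflected J y) =
        ElectroDecay.reflected fun y => xDeriv J y + (3 : ℝ) • J y := by
      rw [xDeriv_reflected]
      funext y
      simp [ElectroDecay.reflected]
    have := hc (timeRefl x)
    rwa [e, norm_iteratedFDeriv_reflected, ← timeRefl.norm_map x]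

lemma BoundedBy.comp_timeRefl {f g B : Spacetime → ℝ} (hf : BoundedBy f B)
    (hB : ∀ x, B (timeRefl x) = B x) (hg : ∀ x, g x = f (timeRefl x)) : BoundedBy g B := by
  obtain ⟨C, hC, hf⟩ := hf
  exact ⟨C, hC, fun x => by rw [hg, ← hB]; exact hf _⟩

lemma PotentialBounds.reflected {ε : ℝ} {A : Spacetime → Spacetime} (h : PotentialBounds ε A) :
    PotentialBounds ε (reflected A) := by
  refine ⟨contDiff_reflected (n := 3) h.contDiff, ?_, ?_, ?_, ?_, ?_, ?_, ?_, ?_, ?_⟩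
  · refine h.value.comp_timeRefl (by simp [wPlus_timeRefl]) fun x => ?_
    exact timeRefl.norm_map _
  · refine h.second.comp_timeRefl (by simp [wPlus_timeRefl]) fun x => ?_
    exact norm_iteratedFDeriv_reflected 2 A x
  · refine h.scalar.comp_timeRefl (by simp [wPlus_timeRefl]) fun x => ?_
    simp only [← norm_iteratedFDeriv_one, scalarC_reflected,
      LinearIsometryEquiv.norm_iteratedFDeriv_comp_right]
  · refine h.first.comp_timeRefl (by simp [wPlus_timeRefl, wMinus_timeRefl]) fun x => ?_
    simp only [← norm_iteratedFDeriv_one, norm_iteratedFDeriv_reflected]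
  · refine h.scalarSecond.comp_timeRefl (by simp [wPlus_timeRefl, wMinus_timeRefl]) fun x => ?_
    simp only [scalarC_reflected, LinearIsometryEquiv.norm_iteratedFDeriv_comp_right]
  · refine h.homogeneous.comp_timeRefl (by simp [wPlus_timeRefl, wMinus_timeRefl]) fun x => ?_
    rw [xDeriv_reflected]
    simp only [ElectroDecay.reflected, Function.comp_apply, ← map_add, timeRefl.norm_map]
  · refine h.scalarHom.comp_timeRefl (by simp [wPlus_timeRefl, wMinus_timeRefl]) fun x => ?_
    simp only [← norm_iteratedFDeriv_one, scalarC_reflected, xDeriv_comp_timeRefl,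
      LinearIsometryEquiv.norm_iteratedFDeriv_comp_right]
  · refine h.scalarX.comp_timeRefl (by simp [wPlus_timeRefl]) fun x => ?_
    simp only [scalarC_reflected, xDeriv_comp_timeRefl, Function.comp_apply]
  · refine h.scalarXX.comp_timeRefl (by simp [wPlus_timeRefl]) fun x => ?_
    simp only [scalarC_reflected, xDeriv_comp_timeRefl, Function.comp_apply]

/-! ### Potentials -/

lemma retarded_eq (J : Spacetime → Spacetime) : retarded J = ret J := by
  funext x
  simp only [retarded, ret, cone, point_sub_norm, Real.rpow_neg_one]

lemma timeRefl_add_nul (x : Spacetime) (u : Space) :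
    timeRefl (timeRefl x + nul u) = point (x 0 + ‖u‖) (spacePart x + u) := by
  refine spacetime_ext ?_ ?_
  · simp [timeRefl_zero]
  · simp [spacePart_timeRefl]

/-- Time reflection carries the past cone of the reflected point to the future cone of the point;
the two reflections of the vector values cancel. -/
lemma advanced_eq (J : Spacetime → Spacetime) : advanced J = reflected (ret (reflected J)) := by
  funext x
  have := isometryEquiv_cone timeRefl (fun u => ‖u‖ ^ (-1 : ℝ)) (J ∘ timeRefl) (timeRefl x)
  change _ = timeRefl (cone _ (fun y => timeRefl ((J ∘ timeRefl) y)) (timeRefl x))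
  rw [this, timeRefl_timeRefl]
  simp only [advanced, cone, Function.comp_apply, timeRefl_add_nul, Real.rpow_neg_one]

theorem potentialBounds_scattering {ε : ℝ} (hε : 0 < ε) (hε1 : ε < 1) {A : Spacetime → Spacetime}
    (hA : ScatteringPotential ε A) : PotentialBounds ε A := by
  obtain ⟨J, Jin, hJ, hin, h⟩ := hA
  -- Written with differences only, to match `PotentialBounds.sub`.
  have e : A = ret J - (reflected (ret (reflected Jin)) - ret Jin) := by
    funext x
    rw [h, radiated, ← advanced_eq, retarded_eq, retarded_eq]
    simp only [Pi.sub_apply]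
    abel
  rw [e]
  exact (potentialBounds_ret hε hε1 hJ).sub
    ((potentialBounds_ret hε hε1 hin.reflected).reflected.sub (potentialBounds_ret hε hε1 hin))

/-! ### The coordinates -/

lemma bracket_pos (v : E) : 0 < bracket v := Real.sqrt_pos.2 (by positivity)

lemma bracket_sq (v : E) : bracket v ^ 2 = ‖v‖ ^ 2 + 1 := Real.sq_sqrt (by positivity)

lemma norm_le_bracket (v : E) : ‖v‖ ≤ bracket v := Real.le_sqrt_of_sq_le (by linarith)

lemma prodB_pos (τ : ℝ) (z : Space) : 0 < prodB τ z := mul_pos (bracket_pos τ) (bracket_pos z)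

lemma ratioB_pos (τ : ℝ) (z : Space) : 0 < ratioB τ z :=
  div_pos (prodB_pos τ z) (add_pos (pow_pos (bracket_pos τ) 2) (pow_pos (bracket_pos z) 2))

lemma wMinus_pos (x : Spacetime) : 0 < wMinus x := zero_lt_one.trans_le (one_le_wMinus x)

/-- Follows from ⟨τ⟩²⟨z⟩² = |x|² + 1 - τ²|𝐳|² ≤ (|x| + 1)². -/
lemma prodB_le_wPlus (τ : ℝ) (z : Space) : prodB τ z ≤ wPlus (coord τ z) := by
  have ha := bracket_pos τ
  have h1 := bracket_sq τ
  have h2 := bracket_sq z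
  have hn : ‖coord τ z‖ ^ 2 = (τ * bracket z) ^ 2 + (bracket τ * ‖z‖) ^ 2 := by
    rw [norm_sq_split, coord, point_zero, spacePart_point, norm_smul, Real.norm_of_nonneg ha.le]
  rw [Real.norm_eq_abs, sq_abs] at h1
  have h3 : (bracket τ * bracket z) ^ 2 = ‖coord τ z‖ ^ 2 + 1 - τ ^ 2 * ‖z‖ ^ 2 := by
    rw [hn, mul_pow, mul_pow, mul_pow, h1, h2]; ring
  have h4 := norm_nonneg (coord τ z)
  refine abs_le_of_sq_le_sq' ?_ (wPlus_pos _).le |>.2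
  rw [prodB, h3, wPlus]
  nlinarith [mul_nonneg (sq_nonneg τ) (sq_nonneg ‖z‖)]

/-- With a = ⟨τ⟩, b = ⟨z⟩ and d = |x⁰| - |𝐱| one has d(|x⁰| + |𝐱|) = a² - b² and |x⁰| + |𝐱| ≤ 2ab.
Hence a² + b² = |a² - b²| + 2 min(a, b)² ≤ 2ab(|d| + 1). -/
lemma one_div_wMinus_le (τ : ℝ) (z : Space) : 1 / wMinus (coord τ z) ≤ 2 * ratioB τ z := by
  have ha := bracket_pos τ
  have hb := bracket_pos z
  have h1 := bracket_sq τ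
  have h2 := bracket_sq z
  have h3 := norm_le_bracket τ
  have h4 := norm_le_bracket z
  rw [Real.norm_eq_abs] at h1 h3
  have hw : wMinus (coord τ z) = |(|τ| * bracket z - bracket τ * ‖z‖)| + 1 := by
    rw [wMinus, coord, point_zero, spacePart_point, norm_smul, Real.norm_of_nonneg ha.le, abs_mul,
      abs_of_pos hb]
  have hp := wMinus_pos (coord τ z)
  rw [ratioB, prodB, ← mul_div_assoc, div_le_div_iff₀ hp (by positivity), one_mul, hw]
  set a := bracket τ
  set b := bracket z
  set d := |τ| * b - a * ‖z‖ with hd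
  have h5 : d * (|τ| * b + a * ‖z‖) = a ^ 2 - b ^ 2 := by
    rw [hd]; linear_combination -(b ^ 2) * h1 + a ^ 2 * h2
  have h6 : |τ| * b + a * ‖z‖ ≤ 2 * (a * b) := by nlinarith
  have h7 : |a ^ 2 - b ^ 2| ≤ |d| * (2 * (a * b)) := by
    rw [← h5, abs_mul, abs_of_nonneg (a := |τ| * b + a * ‖z‖) (by positivity)]
    gcongr
  have h8 := abs_le.1 h7
  rcases le_total a b with h | h <;> nlinarith

lemma one_div_wMinus_rpow_le {p : ℝ} (hp : 0 ≤ p) (hp2 : p ≤ 2) (τ : ℝ) (z : Space) :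
    1 / wMinus (coord τ z) ^ p ≤ 4 * ratioB τ z ^ p := by
  have hr := ratioB_pos τ z
  have h2 : (2 : ℝ) ^ p ≤ 4 := by
    calc (2 : ℝ) ^ p ≤ 2 ^ (2 : ℝ) := Real.rpow_le_rpow_of_exponent_le one_le_two hp2
      _ = 4 := by norm_num
  calc 1 / wMinus (coord τ z) ^ p = (1 / wMinus (coord τ z)) ^ p := by
        rw [Real.div_rpow zero_le_one (wMinus_pos _).le, Real.one_rpow]
    _ ≤ (2 * ratioB τ z) ^ p :=
        Real.rpow_le_rpow (one_div_nonneg.2 (wMinus_pos _).le) (one_div_wMinus_le τ z) hp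
    _ = 2 ^ p * ratioB τ z ^ p := Real.mul_rpow zero_le_two hr.le
    _ ≤ _ := by gcongr

lemma one_div_wPlus_rpow_le {p : ℝ} (hp : 0 ≤ p) (τ : ℝ) (z : Space) :
    1 / wPlus (coord τ z) ^ p ≤ 1 / prodB τ z ^ p :=
  one_div_le_one_div_of_le (Real.rpow_pos_of_pos (prodB_pos τ z) p)
    (Real.rpow_le_rpow (prodB_pos τ z).le (prodB_le_wPlus τ z) hp)

lemma one_div_wPlus_le (τ : ℝ) (z : Space) : 1 / wPlus (coord τ z) ≤ 1 / prodB τ z :=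
  one_div_le_one_div_of_le (prodB_pos τ z) (prodB_le_wPlus τ z)

/-! ### The chains of estimates -/

lemma BoundedBy.chainBound {f B : Spacetime → ℝ} {b : ℝ → Space → ℝ} (h : BoundedBy f B)
    {c : ℝ} (hB : ∀ τ z, B (coord τ z) ≤ c * b τ z) : ChainBound f B b := by
  obtain ⟨C, hC, h⟩ := h
  refine ⟨C, C * c, h, fun τ z => ?_⟩
  rw [mul_assoc]
  exact mul_le_mul_of_nonneg_left (hB τ z) hC

lemma BoundedBy.mono {f B B' : Spacetime → ℝ} (h : BoundedBy f B) (hB : ∀ x, B x ≤ B' x) :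
    BoundedBy f B' := by
  obtain ⟨C, hC, h⟩ := h
  exact ⟨C, hC, fun x => (h x).trans (mul_le_mul_of_nonneg_left (hB x) hC)⟩

lemma BoundedBy.of_le_const_mul {f g B : Spacetime → ℝ} (h : BoundedBy f B) {a : ℝ} (ha : 0 ≤ a)
    (hg : ∀ x, g x ≤ a * f x) : BoundedBy g B := by
  obtain ⟨C, hC, h⟩ := h
  refine ⟨a * C, by positivity, fun x => (hg x).trans ?_⟩
  rw [mul_assoc]
  exact mul_le_mul_of_nonneg_left (h x) ha

lemma BoundedBy.chainBound_wPlus {f : Spacetime → ℝ} (h : BoundedBy f fun x => 1 / wPlus x) :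
    ChainBound f (fun x => 1 / wPlus x) fun τ z => 1 / prodB τ z :=
  h.chainBound (c := 1) fun τ z => by rw [one_mul]; exact one_div_wPlus_le τ z

lemma BoundedBy.chainBound_wMinus {ε : ℝ} (hε : 0 ≤ ε) (hε1 : ε ≤ 1) {f : Spacetime → ℝ}
    (h : BoundedBy f fun x => 1 / (wPlus x * wMinus x ^ ε)) :
    ChainBound f (fun x => 1 / (wPlus x * wMinus x ^ ε))
      fun τ z => 1 / prodB τ z * ratioB τ z ^ ε :=
  h.chainBound (c := 4) fun τ z => by
    have h1 := one_div_wPlus_le τ z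
    have h2 := one_div_wMinus_rpow_le hε (by linarith) τ z
    have := wMinus_pos (coord τ z)
    have := prodB_pos τ z
    calc _ = 1 / wPlus (coord τ z) * (1 / wMinus (coord τ z) ^ ε) := (one_div_mul_one_div _ _).symm
      _ ≤ 1 / prodB τ z * (4 * ratioB τ z ^ ε) := by gcongr
      _ = _ := by ring

lemma BoundedBy.chainBound_rpow {ε : ℝ} (hε : 0 ≤ ε) {f : Spacetime → ℝ}
    (h : BoundedBy f fun x => 1 / wPlus x ^ ε) :
    ChainBound f (fun x => 1 / wPlus x ^ ε)
      fun τ z => 1 / (bracket τ ^ ε * bracket z ^ ε) :=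
  h.chainBound (c := 1) fun τ z => by
    rw [one_mul, ← Real.mul_rpow (bracket_pos τ).le (bracket_pos z).le]
    exact one_div_wPlus_rpow_le hε τ z

lemma BoundedBy.chainBound_first {ε : ℝ} (hε : 0 ≤ ε) (hε1 : ε ≤ 1) {f : Spacetime → ℝ}
    (h : BoundedBy f fun x => 1 / wPlus x * (1 / wMinus x ^ (1 + ε) + 1 / wPlus x)) :
    ChainBound f (fun x => 1 / wPlus x * (1 / wMinus x ^ (1 + ε) + 1 / wPlus x))
      fun τ z => 1 / prodB τ z * (1 / prodB τ z + ratioB τ z ^ (1 + ε)) :=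
  h.chainBound (c := 4) fun τ z => by
    have h1 := one_div_wPlus_le τ z
    have h2 := one_div_wMinus_rpow_le (p := 1 + ε) (by linarith) (by linarith) τ z
    have h0 := one_div_pos.2 (prodB_pos τ z)
    have := one_div_pos.2 (wPlus_pos (coord τ z))
    have := Real.rpow_pos_of_pos (wMinus_pos (coord τ z)) (1 + ε)
    calc _ ≤ 1 / prodB τ z * (4 * ratioB τ z ^ (1 + ε) + 1 / prodB τ z) := by gcongr
      _ ≤ 1 / prodB τ z * (4 * ratioB τ z ^ (1 + ε) + 4 * (1 / prodB τ z)) := by gcongr; linarith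
      _ = _ := by ring

lemma one_div_wPlus_le_sqrt (x : Spacetime) :
    1 / wPlus x ≤ 1 / (wPlus x ^ (1 / 2 : ℝ) * wMinus x ^ (1 / 2 : ℝ)) := by
  have hp := wPlus_pos x
  have hm := wMinus_pos x
  refine one_div_le_one_div_of_le (by positivity) ?_
  calc _ ≤ wPlus x ^ (1 / 2 : ℝ) * wPlus x ^ (1 / 2 : ℝ) := by
        gcongr; exact wMinus_le_wPlus x
    _ = wPlus x := by rw [← Real.rpow_add hp]; norm_num

/-- The input is the sharper bound with 1/`wPlus x`; it is weakened to the geometric mean by `wMinus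
x` ≤ `wPlus x`. -/
lemma BoundedBy.chainBound_second {ε : ℝ} (hε : 0 ≤ ε) (hε1 : ε ≤ 1) {f : Spacetime → ℝ}
    (h : BoundedBy f fun x => 1 / wPlus x * (1 / wMinus x ^ (1 + ε) + 1 / wPlus x)) :
    ChainBound f (fun x => 1 / wPlus x * (1 / wMinus x ^ (1 + ε) +
        1 / (wPlus x ^ (1 / 2 : ℝ) * wMinus x ^ (1 / 2 : ℝ))))
      fun τ z => 1 / prodB τ z * (1 / prodB τ z ^ (1 / 2 : ℝ) * ratioB τ z ^ (1 / 2 : ℝ) +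
        ratioB τ z ^ (1 + ε)) := by
  refine (h.mono fun x => ?_).chainBound (c := 4) fun τ z => ?_
  · have := one_div_pos.2 (wPlus_pos x)
    have := one_div_wPlus_le_sqrt x
    gcongr
  · have h1 := one_div_wPlus_le τ z
    have h2 := one_div_wMinus_rpow_le (p := 1 + ε) (by linarith) (by linarith) τ z
    have h3 := one_div_wMinus_rpow_le (p := 1 / 2) (by norm_num) (by norm_num) τ z
    have h4 := one_div_wPlus_rpow_le (p := 1 / 2) (by norm_num) τ z
    have h0 := prodB_pos τ z
    have hp := wPlus_pos (coord τ z)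
    have hm := wMinus_pos (coord τ z)
    rw [← one_div_mul_one_div]
    calc _ ≤ 1 / prodB τ z * (4 * ratioB τ z ^ (1 + ε) +
          1 / prodB τ z ^ (1 / 2 : ℝ) * (4 * ratioB τ z ^ (1 / 2 : ℝ))) := by gcongr
      _ = _ := by ring

/-! ### The contracted field -/

/-- Since ∇_b C = A_b + x^a ∇_b A_a, the contraction x^a F_ab equals (x·∇ + 1)A_b - ∇_b C. The bound
thus needs no estimate of ∇A. -/
lemma xF_apply {A : Spacetime → Spacetime} (hA : Differentiable ℝ A) (x : Spacetime) (b : Fin 4) :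
    xF A x b = metric b * (xDeriv A x + A x) b -
      fderiv ℝ (scalarC A) x (EuclideanSpace.single b 1) := by
  have hp : ∀ a b, partialD a (fun y => metric b * A y b) x =
      metric b * (fderiv ℝ A x (EuclideanSpace.single a 1)) b := fun a b =>
    fderiv_comp_clm hA (metric b • coordL b) x _
  have hx : (xDeriv A x) b = ∑ a, x a * (fderiv ℝ A x (EuclideanSpace.single a 1)) b := by
    have e : x = ∑ a, x a • EuclideanSpace.single a (1 : ℝ) := by
      ext i
      simp [Pi.single_apply]
    have h := congrArg (fun v => coordL b (fderiv ℝ A x v)) e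
    simp only [map_sum, map_smul, smul_eq_mul] at h
    exact h
  rw [fderiv_scalarC_apply hA, PiLp.add_apply, hx, minkL_apply, minkL_apply]
  simp only [xF, fieldF, hp, minkowski, mul_sub, Finset.sum_sub_distrib]
  have h1 : ∑ a, metric a * (EuclideanSpace.single b (1 : ℝ)) a * A x a = metric b * A x b := by
    simp
  rw [h1, mul_add, Finset.mul_sum]
  have h2 : ∑ a, x a * (metric b * (fderiv ℝ A x (EuclideanSpace.single a 1)) b) =
      ∑ a, metric b * (x a * (fderiv ℝ A x (EuclideanSpace.single a 1)) b) :=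
    Finset.sum_congr rfl fun a _ => by ring
  have h3 : ∑ a, x a * (metric a * (fderiv ℝ A x (EuclideanSpace.single b 1)) a) =
      ∑ a, metric a * x a * (fderiv ℝ A x (EuclideanSpace.single b 1)) a :=
    Finset.sum_congr rfl fun a _ => by ring
  rw [h2, h3]
  ring

lemma norm_le_sum_abs (v : Spacetime) : ‖v‖ ≤ ∑ a, |v a| := by
  refine abs_le_of_sq_le_sq' ?_ (Finset.sum_nonneg fun _ _ => abs_nonneg _) |>.2
  rw [EuclideanSpace.norm_sq_eq]
  exact Finset.sum_sq_le_sq_sum_of_nonneg fun _ _ => abs_nonneg _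

lemma norm_xF_le {A : Spacetime → Spacetime} (hA : Differentiable ℝ A) (x : Spacetime) :
    ‖xF A x‖ ≤ 4 * ‖xDeriv A x + A x‖ + 4 * ‖fderiv ℝ (scalarC A) x‖ := by
  have h : ∀ b, |xF A x b| ≤ ‖xDeriv A x + A x‖ + ‖fderiv ℝ (scalarC A) x‖ := fun b => by
    have hm : |metric b| = 1 := by by_cases hb : b = 0 <;> simp [metric, hb]
    rw [xF_apply hA]
    refine (abs_sub _ _).trans (add_le_add ?_ ?_)
    · rw [abs_mul, hm, one_mul]
      exact PiLp.norm_apply_le (xDeriv A x + A x) b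
    · simpa using (fderiv ℝ (scalarC A) x).le_opNorm (EuclideanSpace.single b 1)
  refine (norm_le_sum_abs _).trans ((Finset.sum_le_sum fun b _ => h b).trans (le_of_eq ?_))
  simp

lemma PotentialBounds.xF {ε : ℝ} (hε : 0 ≤ ε) {A : Spacetime → Spacetime}
    (h : PotentialBounds ε A) : BoundedBy (fun x => ‖xF A x‖) fun x => 1 / wPlus x := by
  have h1 : BoundedBy (fun x => ‖xDeriv A x + A x‖) fun x => 1 / wPlus x :=
    h.homogeneous.mono fun x => one_div_le_one_div_of_le (wPlus_pos x)
      (le_mul_of_one_le_right (wPlus_pos x).le (Real.one_le_rpow (one_le_wMinus x) hε))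
  exact (h1.of_le_const_mul (by norm_num) fun x => le_rfl).of_le_add
    (h.scalar.of_le_const_mul (by norm_num) fun x => le_rfl)
    (norm_xF_le (h.contDiff.differentiable three_ne_zero))

end ElectroDecay

end

theorem theoremI2 (ε : ℝ) (hε₀ : 0 < ε) (hε₁ : ε < 1 / 2)
    (A : ElectroDecay.Spacetime → ElectroDecay.Spacetime)
    (hA : ElectroDecay.ScatteringPotential ε A) :
    ContDiff ℝ 3 A ∧
    (∀ k : ℕ, k = 0 ∨ k = 2 →
      ElectroDecay.ChainBound (fun x => ‖iteratedFDeriv ℝ k A x‖)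
        (fun x => 1 / ElectroDecay.wPlus x)
        (fun τ z => 1 / ElectroDecay.prodB τ z)) ∧
    ElectroDecay.ChainBound (fun x => ‖fderiv ℝ (ElectroDecay.scalarC A) x‖)
      (fun x => 1 / ElectroDecay.wPlus x)
      (fun τ z => 1 / ElectroDecay.prodB τ z) ∧
    ElectroDecay.ChainBound (fun x => ‖fderiv ℝ A x‖)
      (fun x => 1 / ElectroDecay.wPlus x *
        (1 / ElectroDecay.wMinus x ^ (1 + ε) + 1 / ElectroDecay.wPlus x))
      (fun τ z => 1 / ElectroDecay.prodB τ z *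
        (1 / ElectroDecay.prodB τ z + ElectroDecay.ratioB τ z ^ (1 + ε))) ∧
    ElectroDecay.ChainBound (fun x => ‖iteratedFDeriv ℝ 2 (ElectroDecay.scalarC A) x‖)
      (fun x => 1 / ElectroDecay.wPlus x *
        (1 / ElectroDecay.wMinus x ^ (1 + ε) +
          1 / (ElectroDecay.wPlus x ^ (1 / 2 : ℝ) * ElectroDecay.wMinus x ^ (1 / 2 : ℝ))))
      (fun τ z => 1 / ElectroDecay.prodB τ z *
        (1 / ElectroDecay.prodB τ z ^ (1 / 2 : ℝ) * ElectroDecay.ratioB τ z ^ (1 / 2 : ℝ) +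
          ElectroDecay.ratioB τ z ^ (1 + ε))) ∧
    ElectroDecay.ChainBound (fun x => ‖ElectroDecay.xDeriv A x + A x‖)
      (fun x => 1 / (ElectroDecay.wPlus x * ElectroDecay.wMinus x ^ ε))
      (fun τ z => 1 / ElectroDecay.prodB τ z * ElectroDecay.ratioB τ z ^ ε) ∧
    ElectroDecay.ChainBound
      (fun x => ‖fderiv ℝ (ElectroDecay.xDeriv (ElectroDecay.scalarC A)) x‖)
      (fun x => 1 / (ElectroDecay.wPlus x * ElectroDecay.wMinus x ^ ε))
      (fun τ z => 1 / ElectroDecay.prodB τ z * ElectroDecay.ratioB τ z ^ ε) ∧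
    (∀ k : ℕ, k = 1 ∨ k = 2 →
      ElectroDecay.ChainBound
        (fun x => |(ElectroDecay.xDeriv^[k] (ElectroDecay.scalarC A)) x|)
        (fun x => 1 / ElectroDecay.wPlus x ^ ε)
        (fun τ z => 1 / (ElectroDecay.bracket τ ^ ε * ElectroDecay.bracket z ^ ε))) ∧
    ElectroDecay.ChainBound (fun x => ‖ElectroDecay.xF A x‖)
      (fun x => 1 / ElectroDecay.wPlus x)
      (fun τ z => 1 / ElectroDecay.prodB τ z) := by
  have hb := ElectroDecay.potentialBounds_scattering hε₀ (by linarith) hA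
  refine ⟨hb.contDiff, ?_, hb.scalar.chainBound_wPlus, hb.first.chainBound_first hε₀.le (by linarith),
    hb.scalarSecond.chainBound_second hε₀.le (by linarith),
    hb.homogeneous.chainBound_wMinus hε₀.le (by linarith),
    hb.scalarHom.chainBound_wMinus hε₀.le (by linarith), ?_,
    (hb.xF hε₀.le).chainBound_wPlus⟩
  · rintro k (rfl | rfl)
    · simp only [norm_iteratedFDeriv_zero]
      exact hb.value.chainBound_wPlus
    · exact hb.second.chainBound_wPlus
  · rintro k (rfl | rfl)
    · exact hb.scalarX.chainBound_rpow hε₀.le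
    · exact hb.scalarXX.chainBound_rpow hε₀.le
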